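/- **Setting.** Let $Y=\{y\in\mathbb R^{d_y}: a_i^\top y\le b_i,\ 1\le i\le m\}$ be compact with a point satisfying all constraints strictly, $s_i(y)=b_i-a_i^\top y$, $\phi(y)=-\sum_i\log s_i(y)$, and $\|u\|_c^2=\langle\nabla^2\phi(c)u,u\rangle$ for $c\in\operatorname{int}Y$. Let $f,g$ be $C^2$ on $\mathbb R^{d_x}\times\operatorname{int}Y$ with jointly Lipschitz gradients and Hessians, $g(x,\cdot)$ strongly convex with a modulus $\rho_g>0$ independent of $x$, $\|\nabla_xf\|_2,\|\nabla_yf\|_2\le\ell_{f,0}$ and $\|\nabla_xg\|_2\le\ell_{g,0}$. Fix $\mu>0$ and put $\psi_\mu=g+\mu\phi$, $y_\mu^\star(x)=\arg\min_{\operatorname{int}Y}\psi_\mu(x,\cdot)$, $\psi_\mu^\star(x)=\psi_\mu(x,y_\mu^\star(x))$, $F_\mu(x)=f(x,y_\mu^\star(x))$, $L_{\lambda,\mu}(x,y)=f(x,y)+\lambda(\psi_\mu(x,y)-\psi_\mu^\star(x))$, $y_{\lambda,\mu}^\star(x)\in\arg\min_{\operatorname{int}Y}L_{\lambda,\mu}(x,\cdot)$,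 and, for $r>0$, $T_{r,\mu}(x)=\{y\in\operatorname{int}Y:\|y-y_\mu^\star(x)\|_{y_\mu^\star(x)}\le r\}$, $T^\lambda_{r,\mu}(x)=\{y\in\operatorname{int}Y:\|y-y_{\lambda,\mu}^\star(x)\|_{y_{\lambda,\mu}^\star(x)}\le r\}$. **Algorithm.** Given $T\ge1$, $\xi>0$, $(x_0,y_0,z_0)$ and sequences $\alpha_k,\gamma_k,\lambda_k$, set $z_k^{(0)}=z_k$, $y_k^{(0)}=y_k$ and, for $0\le t<T$, $$z_k^{(t+1)}=z_k^{(t)}-\gamma_k\nabla^2\phi(z_k)^{-1}\nabla_y\psi_\mu(x_k,z_k^{(t)}),\qquad y_k^{(t+1)}=y_k^{(t)}-\alpha_k\nabla^2\phi(y_k)^{-1}\nabla_yL_{\lambda_k,\mu}(x_k,y_k^{(t)}),$$ then $z_{k+1}=z_k^{(T)}$, $y_{k+1}=y_k^{(T)}$ and $x_{k+1}=x_k-\xi\alpha_k\bigl[\nabla_xf(x_k,y_{k+1})+\lambda_k(\nabla_x\psi_\mu(x_k,y_{k+1})-\nabla_x\psi_\mu(x_k,z_{k+1}))\bigr]$.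 **Local Dikin constants.** For $\eta\in(0,\tfrac12)$, these are numbers $\rho_\psi,\ell_{\psi,1}>0$, $\ell_{f,0}^\eta,\ell_{f,1}^\eta,\ell_{*,1},\ell_{\lambda,0},L_F\ge0$, $\ell_{*,0}\ge\max\{1,\ell_{\lambda,0}\}$ and $\lambda_\eta>0$ such that, for all $x,x_1,x_2$ and all $\lambda,\lambda_1,\lambda_2\ge\lambda_\eta$: - for each pair $(c,\mathcal T)$ among $(y_\mu^\star(x),T_{2\eta,\mu}(x))$ and $(y_{\lambda,\mu}^\star(x),T^\lambda_{2\eta,\mu}(x))$, and all $y\in\mathcal T$, one has $\rho_\psi\nabla^2\phi(c)\preceq\nabla^2_{yy}\psi_\mu(x,y)\preceq\ell_{\psi,1}\nabla^2\phi(c)$, and in the dual and induced norms of $\|\cdot\|_2$ (for $x$) and $\|\cdot\|_c$ (for $y$), $\|\nabla^2_{xy}\psi_\mu(x,y)\|\le\ell_{\psi,1}$, $\|\nabla_yf(x,y)\|\le\ell_{f,0}^\eta$, $\|\nabla^2_{xy}f(x,y)\|\le\ell^\eta_{f,1}$, $\|\nabla^2_{yy}f(x,y)\|\le\ell^\eta_{f,1}$;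 - $\|y^\star_{\lambda,\mu}(x)-y^\star_\mu(x)\|_{y^\star_\mu(x)}\le 2\ell_{f,0}^\eta/(\rho_\psi\lambda)\le\eta$; - $\|y^\star_{\lambda_2,\mu}(x_2)-y^\star_{\lambda_1,\mu}(x_1)\|_{y^\star_{\lambda_1,\mu}(x_1)}\le\frac{2\ell_{f,0}^\eta}{\rho_\psi}|\lambda_2^{-1}-\lambda_1^{-1}|+\ell_{\lambda,0}\|x_2-x_1\|_2$; - $\|y_\mu^\star(x_2)-y_\mu^\star(x_1)\|_{y_\mu^\star(x_1)}\le\ell_{*,0}\|x_2-x_1\|_2$, the Jacobian satisfies $\|(Dy_\mu^\star(x_2)-Dy_\mu^\star(x_1))u\|_{y_\mu^\star(x_1)}\le\ell_{*,1}\|x_2-x_1\|_2\|u\|_2$ for all $u$, and $\|\nabla F_\mu(x_2)-\nabla F_\mu(x_1)\|_2\le L_F\|x_2-x_1\|_2$. **Valid polynomial schedule** (for $\eta$, local Dikin constants, $T$ and a number $c_\xi>0$). This means positive $\xi,\alpha_0,\gamma_0,\lambda_0,k_0$ with $\lambda_0\ge\lambda_\eta$ such that $\alpha_k=\alpha_0(k+k_0)^{-1/3}$,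 $\gamma_k=\gamma_0$, $\lambda_k=\lambda_0((k+k_0)/k_0)^{1/3}$, $\delta_k=\lambda_{k+1}-\lambda_k$, $\beta_k=\alpha_k\lambda_k$ satisfy, for all $k\ge0$ (bounds with a zero denominator being void), - $\lambda_0\ge\max\{2\ell_{f,1}^\eta/\rho_\psi,\ 8\ell_{f,0}^\eta/(\eta\rho_\psi)\}$, $\ \beta_k\le\gamma_k\le\min\{\frac1{4\ell_{\psi,1}},\frac1{4T\rho_\psi}\}$, $\ \alpha_k\le\frac1{2\xi L_F}$; - $0\le\delta_k/\lambda_k\le\frac{T\rho_\psi}{16}\beta_k$; - $\dfrac\xi T\le\min\Bigl\{\dfrac{\eta\rho_\psi}{16\ell_{*,0}(\ell_{f,0}/\lambda_0+2\ell_{g,0})},\dfrac{\eta\rho_\psi}{64\ell_{\lambda,0}(\ell_{f,0}/\lambda_0+2\ell_{g,0})},\dfrac{c_\xi\rho_\psi}{\max\{\ell_{\psi,1}\ell_{*,0}^2,\ \ell_{*,1}\sqrt{\max(\ell_{g,0}^2,\ell_{f,0}^2)}\}}\Bigr\}$; and $\eta$ is small enough that, with $\theta_\eta=(1-\eta)^{-2}-1$,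 $\theta_\eta\ell_{\psi,1}\le\frac{\rho_\psi}4$ and $\theta_\eta(\lambda_0\ell_{\psi,1}+\ell_{f,1}^\eta)\le\frac{\lambda_0\rho_\psi}8$. **Theorem.** There is an absolute constant $c_\xi>0$ such that, for every problem as above and every $\mu>0$, $F_\mu$ is differentiable and the following hold. 1. For all sufficiently small $\eta>0$ there are local Dikin constants for which a valid polynomial schedule exists for every integer $T\ge1$. 2. Suppose $\inf_xF_\mu(x)>-\infty$. For every $\eta\in(0,\frac12)$, all local Dikin constants, every integer $T\ge1$, every valid polynomial schedule, and every start with $z_0\in T_{\eta,\mu}(x_0)$ and $y_0\in T^{\lambda_0}_{\eta,\mu}(x_0)$, the iterates of the algorithm satisfy: - $z_k^{(t)}\in T_{\eta,\mu}(x_k)$ and $y_k^{(t)}\in T^{\lambda_k}_{\eta,\mu}(x_k)$ for all $k\ge0$ and $0\le t\le T$; - $\min_{0\le k\le K-1}\|\nabla F_\mu(x_k)\|_2^2=\widetilde O(K^{-2/3})$ as $K\to\infty$; - a point $x_k$ with $\|\nabla F_\mu(x_k)\|_2^2\le\epsilon$ is reached after $k=\widetilde O(\epsilon^{-3/2})$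 outer iterations, for $0<\epsilon\le\frac12$. Here $\widetilde O$ hides constant factors and powers of $\log K$, respectively $\log(1/\epsilon)$. -/

import Mathlib

open Filter Asymptotics
open scoped NNReal

noncomputable section

namespace BarrierBilevel

/-- Real Euclidean space of dimension `n`. -/
abbrev Vec (n : ℕ) := EuclideanSpace ℝ (Fin n)

/-- The data of a bilevel problem whose upper variable ranges over all of `ℝ^dx` and whose lower
feasible set is the fixed polytope `Y = {y | aᵢᵀ y ≤ bᵢ for all i}` in `ℝ^dy`. -/
structure Problem (dx dy m : ℕ) where
  /-- upper objective `f(x, y)` -/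
  f : Vec dx → Vec dy → ℝ
  /-- lower objective `g(x, y)` -/
  g : Vec dx → Vec dy → ℝ
  /-- rows of the constraint matrix -/
  a : Fin m → Vec dy
  /-- right-hand side of the constraints -/
  b : Fin m → ℝ

section Objects

variable {dx dy m : ℕ} (P : Problem dx dy m)

/-- The lower feasible set `Y`. -/
def Problem.feasible : Set (Vec dy) := {y | ∀ i, inner ℝ (P.a i) y ≤ P.b i}

/-- The slack `sᵢ(y) = bᵢ - aᵢᵀ y`. -/
def Problem.slack (y : Vec dy) (i : Fin m) : ℝ := P.b i - inner ℝ (P.a i) y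

/-- The strictly feasible points. As soon as there is one, they form the interior of `Y`. -/
def Problem.interiorY : Set (Vec dy) := {y | ∀ i, 0 < P.slack y i}

/-- The region `ℝ^dx × int Y` on which the objectives are evaluated. -/
def Problem.region : Set (Vec dx × Vec dy) := Set.univ ×ˢ P.interiorY

/-- `Y` is compact and full-dimensional (it has a Slater point). -/
structure Problem.IsPolytope : Prop where
  compact : IsCompact P.feasible
  slater : P.interiorY.Nonempty

/-- The partial gradient `∇_x h(x,y)`. -/
def gradX (h : Vec dx → Vec dy → ℝ) (x : Vec dx) (y : Vec dy) : Vec dx :=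
  gradient (fun x' => h x' y) x

/-- The partial gradient `∇_y h(x,y)`. -/
def gradY (h : Vec dx → Vec dy → ℝ) (x : Vec dx) (y : Vec dy) : Vec dy :=
  gradient (fun y' => h x y') y

/-- `vᵀ ∇²_yy h(x,y) u`. -/
def hessYY (h : Vec dx → Vec dy → ℝ) (x : Vec dx) (y : Vec dy) (u v : Vec dy) : ℝ :=
  fderiv ℝ (fun y' => fderiv ℝ (fun y'' => h x y'') y') y u v

/-- `vᵀ ∇²_xy h(x,y) u`, with `u` an `x`-direction and `v` a `y`-direction. -/
def hessXY (h : Vec dx → Vec dy → ℝ) (x : Vec dx) (y : Vec dy) (u : Vec dx) (v : Vec dy) : ℝ :=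
  fderiv ℝ (fun x' => fderiv ℝ (fun y' => h x' y') y) x u v

/-- The regularity assumptions on the objectives: `f`, `g` are `C²` with Lipschitz gradients and
Lipschitz Hessians jointly in `(x, y)`, `g(x, ·)` is strongly convex with a modulus that does not
depend on `x`, and `∇_x f`, `∇_y f` are bounded by `lf0` and `∇_x g` by `lg0`. Only the last two
constants enter the step-size conditions. (The norm of `Vec dx × Vec dy` is the maximum of the two
Euclidean norms; replacing it by the joint Euclidean norm only changes the Lipschitz constants.) -/
structure Problem.Regular (lf0 lg0 : ℝ) : Prop where
  f_smooth : ContDiffOn ℝ 2 (Function.uncurry P.f) P.region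
  g_smooth : ContDiffOn ℝ 2 (Function.uncurry P.g) P.region
  f_grad_lipschitz : ∃ l : ℝ≥0, LipschitzOnWith l (fderiv ℝ (Function.uncurry P.f)) P.region
  g_grad_lipschitz : ∃ l : ℝ≥0, LipschitzOnWith l (fderiv ℝ (Function.uncurry P.g)) P.region
  f_hess_lipschitz : ∃ l : ℝ≥0,
    LipschitzOnWith l (fderiv ℝ (fderiv ℝ (Function.uncurry P.f))) P.region
  g_hess_lipschitz : ∃ l : ℝ≥0,
    LipschitzOnWith l (fderiv ℝ (fderiv ℝ (Function.uncurry P.g))) P.region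
  g_strongConvex : ∃ ρ : ℝ, 0 < ρ ∧ ∀ x, StrongConvexOn P.interiorY ρ (P.g x)
  gradX_f_le : ∀ x, ∀ y ∈ P.interiorY, ‖gradX P.f x y‖ ≤ lf0
  gradY_f_le : ∀ x, ∀ y ∈ P.interiorY, ‖gradY P.f x y‖ ≤ lf0
  gradX_g_le : ∀ x, ∀ y ∈ P.interiorY, ‖gradX P.g x y‖ ≤ lg0

/-- The logarithmic barrier `φ(y) = -∑ᵢ log sᵢ(y)`. -/
def Problem.barrier (y : Vec dy) : ℝ := -∑ i, Real.log (P.slack y i)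

/-- Its Hessian `∇²φ(y) = ∑ᵢ aᵢ aᵢᵀ / sᵢ(y)²`. -/
def Problem.barrierHess (y : Vec dy) : Vec dy →L[ℝ] Vec dy :=
  ∑ i, ((P.slack y i) ^ 2)⁻¹ • (innerSL ℝ (P.a i)).smulRight (P.a i)

/-- The local norm `‖u‖_c = √⟨∇²φ(c) u, u⟩`. -/
def Problem.dikinNorm (c u : Vec dy) : ℝ := Real.sqrt (inner ℝ (P.barrierHess c u) u)

/-- The barrierized lower objective `ψ_μ(x,y) = g(x,y) + μ φ(y)`. -/
def Problem.psi (μ : ℝ) (x : Vec dx) (y : Vec dy) : ℝ := P.g x y + μ * P.barrier y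

/-- A minimizer of `h` over `int Y` (an arbitrary point if there is none). -/
def Problem.argminInterior (h : Vec dy → ℝ) : Vec dy :=
  Classical.epsilon fun y => y ∈ P.interiorY ∧ IsMinOn h P.interiorY y

/-- The exact center `y*_μ(x)`. -/
def Problem.exactCenter (μ : ℝ) (x : Vec dx) : Vec dy := P.argminInterior (P.psi μ x)

/-- The barrierized lower value function `ψ*_μ(x) = min_y ψ_μ(x,y)`. -/
def Problem.psiStar (μ : ℝ) (x : Vec dx) : ℝ := P.psi μ x (P.exactCenter μ x)

/-- The barrier-smoothed objective `F_μ(x) = f(x, y*_μ(x))`. -/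
def Problem.F (μ : ℝ) (x : Vec dx) : ℝ := P.f x (P.exactCenter μ x)

/-- The penalized surrogate `L_{λ,μ}(x,y) = f(x,y) + λ (ψ_μ(x,y) - ψ*_μ(x))`. -/
def Problem.L (lam μ : ℝ) (x : Vec dx) (y : Vec dy) : ℝ :=
  P.f x y + lam * (P.psi μ x y - P.psiStar μ x)

/-- The proxy center `y*_{λ,μ}(x)`. -/
def Problem.proxyCenter (lam μ : ℝ) (x : Vec dx) : Vec dy := P.argminInterior (P.L lam μ x)

/-- The Dikin neighborhood of radius `r` around `c`; with `c = y*_μ(x)` it is `T_{r,μ}(x)`, with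
`c = y*_{λ,μ}(x)` it is `T^λ_{r,μ}(x)`. -/
def Problem.tube (r : ℝ) (c : Vec dy) : Set (Vec dy) :=
  {y | y ∈ P.interiorY ∧ P.dikinNorm c (y - c) ≤ r}

/-! ### The algorithm -/

/-- One inner step of the exact tracker, preconditioned by the frozen metric `∇²φ(z₀)`. -/
def Problem.zStep (μ γ : ℝ) (x : Vec dx) (z₀ z : Vec dy) : Vec dy :=
  z - γ • (P.barrierHess z₀).inverse (gradY (P.psi μ) x z)

/-- One inner step of the proxy tracker, preconditioned by the frozen metric `∇²φ(y₀)`. -/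
def Problem.yStep (μ α lam : ℝ) (x : Vec dx) (y₀ y : Vec dy) : Vec dy :=
  y - α • (P.barrierHess y₀).inverse (gradY (P.L lam μ) x y)

/-- The `t`-th inner iterate of the exact tracker started at `z₀`. -/
def Problem.zInner (μ γ : ℝ) (x : Vec dx) (z₀ : Vec dy) (t : ℕ) : Vec dy :=
  (P.zStep μ γ x z₀)^[t] z₀

/-- The `t`-th inner iterate of the proxy tracker started at `y₀`. -/
def Problem.yInner (μ α lam : ℝ) (x : Vec dx) (y₀ : Vec dy) (t : ℕ) : Vec dy :=
  (P.yStep μ α lam x y₀)^[t] y₀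

/-- The outer direction `q = ∇_x f(x,y) + λ (∇_x ψ_μ(x,y) - ∇_x ψ_μ(x,z))`. -/
def Problem.direction (μ lam : ℝ) (x : Vec dx) (y z : Vec dy) : Vec dx :=
  gradX P.f x y + lam • (gradX (P.psi μ) x y - gradX (P.psi μ) x z)

end Objects

/-- The state `(x_k, y_k, z_k)` at the beginning of an outer iteration. -/
structure State (dx dy : ℕ) where
  x : Vec dx
  y : Vec dy
  z : Vec dy

/-- Algorithmic parameters: inner-loop length `T`, outer ratio `ξ`, and the schedules
`α_k`, `γ_k`, `λ_k`. -/
structure Schedule where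
  T : ℕ
  ξ : ℝ
  α : ℕ → ℝ
  γ : ℕ → ℝ
  lam : ℕ → ℝ

/-- Effective step size of the proxy tracker, `β_k = α_k λ_k`. -/
def Schedule.β (S : Schedule) (k : ℕ) : ℝ := S.α k * S.lam k

/-- Multiplier increment, `δ_k = λ_{k+1} - λ_k`. -/
def Schedule.δ (S : Schedule) (k : ℕ) : ℝ := S.lam (k + 1) - S.lam k

/-- One outer iteration with index `k`. -/
def Problem.outerStep {dx dy m : ℕ} (P : Problem dx dy m) (μ : ℝ) (S : Schedule) (k : ℕ)
    (s : State dx dy) : State dx dy :=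
  let z' := P.zInner μ (S.γ k) s.x s.z S.T
  let y' := P.yInner μ (S.α k) (S.lam k) s.x s.y S.T
  { x := s.x - (S.ξ * S.α k) • P.direction μ (S.lam k) s.x y' z'
    y := y'
    z := z' }

/-- The sequence `(x_k, y_k, z_k)` generated by the algorithm from the initial state `s₀`. -/
def Problem.run {dx dy m : ℕ} (P : Problem dx dy m) (μ : ℝ) (S : Schedule) (s₀ : State dx dy) :
    ℕ → State dx dy
  | 0 => s₀
  | k + 1 => P.outerStep μ S k (P.run μ S s₀ k)

/-! ### Local Dikin constants -/

/-- The local Dikin constants that enter the step-size conditions. -/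
structure DikinConstants where
  /-- lower curvature `ρ_ψ^η` -/
  ρψ : ℝ
  /-- smoothness `ℓ_{ψ,1}^η` -/
  lψ1 : ℝ
  /-- bound `ℓ_{f,0}^η` on `∇_y f` in the dual local norm -/
  lf0 : ℝ
  /-- smoothness `ℓ_{f,1}^η` of `f` -/
  lf1 : ℝ
  /-- Lipschitz constant `ℓ_{*,0}^η` of the exact center -/
  ls0 : ℝ
  /-- Lipschitz constant `ℓ_{*,1}^η` of the Jacobian of the exact center -/
  ls1 : ℝ
  /-- Lipschitz constant `ℓ_{λ,0}^η` of the proxy center in `x` -/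
  ll0 : ℝ
  /-- Lipschitz constant `L_F^η` of `∇F_μ` -/
  LF : ℝ
  /-- threshold `λ_η` of the admissible multiplier range -/
  lamη : ℝ

section Constants

variable {dx dy m : ℕ} (P : Problem dx dy m)

/-- Regularity of `ψ_μ(x, ·)` and `f(x, ·)` on the buffer neighborhood of radius `2η` of the
anchor `c`, in the local norm at `c`. Bounds in dual and induced local norms are written out on
vectors: `‖w‖_{c,*} ≤ l` is `|⟪w, v⟫| ≤ l ‖v‖_c` for all `v`, and so on. -/
structure Problem.LocalBounds (μ η : ℝ) (C : DikinConstants) (x : Vec dx) (c : Vec dy) :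
    Prop where
  curvature : ∀ y ∈ P.tube (2 * η) c, ∀ u,
    C.ρψ * P.dikinNorm c u ^ 2 ≤ hessYY (P.psi μ) x y u u ∧
      hessYY (P.psi μ) x y u u ≤ C.lψ1 * P.dikinNorm c u ^ 2
  psi_cross : ∀ y ∈ P.tube (2 * η) c, ∀ u v,
    |hessXY (P.psi μ) x y u v| ≤ C.lψ1 * ‖u‖ * P.dikinNorm c v
  f_grad : ∀ y ∈ P.tube (2 * η) c, ∀ v,
    |inner ℝ (gradY P.f x y) v| ≤ C.lf0 * P.dikinNorm c v
  f_cross : ∀ y ∈ P.tube (2 * η) c, ∀ u v,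
    |hessXY P.f x y u v| ≤ C.lf1 * ‖u‖ * P.dikinNorm c v
  f_hess : ∀ y ∈ P.tube (2 * η) c, ∀ u v,
    |hessYY P.f x y u v| ≤ C.lf1 * P.dikinNorm c u * P.dikinNorm c v

/-- `C` is a family of local Dikin constants of the problem for the barrier parameter `μ` and the
radius `η`: each constant is a valid bound for the quantity it stands for, uniformly in `x`, around
the exact centers and around the proxy centers with multiplier at least `λ_η`. -/
structure Problem.IsDikinConstants (μ η : ℝ) (C : DikinConstants) : Prop where
  ρψ_pos : 0 < C.ρψ
  lψ1_pos : 0 < C.lψ1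
  lf0_nonneg : 0 ≤ C.lf0
  lf1_nonneg : 0 ≤ C.lf1
  one_le_ls0 : 1 ≤ C.ls0
  ls1_nonneg : 0 ≤ C.ls1
  ll0_nonneg : 0 ≤ C.ll0
  ll0_le_ls0 : C.ll0 ≤ C.ls0
  LF_nonneg : 0 ≤ C.LF
  lamη_pos : 0 < C.lamη
  exact_bounds : ∀ x, P.LocalBounds μ η C x (P.exactCenter μ x)
  proxy_bounds : ∀ lam, C.lamη ≤ lam → ∀ x, P.LocalBounds μ η C x (P.proxyCenter lam μ x)
  proxy_transfer : ∀ lam, C.lamη ≤ lam → ∀ x,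
    P.dikinNorm (P.exactCenter μ x) (P.proxyCenter lam μ x - P.exactCenter μ x) ≤
        2 * C.lf0 / C.ρψ / lam ∧
      2 * C.lf0 / C.ρψ / lam ≤ η
  proxy_stability : ∀ lam₁ lam₂, C.lamη ≤ lam₁ → C.lamη ≤ lam₂ → ∀ x₁ x₂,
    P.dikinNorm (P.proxyCenter lam₁ μ x₁)
        (P.proxyCenter lam₂ μ x₂ - P.proxyCenter lam₁ μ x₁) ≤
      2 * C.lf0 / C.ρψ * |1 / lam₂ - 1 / lam₁| + C.ll0 * ‖x₂ - x₁‖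
  exact_stability : ∀ x₁ x₂,
    P.dikinNorm (P.exactCenter μ x₁) (P.exactCenter μ x₂ - P.exactCenter μ x₁) ≤
      C.ls0 * ‖x₂ - x₁‖
  exact_jacobian : ∀ x₁ x₂ u,
    P.dikinNorm (P.exactCenter μ x₁)
        (fderiv ℝ (P.exactCenter μ) x₂ u - fderiv ℝ (P.exactCenter μ) x₁ u) ≤
      C.ls1 * ‖x₂ - x₁‖ * ‖u‖
  F_smooth : ∀ x₁ x₂, ‖gradient (P.F μ) x₂ - gradient (P.F μ) x₁‖ ≤ C.LF * ‖x₂ - x₁‖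

end Constants

/-- The barrier-aware conditions on the step sizes. Here `lf0`, `lg0` are the Euclidean gradient
bounds and `cξ` is the absolute constant in the last condition. Upper bounds whose denominator may
vanish are cleared of it. -/
structure Schedule.BarrierAware (S : Schedule) (cξ lf0 lg0 η : ℝ) (C : DikinConstants) :
    Prop where
  lam_zero_curvature : 2 * C.lf1 / C.ρψ ≤ S.lam 0
  lam_zero_transfer : 8 * C.lf0 / (η * C.ρψ) ≤ S.lam 0
  β_le_γ : ∀ k, S.β k ≤ S.γ k
  γ_le : ∀ k, S.γ k ≤ min (1 / (4 * C.lψ1)) (1 / (4 * S.T * C.ρψ))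
  α_le : ∀ k, S.α k * (2 * S.ξ * C.LF) ≤ 1
  δ_nonneg : ∀ k, 0 ≤ S.δ k
  δ_le : ∀ k, S.δ k / S.lam k ≤ S.T * C.ρψ / 16 * S.β k
  exact_drift : S.ξ / S.T * (16 * C.ls0 * (lf0 / S.lam 0 + 2 * lg0)) ≤ η * C.ρψ
  proxy_drift : S.ξ / S.T * (64 * C.ll0 * (lf0 / S.lam 0 + 2 * lg0)) ≤ η * C.ρψ
  anchor_switch :
    S.ξ / S.T * max (C.lψ1 * C.ls0 ^ 2) (C.ls1 * Real.sqrt (max (lg0 ^ 2) (lf0 ^ 2))) ≤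
      cξ * C.ρψ

/-- The radius `η` is small enough for the frozen metrics: with `θ_η = (1-η)⁻² - 1`, every
curvature pair `(c₁, c₂)` of a tracker satisfies `θ_η c₂ ≤ c₁ / 4`. The pair of the exact tracker
is `(ρ_ψ, ℓ_{ψ,1})`, that of the proxy tracker `(λ ρ_ψ / 2, λ ℓ_{ψ,1} + ℓ_{f,1})`. -/
def FrozenMetricCondition (η : ℝ) (C : DikinConstants) (lam : ℝ) : Prop :=
  (((1 - η) ^ 2)⁻¹ - 1) * C.lψ1 ≤ C.ρψ / 4 ∧
    (((1 - η) ^ 2)⁻¹ - 1) * (lam * C.lψ1 + C.lf1) ≤ lam * C.ρψ / 2 / 4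

/-- The polynomial profile `α_k = α₀ (k+k₀)^{-1/3}`, `γ_k = γ₀`, `λ_k = λ₀ ((k+k₀)/k₀)^{1/3}`. -/
def polySchedule (T : ℕ) (ξ α₀ γ₀ lam₀ k₀ : ℝ) : Schedule where
  T := T
  ξ := ξ
  α := fun k => α₀ / ((k : ℝ) + k₀) ^ (1 / 3 : ℝ)
  γ := fun _ => γ₀
  lam := fun k => lam₀ * (((k : ℝ) + k₀) / k₀) ^ (1 / 3 : ℝ)

/-- The parameters of the polynomial profile are positive, `λ₀` lies in the admissible multiplier
range, `η` is small enough for the frozen metrics, and the schedule is barrier-aware. -/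
structure ValidPolySchedule (cξ lf0 lg0 η : ℝ) (C : DikinConstants) (T : ℕ)
    (ξ α₀ γ₀ lam₀ k₀ : ℝ) : Prop where
  ξ_pos : 0 < ξ
  α₀_pos : 0 < α₀
  γ₀_pos : 0 < γ₀
  lam₀_pos : 0 < lam₀
  k₀_pos : 0 < k₀
  admissible : C.lamη ≤ lam₀
  frozen : FrozenMetricCondition η C lam₀
  barrierAware : (polySchedule T ξ α₀ γ₀ lam₀ k₀).BarrierAware cξ lf0 lg0 η C

end BarrierBilevel

end

/-! The Dikin norm at `c` is the Euclidean norm of the vector of relative slack changes. Hence its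
open unit ball stays strictly feasible, the metrics at nearby points are equivalent with explicit
factors, and, because `Y` lies in a ball of radius `R`, one has `‖u‖ ≤ R ‖u‖_c` for every interior
`c`. This last bound transfers the Euclidean regularity of `f` and `g` to the local norms, uniformly
in `x`.

Constants. Exact and proxy centers are stationary points of `ψ_μ(x, ·) + p f(x, ·)` with `p = 0` and
`p = 1/λ`. Subtracting two stationarity conditions leaves the symmetrized Bregman divergence of the
barrier, strong convexity of `g` absorbs `p f`, and the divergence bounds the local distance with no
smallness assumption (`Problem.HasBounds.stability`). The coercivity `μ ‖u‖_c²` of the Hessian then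
gives the Jacobian of the exact center and its Lipschitz bound
(`Problem.HasBounds.jacobian_lipschitz`).

Tracking. A step preconditioned by the metric at the anchor contracts by `1 - γρ`; freezing the
metric at the start of the inner loop loses at most `9/16` of that gain (`frozen_step_le`). With `β
= αλ` and `τ = T ρ_ψ β`, the inner loop contracts by `1 - τ/5`, while one outer step moves the
anchors by at most `τη/16`. So the tubes are invariant, and the squared errors contract by `1 - τ/6`
up to `7/τ` times the squared drift (`outerStep_tracking`).

Bias. At the exact and proxy centers the outer direction is within `O(1/λ)` of `∇F_μ`: tested along
the graph of the exact center, the first-order variation of `ψ_μ` vanishes, so the factor `λ` only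
meets an error of order `1/λ²` (`Problem.HasBounds.exists_bias_bound`).

Potential. A combination of `F_μ`, `λ` times the squared tracking errors, and `1/λ` decreases by
`ξα/2 ‖∇F_μ‖²` up to a multiple of `α/λ²` (`potential_step`). The condition with `c_ξ = 1/100` lets
the term `-ξα/4 ‖q‖²` of the descent lemma pay for the drift. Since `αλ` is constant and `λ³` is
linear in `k`, the bias sums like `log K`, whereas `α_k` is at least of order `K^{-1/3}` for `k <
K`; comparison gives the rate, and inverting it gives the complexity. -/

namespace BarrierBilevel

/-! ### Geometry of the Dikin norms and derivatives of the barrier -/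

section Geometry

/-- A weighted pairing of Euclidean vectors is bounded by the largest weight. -/
theorem abs_sum_weight_mul_le {ι : Type*} [Fintype ι] (w : ι → ℝ) (θ : ℝ) (hθ : 0 ≤ θ)
    (hw : ∀ i, |w i| ≤ θ) (x y : EuclideanSpace ℝ ι) :
    |∑ i, w i * (x i * y i)| ≤ θ * ‖x‖ * ‖y‖ := by
  have h1 : |∑ i, w i * (x i * y i)| ≤ θ * ∑ i, |x i| * |y i| := by
    rw [Finset.mul_sum]
    refine (Finset.abs_sum_le_sum_abs _ _).trans (Finset.sum_le_sum fun i _ => ?_)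
    rw [abs_mul, abs_mul]
    exact mul_le_mul_of_nonneg_right (hw i) (by positivity)
  have h2 : ∑ i, |x i| * |y i| ≤ ‖x‖ * ‖y‖ := by
    rw [EuclideanSpace.norm_eq, EuclideanSpace.norm_eq]
    simpa using Real.sum_mul_le_sqrt_mul_sqrt Finset.univ (fun i => |x i|) (fun i => |y i|)
  calc _ ≤ _ := h1
    _ ≤ θ * (‖x‖ * ‖y‖) := mul_le_mul_of_nonneg_left h2 hθ
    _ = _ := by ring

theorem real_inner_eq_mul (x y : ℝ) : inner ℝ x y = x * y := by
  simp [mul_comm]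

variable {dx dy m : ℕ} (P : Problem dx dy m)

/-- The linear map `u ↦ (⟨aᵢ, u⟩ / sᵢ(c))ᵢ`, whose Gram form is the barrier Hessian at `c`. -/
noncomputable def Problem.scaled (c : Vec dy) : Vec dy →L[ℝ] EuclideanSpace ℝ (Fin m) :=
  (EuclideanSpace.equiv (Fin m) ℝ).symm.toContinuousLinearMap ∘L
    ContinuousLinearMap.pi fun i => (P.slack c i)⁻¹ • innerSL ℝ (P.a i)

variable {P}

theorem scaled_apply (c u : Vec dy) (i : Fin m) :
    P.scaled c u i = (P.slack c i)⁻¹ * inner ℝ (P.a i) u := by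
  simp [Problem.scaled]

theorem inner_scaled (c u v : Vec dy) : inner ℝ (P.scaled c u) (P.scaled c v) =
    ∑ i, (P.slack c i)⁻¹ * inner ℝ (P.a i) u * ((P.slack c i)⁻¹ * inner ℝ (P.a i) v) := by
  rw [PiLp.inner_apply]
  refine Finset.sum_congr rfl fun i _ => ?_
  rw [scaled_apply, scaled_apply, real_inner_eq_mul]

theorem inner_barrierHess (c u v : Vec dy) :
    inner ℝ (P.barrierHess c u) v = inner ℝ (P.scaled c u) (P.scaled c v) := by
  simp only [Problem.barrierHess, sum_apply, sum_inner, inner_scaled]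
  refine Finset.sum_congr rfl fun i _ => ?_
  simp only [smul_apply, ContinuousLinearMap.smulRight_apply,
    innerSL_apply_apply, inner_smul_left, conj_trivial]
  ring

theorem dikinNorm_eq (c u : Vec dy) : P.dikinNorm c u = ‖P.scaled c u‖ := by
  rw [Problem.dikinNorm, inner_barrierHess, real_inner_self_eq_norm_sq,
    Real.sqrt_sq (norm_nonneg _)]

theorem dikinNorm_nonneg (c u : Vec dy) : 0 ≤ P.dikinNorm c u := Real.sqrt_nonneg _

theorem slack_sub (y c : Vec dy) (i : Fin m) :
    P.slack y i = P.slack c i - inner ℝ (P.a i) (y - c) := by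
  simp [Problem.slack, inner_sub_right]

/-- Slacks are affine, so no error term appears: the coordinates of `scaled c (y - c)` are exactly
the relative slack changes up to sign. All metric comparisons reduce to scalar ratios through this
identity. -/
theorem slack_div_sub_one {c : Vec dy} (hc : c ∈ P.interiorY) (y : Vec dy) (i : Fin m) :
    P.slack y i / P.slack c i - 1 = -P.scaled c (y - c) i := by
  have := hc i
  rw [scaled_apply, slack_sub y c]
  field_simp
  ring

theorem abs_scaled_apply_le (c u : Vec dy) (i : Fin m) :
    |P.scaled c u i| ≤ P.dikinNorm c u := by
  rw [dikinNorm_eq]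
  exact PiLp.norm_apply_le (P.scaled c u) i

theorem abs_slack_div_sub_one_le {c : Vec dy} (hc : c ∈ P.interiorY) (y : Vec dy) (i : Fin m) :
    |P.slack y i / P.slack c i - 1| ≤ P.dikinNorm c (y - c) := by
  rw [slack_div_sub_one hc, abs_neg]
  exact abs_scaled_apply_le _ _ _

theorem slack_le_of_dikinNorm {c : Vec dy} (hc : c ∈ P.interiorY) {y : Vec dy} {r : ℝ}
    (h : P.dikinNorm c (y - c) ≤ r) (i : Fin m) :
    (1 - r) * P.slack c i ≤ P.slack y i ∧ P.slack y i ≤ (1 + r) * P.slack c i := by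
  have h1 := abs_le.1 ((abs_slack_div_sub_one_le hc y i).trans h)
  have h2 := hc i
  constructor
  · rw [← le_div_iff₀ h2]; linarith
  · rw [← div_le_iff₀ h2]; linarith

/-- No slack can lose its full relative size inside the open Dikin ball of radius one. -/
theorem mem_interiorY_of_dikinNorm {c : Vec dy} (hc : c ∈ P.interiorY) {y : Vec dy}
    (h : P.dikinNorm c (y - c) < 1) : y ∈ P.interiorY := fun i => by
  have := (slack_le_of_dikinNorm hc (le_refl (P.dikinNorm c (y - c))) i).1
  have h2 := hc i
  exact lt_of_lt_of_le (mul_pos (by linarith) h2) this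

theorem mem_tube_iff {c : Vec dy} (hc : c ∈ P.interiorY) {r : ℝ} (hr : r < 1) {y : Vec dy} :
    y ∈ P.tube r c ↔ P.dikinNorm c (y - c) ≤ r :=
  ⟨fun h => h.2, fun h => ⟨mem_interiorY_of_dikinNorm hc (h.trans_lt hr), h⟩⟩

theorem dikinNorm_sub_le (c u v : Vec dy) :
    P.dikinNorm c (u - v) ≤ P.dikinNorm c u + P.dikinNorm c v := by
  simp only [dikinNorm_eq, map_sub]; exact norm_sub_le _ _

theorem dikinNorm_smul (c : Vec dy) (t : ℝ) (u : Vec dy) :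
    P.dikinNorm c (t • u) = |t| * P.dikinNorm c u := by
  simp [dikinNorm_eq, norm_smul]

theorem dikinNorm_le_of_slack_le {c y : Vec dy} (hc : c ∈ P.interiorY) (hy : y ∈ P.interiorY)
    {K : ℝ} (hK : 0 ≤ K) (h : ∀ i, P.slack c i ≤ K * P.slack y i) (u : Vec dy) :
    P.dikinNorm y u ≤ K * P.dikinNorm c u := by
  rw [dikinNorm_eq, dikinNorm_eq, EuclideanSpace.norm_eq, EuclideanSpace.norm_eq]
  refine Real.sqrt_le_iff.2 ⟨by positivity, ?_⟩
  rw [mul_pow, Real.sq_sqrt (Finset.sum_nonneg fun _ _ => by positivity), Finset.mul_sum]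
  refine Finset.sum_le_sum fun i _ => ?_
  rw [← mul_pow]
  refine pow_le_pow_left₀ (norm_nonneg _) ?_ 2
  rw [scaled_apply, scaled_apply, norm_mul, norm_mul, norm_inv, norm_inv, Real.norm_of_nonneg
    (hc i).le, Real.norm_of_nonneg (hy i).le, ← mul_assoc]
  refine mul_le_mul_of_nonneg_right ?_ (norm_nonneg _)
  rw [← div_eq_mul_inv, inv_eq_one_div, div_le_div_iff₀ (hy i) (hc i)]
  linarith [h i]

theorem dikinNorm_le_div {c y : Vec dy} (hc : c ∈ P.interiorY) {r : ℝ} (hr : r < 1)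
    (h : P.dikinNorm c (y - c) ≤ r) (u : Vec dy) :
    P.dikinNorm y u ≤ P.dikinNorm c u / (1 - r) := by
  have hy := mem_interiorY_of_dikinNorm hc (h.trans_lt hr)
  rw [div_eq_inv_mul]
  refine dikinNorm_le_of_slack_le hc hy (inv_nonneg.2 (by linarith)) (fun i => ?_) u
  rw [← div_eq_inv_mul, le_div_iff₀ (by linarith)]
  linarith [(slack_le_of_dikinNorm hc h i).1]

theorem dikinNorm_le_mul {c y : Vec dy} (hc : c ∈ P.interiorY) {r : ℝ} (hr : r < 1)
    (h : P.dikinNorm c (y - c) ≤ r) (u : Vec dy) :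
    P.dikinNorm c u ≤ (1 + r) * P.dikinNorm y u := by
  have hy := mem_interiorY_of_dikinNorm hc (h.trans_lt hr)
  have h0 := (dikinNorm_nonneg (P := P) c (y - c)).trans h
  exact dikinNorm_le_of_slack_le hy hc (by linarith) (fun i => (slack_le_of_dikinNorm hc h i).2) u

/-- Two barrier Hessians differ by a multiplicative perturbation of the slacks. -/
theorem abs_inner_scaled_sub_le {c y : Vec dy} (hc : c ∈ P.interiorY) (hy : y ∈ P.interiorY)
    {θ : ℝ} (hθ : 0 ≤ θ) (h : ∀ i, |(P.slack c i / P.slack y i) ^ 2 - 1| ≤ θ) (u v : Vec dy) :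
    |inner ℝ (P.scaled y u) (P.scaled y v) - inner ℝ (P.scaled c u) (P.scaled c v)| ≤
      θ * P.dikinNorm c u * P.dikinNorm c v := by
  rw [dikinNorm_eq, dikinNorm_eq]
  refine le_trans (le_of_eq ?_) (abs_sum_weight_mul_le _ θ hθ h (P.scaled c u) (P.scaled c v))
  congr 1
  rw [PiLp.inner_apply, PiLp.inner_apply, ← Finset.sum_sub_distrib]
  refine Finset.sum_congr rfl fun i _ => ?_
  have h1 := hc i
  have h2 := hy i
  simp only [scaled_apply, RCLike.inner_apply, conj_trivial]
  field_simp

/-- Here `u` is measured at `y` and `v` at `c`, which turns the weight into a slack ratio minus its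
inverse. The Jacobian comparison needs this form: each vector has a known bound only in its own
metric, and the two anchors may be far apart. -/
theorem abs_inner_scaled_sub_le' {c y : Vec dy} (hc : c ∈ P.interiorY) (hy : y ∈ P.interiorY)
    {θ : ℝ} (hθ : 0 ≤ θ) (h : ∀ i, |P.slack c i / P.slack y i - P.slack y i / P.slack c i| ≤ θ)
    (u v : Vec dy) :
    |inner ℝ (P.scaled y u) (P.scaled y v) - inner ℝ (P.scaled c u) (P.scaled c v)| ≤
      θ * P.dikinNorm y u * P.dikinNorm c v := by
  rw [dikinNorm_eq, dikinNorm_eq]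
  refine le_trans (le_of_eq ?_) (abs_sum_weight_mul_le _ θ hθ h (P.scaled y u) (P.scaled c v))
  congr 1
  rw [PiLp.inner_apply, PiLp.inner_apply, ← Finset.sum_sub_distrib]
  refine Finset.sum_congr rfl fun i _ => ?_
  have h1 := hc i
  have h2 := hy i
  simp only [scaled_apply, RCLike.inner_apply, conj_trivial]
  field_simp

theorem interiorY_subset_feasible : P.interiorY ⊆ P.feasible := fun y hy i => by
  have := hy i
  simp only [Problem.slack] at this
  linarith

theorem continuous_slack (i : Fin m) : Continuous fun y => P.slack y i := by
  unfold Problem.slack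
  fun_prop

theorem isOpen_interiorY : IsOpen P.interiorY := by
  have : P.interiorY = ⋂ i, {y | 0 < P.slack y i} := by ext; simp [Problem.interiorY]
  rw [this]
  exact isOpen_iInter_of_finite fun i => isOpen_lt continuous_const (continuous_slack i)

theorem convex_interiorY : Convex ℝ P.interiorY := by
  intro x hx y hy s t hs ht hst i
  have h : P.slack (s • x + t • y) i = s * P.slack x i + t * P.slack y i := by
    simp only [Problem.slack, inner_add_right, inner_smul_right]
    linear_combination -P.b i * hst
  rw [h]
  rcases hs.eq_or_lt with rfl | hs'
  · have : t = 1 := by linarith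
    subst this; simpa using hy i
  · have := mul_pos hs' (hx i)
    have := mul_nonneg ht (hy i).le
    linarith

theorem isOpen_region : IsOpen P.region := isOpen_univ.prod isOpen_interiorY

/-- A radius of the feasible set compares the Euclidean norm with all local norms. -/
theorem norm_le_mul_dikinNorm {R : ℝ} (hR : ∀ y ∈ P.feasible, ‖y‖ ≤ R) {c : Vec dy}
    (hc : c ∈ P.interiorY) (u : Vec dy) : ‖u‖ ≤ R * P.dikinNorm c u := by
  -- If `s ‖u‖_c ≤ 1`, no constraint is violated at `c ± s u`, so a segment of length `2 s ‖u‖` lies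
  -- in the ball of radius `R`.
  have key : ∀ s : ℝ, 0 ≤ s → s * P.dikinNorm c u ≤ 1 → s * ‖u‖ ≤ R := by
    intro s hs hs1
    have hmem : ∀ t : ℝ, |t| = s → c + t • u ∈ P.feasible := by
      intro t ht i
      have h0 := (abs_scaled_apply_le (P := P) c u i)
      have h1 := hc i
      have h2 : |t * inner ℝ (P.a i) u| ≤ P.slack c i := by
        rw [abs_mul, ht]
        rw [scaled_apply, abs_mul, abs_inv, abs_of_pos h1, inv_mul_le_iff₀ h1] at h0
        calc s * |inner ℝ (P.a i) u| ≤ s * (P.slack c i * P.dikinNorm c u) := by gcongr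
          _ = (s * P.dikinNorm c u) * P.slack c i := by ring
          _ ≤ 1 * P.slack c i := by gcongr
          _ = _ := one_mul _
      have h3 := le_abs_self (t * inner ℝ (P.a i) u)
      simp only [inner_add_right, inner_smul_right]
      simp only [Problem.slack] at h2
      linarith
    have h1 := hR _ (hmem s (abs_of_nonneg hs))
    have h2 := hR _ (hmem (-s) (by rw [abs_neg, abs_of_nonneg hs]))
    have h3 : ‖(c + s • u) - (c + (-s) • u)‖ ≤ R + R := (norm_sub_le _ _).trans (add_le_add h1 h2)
    have h4 : (c + s • u) - (c + (-s) • u) = (2 * s) • u := by module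
    rw [h4, norm_smul, Real.norm_of_nonneg (by linarith)] at h3
    linarith
  rcases (dikinNorm_nonneg (P := P) c u).eq_or_lt with h | h
  -- A direction of local norm zero would leave a whole line feasible; the witness `(R + 1) / ‖u‖`
  -- contradicts boundedness.
  · rw [← h, mul_zero]
    by_contra hu
    push Not at hu
    have hR0 : 0 ≤ R := (norm_nonneg _).trans (hR c (interiorY_subset_feasible hc))
    have := key ((R + 1) / ‖u‖) (by positivity) (by rw [← h]; simp)
    rw [div_mul_cancel₀ _ hu.ne'] at this
    linarith
  · have := key (P.dikinNorm c u)⁻¹ (by positivity) (by rw [inv_mul_cancel₀ h.ne'])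
    rw [inv_mul_le_iff₀ h] at this
    linarith

theorem exists_radius (hP : P.IsPolytope) : ∃ R : ℝ, 0 < R ∧ ∀ y ∈ P.feasible, ‖y‖ ≤ R := by
  obtain ⟨R, hR⟩ := hP.compact.isBounded.exists_norm_le
  exact ⟨max R 1, by positivity, fun y hy => (hR y hy).trans (le_max_left _ _)⟩

theorem eq_zero_of_dikinNorm_eq_zero (hP : P.IsPolytope) {c : Vec dy} (hc : c ∈ P.interiorY)
    {u : Vec dy} (h : P.dikinNorm c u = 0) : u = 0 := by
  obtain ⟨R, -, hR⟩ := exists_radius hP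
  have := norm_le_mul_dikinNorm hR hc u
  rw [h, mul_zero] at this
  exact norm_le_zero_iff.1 this

/-- Compactness makes the local norm definite, hence the Hessian injective on a finite-dimensional
space. This excludes the default value zero of `ContinuousLinearMap.inverse`, so the algorithm
really preconditions. -/
theorem barrierHess_inverse_apply (hP : P.IsPolytope) {c : Vec dy} (hc : c ∈ P.interiorY)
    (w : Vec dy) : P.barrierHess c ((P.barrierHess c).inverse w) = w := by
  have hinj : Function.Injective (P.barrierHess c) := by
    rw [injective_iff_map_eq_zero]
    intro u hu
    refine eq_zero_of_dikinNorm_eq_zero hP hc (u := u) ?_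
    rw [Problem.dikinNorm, hu, inner_zero_left, Real.sqrt_zero]
  let e := (LinearEquiv.ofInjectiveEndo (P.barrierHess c).toLinearMap hinj).toContinuousLinearEquiv
  have he : P.barrierHess c = e := by ext; rfl
  rw [he, ContinuousLinearMap.inverse_equiv]
  exact e.apply_symm_apply w

variable (P) in
/-- The derivative of the barrier, `v ↦ ∑ ⟨aᵢ, v⟩ / sᵢ(y)`. -/
noncomputable def Problem.barrierDeriv (y : Vec dy) : Vec dy →L[ℝ] ℝ :=
  ∑ i, (P.slack y i)⁻¹ • innerSL ℝ (P.a i)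

theorem hasFDerivAt_slack (y : Vec dy) (i : Fin m) :
    HasFDerivAt (fun y => P.slack y i) (-innerSL ℝ (P.a i)) y :=
  (innerSL ℝ (P.a i)).hasFDerivAt.const_sub (P.b i)

theorem hasFDerivAt_barrier {y : Vec dy} (hy : y ∈ P.interiorY) :
    HasFDerivAt P.barrier (P.barrierDeriv y) y := by
  have h : HasFDerivAt P.barrier (-∑ i, (P.slack y i)⁻¹ • (-innerSL ℝ (P.a i))) y :=
    (HasFDerivAt.fun_sum fun i _ => (hasFDerivAt_slack y i).log (hy i).ne').neg
  refine h.congr_fderiv ?_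
  simp [Problem.barrierDeriv]

variable (P) in
/-- The second derivative of the barrier as a bilinear map. -/
noncomputable def Problem.barrierDeriv₂ (y : Vec dy) : Vec dy →L[ℝ] Vec dy →L[ℝ] ℝ :=
  ∑ i, ((P.slack y i) ^ 2)⁻¹ • (innerSL ℝ (P.a i)).smulRight (innerSL ℝ (P.a i))

theorem barrierDeriv₂_apply (y u v : Vec dy) :
    P.barrierDeriv₂ y u v = inner ℝ (P.scaled y u) (P.scaled y v) := by
  simp only [Problem.barrierDeriv₂, sum_apply, inner_scaled]
  refine Finset.sum_congr rfl fun i _ => ?_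
  simp only [smul_apply, ContinuousLinearMap.smulRight_apply, smul_eq_mul,
    innerSL_apply_apply]
  ring

theorem hasFDerivAt_barrierDeriv {y : Vec dy} (hy : y ∈ P.interiorY) :
    HasFDerivAt P.barrierDeriv (P.barrierDeriv₂ y) y := by
  have h : HasFDerivAt P.barrierDeriv
      (∑ i, (-((P.slack y i) ^ 2)⁻¹ • (-innerSL ℝ (P.a i))).smulRight (innerSL ℝ (P.a i))) y := by
    refine HasFDerivAt.fun_sum fun i _ => ?_
    have := (hasDerivAt_inv (hy i).ne').comp_hasFDerivAt y (hasFDerivAt_slack y i)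
    exact HasFDerivAt.smul_const this (innerSL ℝ (P.a i))
  refine h.congr_fderiv (Finset.sum_congr rfl fun i _ => ?_)
  ext1 u
  simp [smul_smul]

theorem contDiffOn_barrier {n : WithTop ℕ∞} : ContDiffOn ℝ n P.barrier P.interiorY := by
  refine (ContDiffOn.sum fun i _ => ContDiffOn.log ?_ fun y hy => (hy i).ne').neg
  exact contDiffOn_const.sub (innerSL ℝ (P.a i)).contDiff.contDiffOn

end Geometry

end BarrierBilevel

namespace BarrierBilevel

/-! ### Partial derivatives as restrictions of joint derivatives -/

section Calculus

variable {dx dy : ℕ}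

/-- The derivative of `h` in both variables. -/
noncomputable def jointDeriv (h : Vec dx → Vec dy → ℝ) (x : Vec dx) (y : Vec dy) :
    Vec dx × Vec dy →L[ℝ] ℝ :=
  fderiv ℝ (Function.uncurry h) (x, y)

/-- The second derivative of `h` in both variables. -/
noncomputable def jointHess (h : Vec dx → Vec dy → ℝ) (x : Vec dx) (y : Vec dy) :
    Vec dx × Vec dy →L[ℝ] Vec dx × Vec dy →L[ℝ] ℝ :=
  fderiv ℝ (fderiv ℝ (Function.uncurry h)) (x, y)

variable {h : Vec dx → Vec dy → ℝ} {U : Set (Vec dx × Vec dy)}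

theorem hasFDerivAt_uncurry (hU : IsOpen U) (hh : ContDiffOn ℝ 2 (Function.uncurry h) U)
    {x : Vec dx} {y : Vec dy} (hp : (x, y) ∈ U) :
    HasFDerivAt (Function.uncurry h) (jointDeriv h x y) (x, y) :=
  ((hh.contDiffAt (hU.mem_nhds hp)).differentiableAt two_ne_zero).hasFDerivAt

theorem hasFDerivAt_fderiv_uncurry (hU : IsOpen U) (hh : ContDiffOn ℝ 2 (Function.uncurry h) U)
    {x : Vec dx} {y : Vec dy} (hp : (x, y) ∈ U) :
    HasFDerivAt (fderiv ℝ (Function.uncurry h)) (jointHess h x y) (x, y) :=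
  ((((hh.contDiffAt (hU.mem_nhds hp))).fderiv_right (m := 1) (by norm_num)).differentiableAt
    one_ne_zero).hasFDerivAt

theorem jointHess_symm (hU : IsOpen U) (hh : ContDiffOn ℝ 2 (Function.uncurry h) U)
    {x : Vec dx} {y : Vec dy} (hp : (x, y) ∈ U) (p q : Vec dx × Vec dy) :
    jointHess h x y p q = jointHess h x y q p :=
  (hh.contDiffAt (hU.mem_nhds hp)).isSymmSndFDerivAt (by simp) p q

theorem hasFDerivAt_slice_right (hU : IsOpen U) (hh : ContDiffOn ℝ 2 (Function.uncurry h) U)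
    {x : Vec dx} {y : Vec dy} (hp : (x, y) ∈ U) :
    HasFDerivAt (fun y' => h x y')
      (jointDeriv h x y ∘L ContinuousLinearMap.inr ℝ (Vec dx) (Vec dy)) y :=
  (hasFDerivAt_uncurry hU hh hp).comp y (hasFDerivAt_prodMk_right x y)

theorem hasFDerivAt_slice_left (hU : IsOpen U) (hh : ContDiffOn ℝ 2 (Function.uncurry h) U)
    {x : Vec dx} {y : Vec dy} (hp : (x, y) ∈ U) :
    HasFDerivAt (fun x' => h x' y)
      (jointDeriv h x y ∘L ContinuousLinearMap.inl ℝ (Vec dx) (Vec dy)) x :=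
  (hasFDerivAt_uncurry hU hh hp).comp (f := fun x' => (x', y)) x (hasFDerivAt_prodMk_left x y)

theorem hasFDerivAt_jointDeriv_right (hU : IsOpen U)
    (hh : ContDiffOn ℝ 2 (Function.uncurry h) U) {x : Vec dx} {y : Vec dy} (hp : (x, y) ∈ U) :
    HasFDerivAt (fun y' => jointDeriv h x y')
      (jointHess h x y ∘L ContinuousLinearMap.inr ℝ (Vec dx) (Vec dy)) y :=
  (hasFDerivAt_fderiv_uncurry hU hh hp).comp y (hasFDerivAt_prodMk_right x y)

theorem hasFDerivAt_jointDeriv_left (hU : IsOpen U)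
    (hh : ContDiffOn ℝ 2 (Function.uncurry h) U) {x : Vec dx} {y : Vec dy} (hp : (x, y) ∈ U) :
    HasFDerivAt (fun x' => jointDeriv h x' y)
      (jointHess h x y ∘L ContinuousLinearMap.inl ℝ (Vec dx) (Vec dy)) x :=
  (hasFDerivAt_fderiv_uncurry hU hh hp).comp (f := fun x' => (x', y)) x
    (hasFDerivAt_prodMk_left x y)

theorem inner_gradient_eq {n : ℕ} {F : Vec n → ℝ} (x u : Vec n) :
    inner ℝ (gradient F x) u = fderiv ℝ F x u := by
  rw [gradient, InnerProductSpace.toDual_symm_apply]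

theorem inner_gradY (hU : IsOpen U) (hh : ContDiffOn ℝ 2 (Function.uncurry h) U)
    {x : Vec dx} {y : Vec dy} (hp : (x, y) ∈ U) (v : Vec dy) :
    inner ℝ (gradY h x y) v = jointDeriv h x y (0, v) := by
  rw [gradY, inner_gradient_eq, (hasFDerivAt_slice_right hU hh hp).fderiv]
  rfl

theorem inner_gradX (hU : IsOpen U) (hh : ContDiffOn ℝ 2 (Function.uncurry h) U)
    {x : Vec dx} {y : Vec dy} (hp : (x, y) ∈ U) (u : Vec dx) :
    inner ℝ (gradX h x y) u = jointDeriv h x y (u, 0) := by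
  rw [gradX, inner_gradient_eq, (hasFDerivAt_slice_left hU hh hp).fderiv]
  rfl

theorem hessYY_eq (hU : IsOpen U) (hh : ContDiffOn ℝ 2 (Function.uncurry h) U)
    {x : Vec dx} {y : Vec dy} (hp : (x, y) ∈ U) (u v : Vec dy) :
    hessYY h x y u v = jointHess h x y (0, u) (0, v) := by
  have h1 : (fun y' => fderiv ℝ (fun y'' => h x y'') y') =ᶠ[nhds y]
      fun y' => jointDeriv h x y' ∘L ContinuousLinearMap.inr ℝ (Vec dx) (Vec dy) := by
    have : ∀ᶠ y' in nhds y, (x, y') ∈ U :=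
      (Continuous.prodMk_right x).continuousAt.preimage_mem_nhds (hU.mem_nhds hp)
    filter_upwards [this] with y' hy'
    exact (hasFDerivAt_slice_right hU hh hy').fderiv
  have h2 := (hasFDerivAt_jointDeriv_right hU hh hp).clm_comp
    (hasFDerivAt_const (ContinuousLinearMap.inr ℝ (Vec dx) (Vec dy)) y)
  rw [hessYY, h1.fderiv_eq, h2.fderiv]
  simp

theorem hessXY_eq (hU : IsOpen U) (hh : ContDiffOn ℝ 2 (Function.uncurry h) U)
    {x : Vec dx} {y : Vec dy} (hp : (x, y) ∈ U) (u : Vec dx) (v : Vec dy) :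
    hessXY h x y u v = jointHess h x y (u, 0) (0, v) := by
  have h1 : (fun x' => fderiv ℝ (fun y' => h x' y') y) =ᶠ[nhds x]
      fun x' => jointDeriv h x' y ∘L ContinuousLinearMap.inr ℝ (Vec dx) (Vec dy) := by
    have : ∀ᶠ x' in nhds x, (x', y) ∈ U :=
      (Continuous.prodMk_left y).continuousAt.preimage_mem_nhds (hU.mem_nhds hp)
    filter_upwards [this] with x' hx'
    exact (hasFDerivAt_slice_right hU hh hx').fderiv
  have h2 := (hasFDerivAt_jointDeriv_left hU hh hp).clm_comp
    (hasFDerivAt_const (ContinuousLinearMap.inr ℝ (Vec dx) (Vec dy)) x)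
  rw [hessXY, h1.fderiv_eq, h2.fderiv]
  simp

/-- Symmetric bilinear forms are bounded by their quadratic form. -/
theorem abs_bilin_le_of_quadratic {E F : Type*} [NormedAddCommGroup E] [NormedSpace ℝ E]
    [NormedAddCommGroup F] [InnerProductSpace ℝ F] (A : E →L[ℝ] F) (B : E →L[ℝ] E →L[ℝ] ℝ)
    {k : ℝ} (hk : 0 ≤ k) (hB : ∀ u v, B u v = B v u) (h : ∀ u, |B u u| ≤ k * ‖A u‖ ^ 2) (u v : E) :
    |B u v| ≤ k * ‖A u‖ * ‖A v‖ := by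
  -- Polarization combined with the parallelogram law.
  have h1 : ∀ u v, 2 * |B u v| ≤ k * (‖A u‖ ^ 2 + ‖A v‖ ^ 2) := fun u v => by
    have h2 : 4 * B u v = B (u + v) (u + v) - B (u - v) (u - v) := by
      simp only [map_add, map_sub, add_apply, sub_apply, hB v u]
      ring
    have h3 := abs_le.1 (h (u + v))
    have h4 := abs_le.1 (h (u - v))
    have h5 := parallelogram_law_with_norm ℝ (A u) (A v)
    rw [← map_add, ← map_sub] at h5
    have h6 : k * ‖A (u + v)‖ ^ 2 + k * ‖A (u - v)‖ ^ 2 = 2 * (k * (‖A u‖ ^ 2 + ‖A v‖ ^ 2)) := by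
      linear_combination k * h5
    have : |4 * B u v| ≤ 2 * (k * (‖A u‖ ^ 2 + ‖A v‖ ^ 2)) := by
      rw [h2, abs_le]
      constructor <;> linarith
    rw [abs_mul, abs_of_pos (by norm_num : (0 : ℝ) < 4)] at this
    linarith
  set a := ‖A u‖ with ha
  set b := ‖A v‖ with hb
  have ha0 : 0 ≤ a := norm_nonneg _
  have hb0 : 0 ≤ b := norm_nonneg _
  -- Rescaling `u` and `v` to comparable size turns the sum of squares into a product; `ε` covers
  -- the case where `A u` or `A v` vanishes.
  have h2 : ∀ ε : ℝ, 0 < ε → |B u v| ≤ k * (a + ε) * (b + ε) := by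
    intro ε hε
    have h3 := h1 ((b + ε) • u) ((a + ε) • v)
    simp only [map_smul, smul_apply, smul_eq_mul, abs_mul, norm_smul, Real.norm_eq_abs] at h3
    rw [abs_of_pos (by positivity : 0 < a + ε), abs_of_pos (by positivity : 0 < b + ε), ← ha,
      ← hb] at h3
    have h4 : ((b + ε) * a) ^ 2 ≤ ((b + ε) * (a + ε)) ^ 2 := by gcongr; linarith
    have h5 : ((a + ε) * b) ^ 2 ≤ ((b + ε) * (a + ε)) ^ 2 := by
      rw [mul_comm (b + ε)]; gcongr; linarith
    have h6 := mul_le_mul_of_nonneg_left (add_le_add h4 h5) hk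
    refine le_of_mul_le_mul_left (a := (b + ε) * (a + ε)) ?_ (by positivity)
    linarith
  have h3 : Tendsto (fun ε : ℝ => k * (a + ε) * (b + ε)) (nhdsWithin 0 (Set.Ioi 0))
      (nhds (k * (a + 0) * (b + 0))) := by
    refine Tendsto.mono_left (Continuous.tendsto ?_ 0) nhdsWithin_le_nhds
    fun_prop
  rw [add_zero, add_zero] at h3
  exact ge_of_tendsto h3 (by filter_upwards [self_mem_nhdsWithin] with ε hε using h2 ε hε)

/-- A real function on `[0, 1]` whose derivative is bounded by `C` changes by at most `C`. -/
theorem abs_sub_le_of_hasDerivAt {φ φ' : ℝ → ℝ} {C : ℝ}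
    (hφ : ∀ t ∈ Set.Icc (0 : ℝ) 1, HasDerivAt φ (φ' t) t)
    (hC : ∀ t ∈ Set.Icc (0 : ℝ) 1, |φ' t| ≤ C) : |φ 1 - φ 0| ≤ C :=
  norm_image_sub_le_of_norm_deriv_le_segment_01' (fun t ht => (hφ t ht).hasDerivWithinAt)
    (fun t ht => hC t ⟨ht.1, ht.2.le⟩)

end Calculus

/-! ### Derivatives of the barrierized and penalized objectives -/

section Objectives

variable {dx dy m : ℕ} {P : Problem dx dy m}

theorem mem_region {x : Vec dx} {y : Vec dy} (hy : y ∈ P.interiorY) : (x, y) ∈ P.region :=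
  ⟨Set.mem_univ _, hy⟩

theorem contDiffOn_psi (hg : ContDiffOn ℝ 2 (Function.uncurry P.g) P.region) (μ : ℝ) :
    ContDiffOn ℝ 2 (Function.uncurry (P.psi μ)) P.region := by
  have h1 : ContDiffOn ℝ 2 (fun p : Vec dx × Vec dy => P.barrier p.2) P.region :=
    contDiffOn_barrier.comp contDiff_snd.contDiffOn fun p hp => hp.2
  exact hg.add (contDiffOn_const.mul h1)

theorem jointDeriv_psi (hg : ContDiffOn ℝ 2 (Function.uncurry P.g) P.region) (μ : ℝ)
    {x : Vec dx} {y : Vec dy} (hy : y ∈ P.interiorY) :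
    jointDeriv (P.psi μ) x y = jointDeriv P.g x y +
      μ • (P.barrierDeriv y ∘L ContinuousLinearMap.snd ℝ (Vec dx) (Vec dy)) := by
  have h1 := (hasFDerivAt_uncurry isOpen_region hg (mem_region (x := x) hy)).add
    (((hasFDerivAt_barrier hy).comp (x, y) hasFDerivAt_snd).const_mul μ)
  exact h1.fderiv

theorem jointDeriv_psi_apply (hg : ContDiffOn ℝ 2 (Function.uncurry P.g) P.region) (μ : ℝ)
    {x : Vec dx} {y : Vec dy} (hy : y ∈ P.interiorY) (p : Vec dx × Vec dy) :
    jointDeriv (P.psi μ) x y p = jointDeriv P.g x y p + μ * P.barrierDeriv y p.2 := by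
  rw [jointDeriv_psi hg μ hy]; simp

theorem jointHess_psi_apply (hg : ContDiffOn ℝ 2 (Function.uncurry P.g) P.region) (μ : ℝ)
    {x : Vec dx} {y : Vec dy} (hy : y ∈ P.interiorY) (p q : Vec dx × Vec dy) :
    jointHess (P.psi μ) x y p q = jointHess P.g x y p q +
      μ * inner ℝ (P.scaled y p.2) (P.scaled y q.2) := by
  have hev : fderiv ℝ (Function.uncurry (P.psi μ)) =ᶠ[nhds (x, y)] fun r =>
      fderiv ℝ (Function.uncurry P.g) r +
      μ • (P.barrierDeriv r.2 ∘L ContinuousLinearMap.snd ℝ (Vec dx) (Vec dy)) := by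
    filter_upwards [isOpen_region.mem_nhds (mem_region (x := x) hy)] with r hr
    exact jointDeriv_psi hg μ hr.2
  have h2 := (hasFDerivAt_fderiv_uncurry isOpen_region hg (mem_region (x := x) hy)).add
    ((((hasFDerivAt_barrierDeriv hy).comp (x, y) hasFDerivAt_snd).clm_comp
      (hasFDerivAt_const (ContinuousLinearMap.snd ℝ (Vec dx) (Vec dy)) (x, y))).const_smul μ)
  have h3 := hev.fderiv_eq.trans h2.fderiv
  rw [jointHess, h3]
  simp [barrierDeriv₂_apply]

theorem hasFDerivAt_L_right (hf : ContDiffOn ℝ 2 (Function.uncurry P.f) P.region)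
    (hg : ContDiffOn ℝ 2 (Function.uncurry P.g) P.region) (lam μ : ℝ)
    {x : Vec dx} {y : Vec dy} (hy : y ∈ P.interiorY) :
    HasFDerivAt (P.L lam μ x) ((jointDeriv P.f x y + lam • jointDeriv (P.psi μ) x y) ∘L
      ContinuousLinearMap.inr ℝ (Vec dx) (Vec dy)) y := by
  have h1 := (hasFDerivAt_slice_right isOpen_region hf (mem_region (x := x) hy)).add
    (((hasFDerivAt_slice_right isOpen_region (contDiffOn_psi hg μ) (mem_region (x := x) hy)).sub_const
      (P.psiStar μ x)).const_mul lam)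
  refine h1.congr_fderiv ?_
  ext v
  simp

theorem inner_gradY_L (hf : ContDiffOn ℝ 2 (Function.uncurry P.f) P.region)
    (hg : ContDiffOn ℝ 2 (Function.uncurry P.g) P.region) (lam μ : ℝ)
    {x : Vec dx} {y : Vec dy} (hy : y ∈ P.interiorY) (v : Vec dy) :
    inner ℝ (gradY (P.L lam μ) x y) v =
      jointDeriv P.f x y (0, v) + lam * jointDeriv (P.psi μ) x y (0, v) := by
  have := (hasFDerivAt_L_right hf hg lam μ (x := x) hy).fderiv
  rw [gradY, inner_gradient_eq]
  erw [this]
  simp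

end Objectives

end BarrierBilevel

namespace BarrierBilevel

/-! ### Uniform bounds, existence and stationarity of the centers -/

section Bounds

variable {dx dy m : ℕ} {P : Problem dx dy m}

/-- Quantitative form of the regularity assumptions with a common Lipschitz constant `l`, a modulus
`ρ` and a radius `R` of the feasible set. -/
structure Problem.HasBounds (P : Problem dx dy m) (l ρ R lf0 lg0 : ℝ) : Prop where
  polytope : P.IsPolytope
  l_pos : 0 < l
  ρ_pos : 0 < ρ
  R_pos : 0 < R
  f_smooth : ContDiffOn ℝ 2 (Function.uncurry P.f) P.region
  g_smooth : ContDiffOn ℝ 2 (Function.uncurry P.g) P.region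
  norm_le : ∀ y ∈ P.feasible, ‖y‖ ≤ R
  f_deriv_lip : ∀ x₁ x₂, ∀ y₁ ∈ P.interiorY, ∀ y₂ ∈ P.interiorY,
    ‖jointDeriv P.f x₁ y₁ - jointDeriv P.f x₂ y₂‖ ≤ l * (‖x₁ - x₂‖ + ‖y₁ - y₂‖)
  g_deriv_lip : ∀ x₁ x₂, ∀ y₁ ∈ P.interiorY, ∀ y₂ ∈ P.interiorY,
    ‖jointDeriv P.g x₁ y₁ - jointDeriv P.g x₂ y₂‖ ≤ l * (‖x₁ - x₂‖ + ‖y₁ - y₂‖)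
  g_hess_lip : ∀ x₁ x₂, ∀ y₁ ∈ P.interiorY, ∀ y₂ ∈ P.interiorY,
    ‖jointHess P.g x₁ y₁ - jointHess P.g x₂ y₂‖ ≤ l * (‖x₁ - x₂‖ + ‖y₁ - y₂‖)
  f_hess_le : ∀ x, ∀ y ∈ P.interiorY, ‖jointHess P.f x y‖ ≤ l
  g_hess_le : ∀ x, ∀ y ∈ P.interiorY, ‖jointHess P.g x y‖ ≤ l
  f_derivX_le : ∀ x, ∀ y ∈ P.interiorY, ∀ u, |jointDeriv P.f x y (u, 0)| ≤ lf0 * ‖u‖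
  f_derivY_le : ∀ x, ∀ y ∈ P.interiorY, ∀ v, |jointDeriv P.f x y (0, v)| ≤ lf0 * ‖v‖
  g_derivX_le : ∀ x, ∀ y ∈ P.interiorY, ∀ u, |jointDeriv P.g x y (u, 0)| ≤ lg0 * ‖u‖
  g_mono : ∀ x, ∀ y₁ ∈ P.interiorY, ∀ y₂ ∈ P.interiorY,
    ρ * ‖y₂ - y₁‖ ^ 2 ≤ jointDeriv P.g x y₂ (0, y₂ - y₁) - jointDeriv P.g x y₁ (0, y₂ - y₁)

theorem norm_prod_le_add (x₁ x₂ : Vec dx) (y₁ y₂ : Vec dy) :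
    ‖((x₁, y₁) : Vec dx × Vec dy) - (x₂, y₂)‖ ≤ ‖x₁ - x₂‖ + ‖y₁ - y₂‖ := by
  rw [Prod.mk_sub_mk, Prod.norm_mk]
  exact max_le (by linarith [norm_nonneg (y₁ - y₂)]) (by linarith [norm_nonneg (x₁ - x₂)])

theorem argminInterior_spec {h : Vec dy → ℝ}
    (hex : ∃ y ∈ P.interiorY, IsMinOn h P.interiorY y) :
    P.argminInterior h ∈ P.interiorY ∧ IsMinOn h P.interiorY (P.argminInterior h) :=
  Classical.epsilon_spec (p := fun y => y ∈ P.interiorY ∧ IsMinOn h P.interiorY y)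
    (let ⟨y, h1, h2⟩ := hex; ⟨y, h1, h2⟩)

/-- The first-order inequality for a strongly convex function. -/
theorem strongConvexOn_first_order {s : Set (Vec dy)} {ρ : ℝ} {h : Vec dy → ℝ}
    (hs : StrongConvexOn s ρ h) {y₁ y₂ : Vec dy} (h1 : y₁ ∈ s) (h2 : y₂ ∈ s)
    {h' : Vec dy →L[ℝ] ℝ} (hh : HasFDerivAt h h' y₁) :
    h' (y₂ - y₁) - ρ * inner ℝ y₁ (y₂ - y₁) ≤
      (h y₂ - ρ / 2 * ‖y₂‖ ^ 2) - (h y₁ - ρ / 2 * ‖y₁‖ ^ 2) := by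
  have hc := strongConvexOn_iff_convex.1 hs
  have hc' := hc.comp_affineMap (AffineMap.lineMap (k := ℝ) y₁ y₂)
  have hd : HasDerivAt ((fun x => h x - ρ / 2 * ‖x‖ ^ 2) ∘ (AffineMap.lineMap (k := ℝ) y₁ y₂))
      (h' (y₂ - y₁) - ρ * inner ℝ y₁ (y₂ - y₁)) 0 := by
    have hl : HasDerivAt (AffineMap.lineMap (k := ℝ) y₁ y₂) (y₂ - y₁) (0 : ℝ) :=
      AffineMap.hasDerivAt_lineMap
    have h3 : HasDerivAt (fun t : ℝ => h (AffineMap.lineMap (k := ℝ) y₁ y₂ t)) (h' (y₂ - y₁)) 0 :=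
      HasFDerivAt.comp_hasDerivAt (f := AffineMap.lineMap (k := ℝ) y₁ y₂) (0 : ℝ)
        (by simpa using hh) hl
    have h4 : HasDerivAt (fun t : ℝ => ‖AffineMap.lineMap (k := ℝ) y₁ y₂ t‖ ^ 2)
        (2 * inner ℝ y₁ (y₂ - y₁)) 0 := by
      simpa using hl.norm_sq
    exact (h3.sub (h4.const_mul (ρ / 2))).congr_deriv (by ring)
  have := hc'.le_slope_of_hasDerivAt (x := 0) (y := 1) (by simpa using h1) (by simpa using h2)
    one_pos hd
  simpa [slope_def_field] using this

/-- Adding the first-order inequalities in the two directions cancels the function values. -/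
theorem strongConvexOn_deriv_mono {s : Set (Vec dy)} {ρ : ℝ} {h : Vec dy → ℝ}
    (hs : StrongConvexOn s ρ h) {y₁ y₂ : Vec dy} (h1 : y₁ ∈ s) (h2 : y₂ ∈ s)
    {h₁' h₂' : Vec dy →L[ℝ] ℝ} (hh1 : HasFDerivAt h h₁' y₁) (hh2 : HasFDerivAt h h₂' y₂) :
    ρ * ‖y₂ - y₁‖ ^ 2 ≤ h₂' (y₂ - y₁) - h₁' (y₂ - y₁) := by
  have h3 := strongConvexOn_first_order hs h1 h2 hh1
  have h4 := strongConvexOn_first_order hs h2 h1 hh2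
  rw [← neg_sub y₂ y₁, map_neg, inner_neg_right] at h4
  have h5 : ‖y₂ - y₁‖ ^ 2 = inner ℝ y₂ (y₂ - y₁) - inner ℝ y₁ (y₂ - y₁) := by
    rw [← inner_sub_left, real_inner_self_eq_norm_sq]
  rw [h5]
  linarith

/-- The Lipschitz constants of the gradients bound the Hessians, and the sum of the constants, plus
one for positivity, serves all estimates at once. -/
theorem exists_hasBounds {lf0 lg0 : ℝ} (hP : P.IsPolytope) (hR : P.Regular lf0 lg0) :
    ∃ l ρ R : ℝ, P.HasBounds l ρ R lf0 lg0 := by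
  obtain ⟨R, hR0, hRle⟩ := exists_radius hP
  obtain ⟨l₁, h₁⟩ := hR.f_grad_lipschitz
  obtain ⟨l₂, h₂⟩ := hR.g_grad_lipschitz
  obtain ⟨l₃, h₃⟩ := hR.g_hess_lipschitz
  obtain ⟨ρ, hρ, hconv⟩ := hR.g_strongConvex
  have e₁ : (l₁ : ℝ) ≤ 1 + l₁ + l₂ + l₃ := by linarith [l₂.2, l₃.2]
  have e₂ : (l₂ : ℝ) ≤ 1 + l₁ + l₂ + l₃ := by linarith [l₁.2, l₃.2]
  have e₃ : (l₃ : ℝ) ≤ 1 + l₁ + l₂ + l₃ := by linarith [l₂.2, l₁.2]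
  have hpos : (0 : ℝ) < 1 + l₁ + l₂ + l₃ := by positivity
  have key : ∀ {E : Type} [NormedAddCommGroup E] {H : Vec dx × Vec dy → E} {k : ℝ≥0},
      (k : ℝ) ≤ 1 + l₁ + l₂ + l₃ → LipschitzOnWith k H P.region →
      ∀ x₁ x₂, ∀ y₁ ∈ P.interiorY, ∀ y₂ ∈ P.interiorY,
      ‖H (x₁, y₁) - H (x₂, y₂)‖ ≤ (1 + l₁ + l₂ + l₃) * (‖x₁ - x₂‖ + ‖y₁ - y₂‖) := by
    intro E _ H k hk hH x₁ x₂ y₁ hy₁ y₂ hy₂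
    refine (hH.norm_sub_le (mem_region hy₁) (mem_region hy₂)).trans ?_
    exact mul_le_mul hk (norm_prod_le_add _ _ _ _) (norm_nonneg _) hpos.le
  refine ⟨1 + l₁ + l₂ + l₃, ρ, R, hP, hpos, hρ, hR0, hR.f_smooth, hR.g_smooth, hRle, ?_, ?_, ?_,
    ?_, ?_, ?_, ?_, ?_, ?_⟩
  · exact key e₁ h₁
  · exact key e₂ h₂
  · exact key e₃ h₃
  · exact fun x y hy => (norm_fderiv_le_of_lipschitzOn ℝ
      (isOpen_region.mem_nhds (mem_region hy)) h₁).trans e₁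
  · exact fun x y hy => (norm_fderiv_le_of_lipschitzOn ℝ
      (isOpen_region.mem_nhds (mem_region hy)) h₂).trans e₂
  · intro x y hy u
    rw [← inner_gradX isOpen_region hR.f_smooth (mem_region hy)]
    exact (abs_real_inner_le_norm _ _).trans
      (mul_le_mul_of_nonneg_right (hR.gradX_f_le x y hy) (norm_nonneg _))
  · intro x y hy u
    rw [← inner_gradY isOpen_region hR.f_smooth (mem_region hy)]
    exact (abs_real_inner_le_norm _ _).trans
      (mul_le_mul_of_nonneg_right (hR.gradY_f_le x y hy) (norm_nonneg _))
  · intro x y hy u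
    rw [← inner_gradX isOpen_region hR.g_smooth (mem_region hy)]
    exact (abs_real_inner_le_norm _ _).trans
      (mul_le_mul_of_nonneg_right (hR.gradX_g_le x y hy) (norm_nonneg _))
  · intro x y₁ hy₁ y₂ hy₂
    simpa using strongConvexOn_deriv_mono (hconv x) hy₁ hy₂
      (hasFDerivAt_slice_right isOpen_region hR.g_smooth (mem_region hy₁))
      (hasFDerivAt_slice_right isOpen_region hR.g_smooth (mem_region hy₂))

variable {l ρ R lf0 lg0 : ℝ} (B : P.HasBounds l ρ R lf0 lg0)
include B

/-- The second derivative is a limit of difference quotients of a monotone derivative. Writing the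
quotient over `t ^ 2` treats both signs of `t` together. -/
theorem Problem.HasBounds.g_hess_nonneg (x : Vec dx) {y : Vec dy} (hy : y ∈ P.interiorY)
    (u : Vec dy) : 0 ≤ jointHess P.g x y (0, u) (0, u) := by
  have hd : HasDerivAt (fun t : ℝ => jointDeriv P.g x (y + t • u) (0, u))
      (jointHess P.g x y (0, u) (0, u)) 0 := by
    have h1 : HasDerivAt (fun t : ℝ => y + t • u) u 0 := by
      simpa using ((hasDerivAt_id (0 : ℝ)).smul_const u).const_add y
    have h2 := HasFDerivAt.comp_hasDerivAt (f := fun t : ℝ => y + t • u) (0 : ℝ)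
      (by simpa using hasFDerivAt_jointDeriv_right isOpen_region B.g_smooth (mem_region (x := x) hy)) h1
    simpa using h2.clm_apply (hasDerivAt_const (0 : ℝ) ((0, u) : Vec dx × Vec dy))
  have ht := hasDerivAt_iff_tendsto_slope.1 hd
  refine ge_of_tendsto ht ?_
  have hmem : ∀ᶠ t : ℝ in nhds 0, y + t • u ∈ P.interiorY := by
    have : Continuous fun t : ℝ => y + t • u := by fun_prop
    exact this.continuousAt.preimage_mem_nhds (isOpen_interiorY.mem_nhds (by simpa using hy))
  filter_upwards [nhdsWithin_le_nhds hmem, self_mem_nhdsWithin] with t ht ht0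
  have h3 := B.g_mono x y hy _ ht
  have h4 : ((0 : Vec dx), y + t • u - y) = t • ((0 : Vec dx), u) := by simp
  rw [h4, map_smul, map_smul, smul_eq_mul, smul_eq_mul, ← mul_sub] at h3
  have h5 : 0 ≤ t * (jointDeriv P.g x (y + t • u) (0, u) - jointDeriv P.g x y (0, u)) :=
    le_trans (mul_nonneg B.ρ_pos.le (sq_nonneg _)) h3
  rw [slope_def_field, zero_smul, add_zero, sub_zero]
  have h6 : t ≠ 0 := ht0
  have h7 : (jointDeriv P.g x (y + t • u) (0, u) - jointDeriv P.g x y (0, u)) / t =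
      (t * (jointDeriv P.g x (y + t • u) (0, u) - jointDeriv P.g x y (0, u))) / t ^ 2 := by
    field_simp
  rw [h7]
  positivity

theorem Problem.HasBounds.norm_sub_le {y₁ y₂ : Vec dy} (h1 : y₁ ∈ P.interiorY)
    (h2 : y₂ ∈ P.interiorY) : ‖y₁ - y₂‖ ≤ 2 * R := by
  have := _root_.norm_sub_le y₁ y₂
  have := B.norm_le _ (interiorY_subset_feasible h1)
  have := B.norm_le _ (interiorY_subset_feasible h2)
  linarith

theorem Problem.HasBounds.norm_le_dikinNorm {c : Vec dy} (hc : c ∈ P.interiorY) (u : Vec dy) :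
    ‖u‖ ≤ R * P.dikinNorm c u := norm_le_mul_dikinNorm B.norm_le hc u

/-- A function with a Lipschitz derivative is bounded below on the bounded interior. -/
theorem Problem.HasBounds.exists_lower_bound {h : Vec dx → Vec dy → ℝ}
    (hh : ContDiffOn ℝ 2 (Function.uncurry h) P.region)
    (hlip : ∀ x₁ x₂, ∀ y₁ ∈ P.interiorY, ∀ y₂ ∈ P.interiorY,
      ‖jointDeriv h x₁ y₁ - jointDeriv h x₂ y₂‖ ≤ l * (‖x₁ - x₂‖ + ‖y₁ - y₂‖)) (x : Vec dx) :
    ∃ b : ℝ, ∀ y ∈ P.interiorY, b ≤ h x y := by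
  obtain ⟨y₀, hy₀⟩ := B.polytope.slater
  set K := ‖jointDeriv h x y₀‖ + l * (2 * R) with hK
  have hK0 : 0 ≤ K := by have := B.l_pos; have := B.R_pos; positivity
  have h1 : ∀ y ∈ P.interiorY, ‖jointDeriv h x y ∘L ContinuousLinearMap.inr ℝ (Vec dx) (Vec dy)‖ ≤ K := by
    intro y hy
    refine ContinuousLinearMap.opNorm_le_bound _ hK0 fun v => ?_
    have h2 := hlip x x y hy y₀ hy₀
    have h3 := mul_le_mul_of_nonneg_left (B.norm_sub_le hy hy₀) B.l_pos.le
    rw [sub_self, norm_zero, zero_add] at h2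
    have h4 : ‖jointDeriv h x y‖ ≤ K := by
      have := norm_add_le (jointDeriv h x y₀) (jointDeriv h x y - jointDeriv h x y₀)
      rw [add_sub_cancel] at this
      linarith
    calc _ ≤ ‖jointDeriv h x y‖ * ‖((0 : Vec dx), v)‖ := (jointDeriv h x y).le_opNorm _
      _ ≤ K * ‖v‖ := by
        rw [Prod.norm_mk, norm_zero, max_eq_right (norm_nonneg v)]
        exact mul_le_mul_of_nonneg_right h4 (norm_nonneg _)
  refine ⟨h x y₀ - K * (2 * R), fun y hy => ?_⟩
  have h2 := convex_interiorY.norm_image_sub_le_of_norm_hasFDerivWithin_le (f := fun y => h x y)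
    (fun y hy => (hasFDerivAt_slice_right isOpen_region hh (mem_region hy)).hasFDerivWithinAt) h1
    hy₀ hy
  have h3 := mul_le_mul_of_nonneg_left (B.norm_sub_le hy hy₀) hK0
  have h4 := neg_le_of_abs_le (h2.trans h3)
  linarith

/-- A barrier objective with a continuous base that is bounded below has an interior minimizer. -/
theorem Problem.HasBounds.exists_isMinOn {b : Vec dy → ℝ} (hb : ContinuousOn b P.interiorY)
    {b₀ : ℝ} (hb0 : ∀ y ∈ P.interiorY, b₀ ≤ b y) {ν : ℝ} (hν : 0 < ν) :
    ∃ y ∈ P.interiorY, IsMinOn (fun y => b y + ν * P.barrier y) P.interiorY y := by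
  obtain ⟨y₀, hy₀⟩ := B.polytope.slater
  -- A common upper bound for the slacks, at least `1` so that its logarithm is nonnegative.
  set S : ℝ := 1 + ∑ i, (|P.b i| + ‖P.a i‖ * R) with hS
  have hR0 := B.R_pos
  have hS1 : 1 ≤ S := by
    have : 0 ≤ ∑ i, (|P.b i| + ‖P.a i‖ * R) := Finset.sum_nonneg fun i _ => by positivity
    linarith
  have hslack : ∀ y ∈ P.interiorY, ∀ i, P.slack y i ≤ S := by
    intro y hy i
    have h1 : |P.b i| + ‖P.a i‖ * R ≤ ∑ i, (|P.b i| + ‖P.a i‖ * R) :=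
      Finset.single_le_sum (f := fun i => |P.b i| + ‖P.a i‖ * R) (fun i _ => by positivity)
        (Finset.mem_univ i)
    have h2 := neg_le_of_abs_le ((abs_real_inner_le_norm (P.a i) y).trans
      (mul_le_mul_of_nonneg_left (B.norm_le y (interiorY_subset_feasible hy)) (norm_nonneg _)))
    have h3 := le_abs_self (P.b i)
    simp only [Problem.slack]
    linarith
  set v₀ := b y₀ + ν * P.barrier y₀ with hv₀
  -- On the sublevel set of the Slater value the barrier is bounded above. As each `log sᵢ` is at
  -- most `log S`, no single slack can fall below `exp (-Q)`, so the sublevel set lies in a compact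
  -- subset of the interior.
  set Q := (v₀ - b₀) / ν + m * Real.log S with hQ
  have hlow : ∀ y ∈ P.interiorY, b y + ν * P.barrier y ≤ v₀ → ∀ i, Real.exp (-Q) ≤ P.slack y i := by
    intro y hy hle i
    have h1 : P.barrier y ≤ (v₀ - b₀) / ν := by
      rw [le_div_iff₀ hν]; linarith [hb0 y hy]
    have h2 : Real.log S - Real.log (P.slack y i) ≤ ∑ j, (Real.log S - Real.log (P.slack y j)) :=
      Finset.single_le_sum (f := fun j => Real.log S - Real.log (P.slack y j))
        (fun j _ => sub_nonneg.2 (Real.log_le_log (hy j) (hslack y hy j))) (Finset.mem_univ i)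
    have h3 : ∑ j, (Real.log S - Real.log (P.slack y j)) = m * Real.log S + P.barrier y := by
      rw [Finset.sum_sub_distrib, Problem.barrier]
      simp [sub_eq_add_neg]
    have h4 := Real.log_nonneg hS1
    rw [← Real.le_log_iff_exp_le (hy i)]
    linarith
  set K := P.feasible ∩ ⋂ i, {y | Real.exp (-Q) ≤ P.slack y i} with hKdef
  have hKc : IsCompact K := B.polytope.compact.inter_right
    (isClosed_iInter fun i => isClosed_le continuous_const (continuous_slack i))
  have hKsub : K ⊆ P.interiorY := fun y hy i =>
    (Real.exp_pos _).trans_le (Set.mem_iInter.1 hy.2 i)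
  have hmemK : ∀ y ∈ P.interiorY, b y + ν * P.barrier y ≤ v₀ → y ∈ K := fun y hy hle =>
    ⟨interiorY_subset_feasible hy, Set.mem_iInter.2 (hlow y hy hle)⟩
  have hcont : ContinuousOn (fun y => b y + ν * P.barrier y) K :=
    (hb.add (continuousOn_const.mul (contDiffOn_barrier (n := 1)).continuousOn)).mono hKsub
  obtain ⟨y, hyK, hmin⟩ := hKc.exists_isMinOn ⟨y₀, hmemK y₀ hy₀ le_rfl⟩ hcont
  refine ⟨y, hKsub hyK, fun z hz => ?_⟩
  by_cases hle : b z + ν * P.barrier z ≤ v₀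
  · exact hmin (hmemK z hz hle)
  · have h5 : b y + ν * P.barrier y ≤ v₀ := hmin (hmemK y₀ hy₀ le_rfl)
    exact h5.trans (not_le.1 hle).le

theorem Problem.HasBounds.exactCenter_spec {μ : ℝ} (hμ : 0 < μ) (x : Vec dx) :
    P.exactCenter μ x ∈ P.interiorY ∧
      IsMinOn (P.psi μ x) P.interiorY (P.exactCenter μ x) := by
  obtain ⟨b₀, hb₀⟩ := B.exists_lower_bound B.g_smooth B.g_deriv_lip x
  refine argminInterior_spec (B.exists_isMinOn (fun y hy => ?_) hb₀ hμ)
  exact (hasFDerivAt_slice_right isOpen_region B.g_smooth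
    (mem_region hy)).continuousAt.continuousWithinAt

theorem Problem.HasBounds.proxyCenter_spec {μ lam : ℝ} (hμ : 0 < μ) (hlam : 0 < lam) (x : Vec dx) :
    P.proxyCenter lam μ x ∈ P.interiorY ∧
      IsMinOn (P.L lam μ x) P.interiorY (P.proxyCenter lam μ x) := by
  obtain ⟨b₁, hb₁⟩ := B.exists_lower_bound B.g_smooth B.g_deriv_lip x
  obtain ⟨b₂, hb₂⟩ := B.exists_lower_bound B.f_smooth B.f_deriv_lip x
  refine argminInterior_spec ?_
  have := B.exists_isMinOn (b := fun y => P.f x y + lam * (P.g x y - P.psiStar μ x))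
    (b₀ := b₂ + lam * (b₁ - P.psiStar μ x)) (ν := lam * μ) ?_ ?_ (by positivity)
  · convert this using 5
    simp only [Problem.L, Problem.psi]
    ring
  · intro y hy
    have h1 := (hasFDerivAt_slice_right isOpen_region B.g_smooth
      (mem_region (x := x) hy)).continuousAt
    have h2 := (hasFDerivAt_slice_right isOpen_region B.f_smooth
      (mem_region (x := x) hy)).continuousAt
    exact (h2.add (continuousAt_const.mul (h1.sub continuousAt_const))).continuousWithinAt
  · intro y hy
    have := mul_le_mul_of_nonneg_left (sub_le_sub_right (hb₁ y hy) (P.psiStar μ x)) hlam.le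
    linarith [hb₂ y hy]

theorem Problem.HasBounds.exactCenter_mem {μ : ℝ} (hμ : 0 < μ) (x : Vec dx) :
    P.exactCenter μ x ∈ P.interiorY := (B.exactCenter_spec hμ x).1

theorem Problem.HasBounds.proxyCenter_mem {μ lam : ℝ} (hμ : 0 < μ) (hlam : 0 < lam) (x : Vec dx) :
    P.proxyCenter lam μ x ∈ P.interiorY := (B.proxyCenter_spec hμ hlam x).1

theorem Problem.HasBounds.exactCenter_stationary {μ : ℝ} (hμ : 0 < μ) (x : Vec dx) (v : Vec dy) :
    jointDeriv (P.psi μ) x (P.exactCenter μ x) (0, v) = 0 := by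
  obtain ⟨h1, h2⟩ := B.exactCenter_spec hμ x
  have h3 := (h2.isLocalMin (isOpen_interiorY.mem_nhds h1)).hasFDerivAt_eq_zero
    (hasFDerivAt_slice_right isOpen_region (contDiffOn_psi B.g_smooth μ) (mem_region h1))
  simpa using DFunLike.congr_fun h3 v

theorem Problem.HasBounds.proxyCenter_stationary {μ lam : ℝ} (hμ : 0 < μ) (hlam : 0 < lam)
    (x : Vec dx) (v : Vec dy) :
    jointDeriv P.f x (P.proxyCenter lam μ x) (0, v) +
      lam * jointDeriv (P.psi μ) x (P.proxyCenter lam μ x) (0, v) = 0 := by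
  obtain ⟨h1, h2⟩ := B.proxyCenter_spec hμ hlam x
  have h3 := (h2.isLocalMin (isOpen_interiorY.mem_nhds h1)).hasFDerivAt_eq_zero
    (hasFDerivAt_L_right B.f_smooth B.g_smooth lam μ h1)
  simpa using DFunLike.congr_fun h3 v

end Bounds

end BarrierBilevel

namespace BarrierBilevel

/-! ### Stability of the centers and differentiability of the exact center -/

section Stability

variable {dx dy m : ℕ} {P : Problem dx dy m}

/-- `c` is an interior stationary point of `ψ_μ(x, ·) + p f(x, ·)`. -/
structure Problem.IsStationary (P : Problem dx dy m) (μ p : ℝ) (x : Vec dx) (c : Vec dy) :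
    Prop where
  mem : c ∈ P.interiorY
  stationary : ∀ v, jointDeriv (P.psi μ) x c (0, v) + p * jointDeriv P.f x c (0, v) = 0

/-- The symmetrized Bregman divergence of the barrier in terms of slack ratios. -/
theorem barrierDeriv_sub_apply {c y : Vec dy} (hc : c ∈ P.interiorY) (hy : y ∈ P.interiorY) :
    P.barrierDeriv y (y - c) - P.barrierDeriv c (y - c) =
      ∑ i, (P.slack y i / P.slack c i - 1) ^ 2 / (P.slack y i / P.slack c i) := by
  simp only [Problem.barrierDeriv, sum_apply, smul_apply, innerSL_apply_apply, smul_eq_mul]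
  rw [← Finset.sum_sub_distrib]
  refine Finset.sum_congr rfl fun i _ => ?_
  have h1 := hc i
  have h2 := hy i
  have h3 : inner ℝ (P.a i) (y - c) = P.slack c i - P.slack y i := by rw [slack_sub y c]; ring
  rw [h3]
  field_simp
  ring

theorem sq_dikinNorm_sub {c : Vec dy} (hc : c ∈ P.interiorY) (y : Vec dy) :
    P.dikinNorm c (y - c) ^ 2 = ∑ i, (P.slack y i / P.slack c i - 1) ^ 2 := by
  rw [dikinNorm_eq, EuclideanSpace.norm_sq_eq]
  refine Finset.sum_congr rfl fun i _ => ?_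
  rw [slack_div_sub_one hc, neg_sq, Real.norm_eq_abs, sq_abs]

/-- With slack ratios `tᵢ` and divergence `N = ∑ (tᵢ - 1)² / tᵢ`, the inequality `(t - 1)² / t ≥ t -
2` bounds every `tᵢ` by `2 + N`; multiplying the summands by `tᵢ` gives the claim. Since nothing is
assumed small, the stability estimate becomes global. -/
theorem sq_dikinNorm_sub_le {c y : Vec dy} (hc : c ∈ P.interiorY) (hy : y ∈ P.interiorY) :
    P.dikinNorm c (y - c) ^ 2 ≤
      (P.barrierDeriv y (y - c) - P.barrierDeriv c (y - c)) *
        (2 + (P.barrierDeriv y (y - c) - P.barrierDeriv c (y - c))) := by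
  rw [sq_dikinNorm_sub hc, barrierDeriv_sub_apply hc hy]
  set t : Fin m → ℝ := fun i => P.slack y i / P.slack c i with ht
  have ht0 : ∀ i, 0 < t i := fun i => div_pos (hy i) (hc i)
  set N := ∑ i, (t i - 1) ^ 2 / t i with hN
  have h1 : ∀ i, t i ≤ 2 + N := fun i => by
    have h2 : (t i - 1) ^ 2 / t i ≤ N :=
      Finset.single_le_sum (f := fun i => (t i - 1) ^ 2 / t i)
        (fun i _ => div_nonneg (sq_nonneg _) (ht0 i).le) (Finset.mem_univ i)
    have h3 : t i - 2 ≤ (t i - 1) ^ 2 / t i := by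
      rw [le_div_iff₀ (ht0 i)]; nlinarith
    linarith
  change ∑ i, (t i - 1) ^ 2 ≤ N * (2 + N)
  rw [hN, Finset.sum_mul, ← hN]
  refine Finset.sum_le_sum fun i _ => ?_
  rw [div_mul_eq_mul_div, le_div_iff₀ (ht0 i)]
  exact mul_le_mul_of_nonneg_left (h1 i) (sq_nonneg _)

theorem abs_jointDeriv_sub_right_le {l : ℝ} {h : Vec dx → Vec dy → ℝ}
    (hlip : ∀ x₁ x₂, ∀ y₁ ∈ P.interiorY, ∀ y₂ ∈ P.interiorY,
      ‖jointDeriv h x₁ y₁ - jointDeriv h x₂ y₂‖ ≤ l * (‖x₁ - x₂‖ + ‖y₁ - y₂‖))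
    (x₁ x₂ : Vec dx) {y₁ y₂ : Vec dy} (h1 : y₁ ∈ P.interiorY) (h2 : y₂ ∈ P.interiorY)
    (v : Vec dy) : |jointDeriv h x₁ y₁ (0, v) - jointDeriv h x₂ y₂ (0, v)| ≤
      l * (‖x₁ - x₂‖ + ‖y₁ - y₂‖) * ‖v‖ := by
  have h3 := (jointDeriv h x₁ y₁ - jointDeriv h x₂ y₂).le_opNorm (0, v)
  rw [Prod.norm_mk, norm_zero, max_eq_right (norm_nonneg v)] at h3
  exact h3.trans (mul_le_mul_of_nonneg_right (hlip _ _ _ h1 _ h2) (norm_nonneg _))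

variable {l ρ R lf0 lg0 : ℝ} (B : P.HasBounds l ρ R lf0 lg0)
include B

/-- Global stability of the stationary points in the local norm. -/
theorem Problem.HasBounds.stability {μ : ℝ} (hμ : 0 < μ) (hlf0 : 0 ≤ lf0) {p₁ p₂ : ℝ}
    (hp₁ : 0 ≤ p₁) (hp₁l : p₁ * l ≤ ρ) {x₁ x₂ : Vec dx} {c₁ c₂ : Vec dy}
    (h₁ : P.IsStationary μ p₁ x₁ c₁) (h₂ : P.IsStationary μ p₂ x₂ c₂) :
    P.dikinNorm c₁ (c₂ - c₁) ≤
      6 * R / μ * ((l + ρ) * ‖x₂ - x₁‖ + lf0 * |p₂ - p₁|) := by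
  set e := c₂ - c₁ with he
  set D := P.dikinNorm c₁ e with hD
  set δ := (l + ρ) * ‖x₂ - x₁‖ + lf0 * |p₂ - p₁| with hδ
  set N := P.barrierDeriv c₂ e - P.barrierDeriv c₁ e with hN
  have hl := B.l_pos
  have hρ := B.ρ_pos
  have hR := B.R_pos
  have hδ0 : 0 ≤ δ := by positivity
  have hD0 : 0 ≤ D := dikinNorm_nonneg _ _
  have hN0 : 0 ≤ N := by
    rw [hN, barrierDeriv_sub_apply h₁.mem h₂.mem]
    exact Finset.sum_nonneg fun i _ =>
      div_nonneg (sq_nonneg _) (div_nonneg (h₂.mem i).le (h₁.mem i).le)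
  -- Both stationarity conditions are tested against `e` and subtracted. The gain `ρ ‖e‖²` from `g`
  -- pays for the possible nonconvexity `p₁ l ‖e‖²` of `f`; only the changes of `x` and of `p`
  -- remain.
  have hmain : μ * N ≤ δ * ‖e‖ := by
    have s1 := h₁.stationary e
    have s2 := h₂.stationary e
    rw [jointDeriv_psi_apply B.g_smooth μ h₁.mem] at s1
    rw [jointDeriv_psi_apply B.g_smooth μ h₂.mem] at s2
    have g1 := B.g_mono x₁ c₁ h₁.mem c₂ h₂.mem
    rw [← he] at g1
    have g2 := abs_le.1 (abs_jointDeriv_sub_right_le B.g_deriv_lip x₁ x₂ h₂.mem h₂.mem e)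
    have f1 := abs_le.1 (abs_jointDeriv_sub_right_le B.f_deriv_lip x₁ x₁ h₁.mem h₂.mem e)
    have f2 := abs_le.1 (abs_jointDeriv_sub_right_le B.f_deriv_lip x₁ x₂ h₂.mem h₂.mem e)
    have f3 := B.f_derivY_le x₂ c₂ h₂.mem e
    rw [sub_self, norm_zero, add_zero] at g2 f2
    rw [sub_self, norm_zero, zero_add, norm_sub_rev, ← he] at f1
    rw [norm_sub_rev] at g2 f2
    have f1' := mul_le_mul_of_nonneg_left f1.2 hp₁
    have f2' := mul_le_mul_of_nonneg_left f2.2 hp₁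
    have f3' : (p₁ - p₂) * jointDeriv P.f x₂ c₂ (0, e) ≤ |p₂ - p₁| * (lf0 * ‖e‖) := by
      refine (le_abs_self _).trans ?_
      rw [abs_mul, abs_sub_comm]
      exact mul_le_mul_of_nonneg_left f3 (abs_nonneg _)
    have k1 : p₁ * l * ‖e‖ ^ 2 ≤ ρ * ‖e‖ ^ 2 := mul_le_mul_of_nonneg_right hp₁l (sq_nonneg _)
    have k2 : p₁ * l * (‖x₂ - x₁‖ * ‖e‖) ≤ ρ * (‖x₂ - x₁‖ * ‖e‖) :=
      mul_le_mul_of_nonneg_right hp₁l (by positivity)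
    simp only [hN, hδ]
    linarith
  have he1 : ‖e‖ ≤ R * D := B.norm_le_dikinNorm h₁.mem e
  have he2 : ‖e‖ ≤ 2 * R := B.norm_sub_le h₂.mem h₁.mem
  have hsq : D ^ 2 ≤ N * (2 + N) := sq_dikinNorm_sub_le h₁.mem h₂.mem
  set K := 2 * R / μ with hK
  have hK0 : 0 < K := by positivity
  have hN1 : N ≤ K * δ * D := by
    have h5 := mul_le_mul_of_nonneg_left he1 hδ0
    have h6 : K * δ * D = 2 * (δ * (R * D)) / μ := by rw [hK]; ring
    rw [h6, le_div_iff₀ hμ]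
    have : 0 ≤ δ * (R * D) := by positivity
    linarith
  have hN2 : N ≤ K * δ := by
    have h5 := mul_le_mul_of_nonneg_left he2 hδ0
    have h6 : K * δ = (δ * (2 * R)) / μ := by rw [hK]; ring
    rw [h6, le_div_iff₀ hμ]
    linarith
  -- For `N ≤ 1`, `D² ≤ 3N` meets the bound proportional to `D`, and one factor cancels. For `N >
  -- 1`, `D² ≤ 3N²` meets the bound from the diameter of `Y`.
  have hgoal : D ≤ 3 * (K * δ) := by
    have hKδ : 0 ≤ K * δ := by positivity
    rcases le_or_gt N 1 with hle | hgt
    · by_contra hcon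
      push Not at hcon
      have hDpos : 0 < D := by linarith
      nlinarith
    · by_contra hcon
      push Not at hcon
      nlinarith
  calc D ≤ 3 * (K * δ) := hgoal
    _ = _ := by rw [hK]; ring

theorem Problem.HasBounds.exactCenter_isStationary {μ : ℝ} (hμ : 0 < μ) (x : Vec dx) :
    P.IsStationary μ 0 x (P.exactCenter μ x) :=
  ⟨B.exactCenter_mem hμ x, fun v => by rw [B.exactCenter_stationary hμ, zero_mul, zero_add]⟩

theorem Problem.HasBounds.proxyCenter_isStationary {μ lam : ℝ} (hμ : 0 < μ) (hlam : 0 < lam)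
    (x : Vec dx) : P.IsStationary μ (1 / lam) x (P.proxyCenter lam μ x) :=
  ⟨B.proxyCenter_mem hμ hlam x, fun v => by
    have := B.proxyCenter_stationary hμ hlam x v
    field_simp
    linarith⟩

theorem Problem.HasBounds.exactCenter_stability {μ : ℝ} (hμ : 0 < μ) (hlf0 : 0 ≤ lf0)
    (x₁ x₂ : Vec dx) :
    P.dikinNorm (P.exactCenter μ x₁) (P.exactCenter μ x₂ - P.exactCenter μ x₁) ≤
      6 * R * (l + ρ) / μ * ‖x₂ - x₁‖ := by
  have := B.stability hμ hlf0 le_rfl (by rw [zero_mul]; exact B.ρ_pos.le)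
    (B.exactCenter_isStationary hμ x₁) (B.exactCenter_isStationary hμ x₂)
  rw [sub_self, abs_zero, mul_zero, add_zero] at this
  exact this.trans_eq (by ring)

/-! ### The Jacobian of the exact center -/

/-- At the base point of the norm the barrier contributes exactly `μ ‖u‖_c²`; the Hessian of `g` is
nonnegative and at most `l ‖u‖² ≤ l R² ‖u‖_c²`. -/
theorem Problem.HasBounds.psi_hess_bounds (μ : ℝ) (x : Vec dx) {c : Vec dy}
    (hc : c ∈ P.interiorY) (u : Vec dy) :
    μ * P.dikinNorm c u ^ 2 ≤ jointHess (P.psi μ) x c (0, u) (0, u) ∧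
      jointHess (P.psi μ) x c (0, u) (0, u) ≤ (l * R ^ 2 + μ) * P.dikinNorm c u ^ 2 := by
  rw [jointHess_psi_apply B.g_smooth μ hc, real_inner_self_eq_norm_sq, ← dikinNorm_eq]
  have h1 := B.g_hess_nonneg x hc u
  have h2 : jointHess P.g x c (0, u) (0, u) ≤ l * ‖u‖ ^ 2 := by
    refine (le_abs_self _).trans (((jointHess P.g x c).le_opNorm₂ (0, u) (0, u)).trans ?_)
    rw [Prod.norm_mk, norm_zero, max_eq_right (norm_nonneg u), mul_assoc, ← sq]
    exact mul_le_mul_of_nonneg_right (B.g_hess_le x c hc) (sq_nonneg _)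
  have h3 := pow_le_pow_left₀ (norm_nonneg _) (B.norm_le_dikinNorm hc u) 2
  have h4 := mul_le_mul_of_nonneg_left h3 B.l_pos.le
  constructor
  · linarith
  · simp only [] at *
    linarith [mul_pow R (P.dikinNorm c u) 2]

/-- The `yy`-block of the Hessian of `ψ_μ` is invertible. -/
theorem Problem.HasBounds.exists_jacobian {μ : ℝ} (hμ : 0 < μ) (x : Vec dx) {c : Vec dy}
    (hc : c ∈ P.interiorY) : ∃ J : Vec dx →L[ℝ] Vec dy, ∀ u v,
      jointHess (P.psi μ) x c (u, J u) (0, v) = 0 := by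
  let Q : (Vec dx × Vec dy →L[ℝ] ℝ) →L[ℝ] (Vec dy →L[ℝ] ℝ) :=
    (ContinuousLinearMap.compL ℝ (Vec dy) (Vec dx × Vec dy) ℝ).flip
      (ContinuousLinearMap.inr ℝ (Vec dx) (Vec dy))
  let H : Vec dy →ₗ[ℝ] (Vec dy →L[ℝ] ℝ) :=
    (Q ∘L jointHess (P.psi μ) x c ∘L ContinuousLinearMap.inr ℝ (Vec dx) (Vec dy)).toLinearMap
  let C : Vec dx →ₗ[ℝ] (Vec dy →L[ℝ] ℝ) :=
    (Q ∘L jointHess (P.psi μ) x c ∘L ContinuousLinearMap.inl ℝ (Vec dx) (Vec dy)).toLinearMap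
  have hH : ∀ u v, H u v = jointHess (P.psi μ) x c (0, u) (0, v) := fun u v => rfl
  have hC : ∀ u v, C u v = jointHess (P.psi μ) x c (u, 0) (0, v) := fun u v => rfl
  have hinj : Function.Injective H := by
    rw [injective_iff_map_eq_zero]
    intro u hu
    have h1 : jointHess (P.psi μ) x c (0, u) (0, u) = 0 := by
      rw [← hH, hu]; rfl
    have h2 := (B.psi_hess_bounds μ x hc u).1
    rw [h1] at h2
    have h3 : P.dikinNorm c u ^ 2 ≤ 0 := by
      by_contra h; push Not at h; linarith [mul_pos hμ h]
    exact eq_zero_of_dikinNorm_eq_zero B.polytope hc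
      (pow_eq_zero_iff two_ne_zero |>.1 (le_antisymm h3 (sq_nonneg _)))
  have hfr : Module.finrank ℝ (Vec dy) = Module.finrank ℝ (Vec dy →L[ℝ] ℝ) :=
    ((InnerProductSpace.toDual ℝ (Vec dy)).toLinearEquiv).finrank_eq
  have hsurj : Function.Surjective H :=
    (LinearMap.injective_iff_surjective_of_finrank_eq_finrank hfr).1 hinj
  let e := LinearEquiv.ofBijective H ⟨hinj, hsurj⟩
  refine ⟨LinearMap.toContinuousLinearMap (-(e.symm.toLinearMap ∘ₗ C)), fun u v => ?_⟩
  have h1 : H (LinearMap.toContinuousLinearMap (-(e.symm.toLinearMap ∘ₗ C)) u) = -C u := by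
    change H (-(e.symm (C u))) = _
    rw [map_neg]
    exact congrArg Neg.neg (e.apply_symm_apply (C u))
  have h2 := DFunLike.congr_fun h1 v
  have h3 : ∀ w : Vec dy, (u, w) = (u, 0) + ((0 : Vec dx), w) := fun w => by simp
  rw [h3, map_add, add_apply, ← hH, ← hC, h2]
  simp

/-- Let `w` be the error of the linear prediction by `J`. Stationarity at both points and the
equation for `J` reduce the linearization error of the derivative of `ψ_μ`, tested against `w`, to
minus the Hessian form of `w`. Coercivity bounds `w` by that error, which is `o(x' - x)` because the
center is Lipschitz. -/
theorem Problem.HasBounds.hasFDerivAt_exactCenter {μ : ℝ} (hμ : 0 < μ) (hlf0 : 0 ≤ lf0)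
    (x : Vec dx) {J : Vec dx →L[ℝ] Vec dy}
    (hJ : ∀ u v, jointHess (P.psi μ) x (P.exactCenter μ x) (u, J u) (0, v) = 0) :
    HasFDerivAt (P.exactCenter μ) J x := by
  set c := P.exactCenter μ x with hcdef
  have hc : c ∈ P.interiorY := B.exactCenter_mem hμ x
  have hR := B.R_pos
  have hl := B.l_pos
  have hρ := B.ρ_pos
  set K := R * (6 * R * (l + ρ) / μ) with hK
  have hK0 : 0 < K := by positivity
  have hlipE : ∀ x', ‖P.exactCenter μ x' - c‖ ≤ K * ‖x' - x‖ := fun x' => by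
    have h1 := B.norm_le_dikinNorm hc (P.exactCenter μ x' - c)
    have h2 := mul_le_mul_of_nonneg_left (B.exactCenter_stability hμ hlf0 x x') hR.le
    exact h1.trans (h2.trans_eq (by rw [hK]; ring))
  have hcont : Tendsto (fun x' => (x', P.exactCenter μ x')) (nhds x) (nhds (x, c)) := by
    refine Tendsto.prodMk_nhds tendsto_id ?_
    rw [tendsto_iff_norm_sub_tendsto_zero]
    refine squeeze_zero (fun _ => norm_nonneg _) hlipE ?_
    have : Tendsto (fun x' : Vec dx => K * ‖x' - x‖) (nhds x) (nhds (K * ‖x - x‖)) :=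
      Continuous.tendsto (by fun_prop) x
    simpa using this
  have hG := (hasFDerivAt_fderiv_uncurry isOpen_region (contDiffOn_psi B.g_smooth μ)
    (mem_region (x := x) hc))
  rw [hasFDerivAt_iff_isLittleO] at hG ⊢
  have hG' := hG.comp_tendsto hcont
  have hO : (fun x' => ((x', P.exactCenter μ x') : Vec dx × Vec dy) - (x, c)) =O[nhds x]
      fun x' => x' - x := by
    refine IsBigO.of_bound (1 + K) (Eventually.of_forall fun x' => ?_)
    refine (norm_prod_le_add _ _ _ _).trans ?_
    linarith [hlipE x']
  have hG'' := hG'.trans_isBigO hO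
  have hΔ : (fun x' => P.exactCenter μ x' - c - J (x' - x)) =O[nhds x]
      ((fun x_1 => fderiv ℝ (Function.uncurry (P.psi μ)) x_1 -
        fderiv ℝ (Function.uncurry (P.psi μ)) (x, c) -
        (jointHess (P.psi μ) x c) (x_1 - (x, c))) ∘ fun x' => (x', P.exactCenter μ x')) := by
    refine IsBigO.of_bound (R ^ 2 / μ) (Eventually.of_forall fun x' => ?_)
    set w := P.exactCenter μ x' - c - J (x' - x) with hw
    set E := ((fun x_1 => fderiv ℝ (Function.uncurry (P.psi μ)) x_1 -
        fderiv ℝ (Function.uncurry (P.psi μ)) (x, c) -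
        (jointHess (P.psi μ) x c) (x_1 - (x, c))) ∘ fun x' => (x', P.exactCenter μ x')) x' with hE
    have h1 : E (0, w) = -jointHess (P.psi μ) x c (0, w) (0, w) := by
      have h2 : E (0, w) = jointDeriv (P.psi μ) x' (P.exactCenter μ x') (0, w) -
        jointDeriv (P.psi μ) x c (0, w) -
          jointHess (P.psi μ) x c ((x', P.exactCenter μ x') - (x, c)) (0, w) := rfl
      rw [h2, B.exactCenter_stationary hμ, B.exactCenter_stationary hμ]
      have h3 : ((x', P.exactCenter μ x') - (x, c) : Vec dx × Vec dy) =
          (x' - x, J (x' - x)) + (0, w) := by simp [hw]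
      rw [h3, map_add, add_apply, hJ]
      ring
    have h4 := (B.psi_hess_bounds μ x hc w).1
    have h5 : |E (0, w)| ≤ ‖E‖ * ‖w‖ := by
      have := E.le_opNorm (0, w)
      rwa [Prod.norm_mk, norm_zero, max_eq_right (norm_nonneg w)] at this
    have h6 := B.norm_le_dikinNorm hc w
    have h7 : ‖w‖ ^ 2 ≤ R ^ 2 * P.dikinNorm c w ^ 2 := by
      rw [← mul_pow]; exact pow_le_pow_left₀ (norm_nonneg _) h6 2
    rw [h1, abs_neg] at h5
    have h8 : μ * ‖w‖ ^ 2 ≤ R ^ 2 * (‖E‖ * ‖w‖) := by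
      calc μ * ‖w‖ ^ 2 ≤ μ * (R ^ 2 * P.dikinNorm c w ^ 2) := by gcongr
        _ = R ^ 2 * (μ * P.dikinNorm c w ^ 2) := by ring
        _ ≤ R ^ 2 * (‖E‖ * ‖w‖) := by
          exact mul_le_mul_of_nonneg_left (h4.trans ((le_abs_self _).trans h5)) (sq_nonneg _)
    change ‖w‖ ≤ R ^ 2 / μ * ‖E‖
    rcases (norm_nonneg w).eq_or_lt with h9 | h9
    · rw [← h9]; positivity
    · rw [div_mul_eq_mul_div, le_div_iff₀ hμ]
      refine le_of_mul_le_mul_right ?_ h9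
      linarith
  exact hΔ.trans_isLittleO hG''

theorem Problem.HasBounds.fderiv_exactCenter_spec {μ : ℝ} (hμ : 0 < μ) (hlf0 : 0 ≤ lf0)
    (x : Vec dx) : HasFDerivAt (P.exactCenter μ) (fderiv ℝ (P.exactCenter μ) x) x ∧ ∀ u v,
      jointHess (P.psi μ) x (P.exactCenter μ x) (u, fderiv ℝ (P.exactCenter μ) x u) (0, v) = 0 := by
  obtain ⟨J, hJ⟩ := B.exists_jacobian hμ x (B.exactCenter_mem hμ x)
  have := B.hasFDerivAt_exactCenter hμ hlf0 x hJ
  rw [this.fderiv]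
  exact ⟨this, hJ⟩

theorem Problem.HasBounds.hasFDerivAt_F {μ : ℝ} (hμ : 0 < μ) (hlf0 : 0 ≤ lf0) (x : Vec dx) :
    HasFDerivAt (P.F μ) (jointDeriv P.f x (P.exactCenter μ x) ∘L
      (ContinuousLinearMap.id ℝ (Vec dx)).prod (fderiv ℝ (P.exactCenter μ) x)) x := by
  have h1 := hasFDerivAt_uncurry isOpen_region B.f_smooth
    (mem_region (x := x) (B.exactCenter_mem hμ x))
  exact h1.comp (f := fun x => (x, P.exactCenter μ x)) x
    ((hasFDerivAt_id x).prodMk (B.fderiv_exactCenter_spec hμ hlf0 x).1)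

theorem Problem.HasBounds.inner_gradient_F {μ : ℝ} (hμ : 0 < μ) (hlf0 : 0 ≤ lf0) (x u : Vec dx) :
    inner ℝ (gradient (P.F μ) x) u =
      jointDeriv P.f x (P.exactCenter μ x) (u, fderiv ℝ (P.exactCenter μ) x u) := by
  rw [inner_gradient_eq, (B.hasFDerivAt_F hμ hlf0 x).fderiv]
  simp

end Stability

end BarrierBilevel

namespace BarrierBilevel

/-! ### Lipschitz bounds for the Jacobian of the center and for the gradient of the smoothed
objective -/

section JacobianLipschitz

variable {dx dy m : ℕ} {P : Problem dx dy m}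

/-- Lipschitz constant of the exact center in the local norm. -/
noncomputable def centerLip (l ρ R μ : ℝ) : ℝ := 6 * R * (l + ρ) / μ

/-- Lipschitz constant of the Jacobian of the exact center in the local norm. -/
noncomputable def jacobianLip (l ρ R μ : ℝ) : ℝ :=
  l * (1 + R * centerLip l ρ R μ) * (1 + R * centerLip l ρ R μ) * R / μ +
    2 * centerLip l ρ R μ * centerLip l ρ R μ

/-- Lipschitz constant of the gradient of the smoothed objective. -/
noncomputable def gradLip (l ρ R lf0 μ : ℝ) : ℝ :=
  l * (1 + R * centerLip l ρ R μ) * (1 + R * centerLip l ρ R μ) +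
    lf0 * (R * jacobianLip l ρ R μ)

variable {l ρ R lf0 lg0 : ℝ} (B : P.HasBounds l ρ R lf0 lg0)
include B

theorem Problem.HasBounds.centerLip_pos {μ : ℝ} (hμ : 0 < μ) : 0 < centerLip l ρ R μ := by
  have := B.l_pos; have := B.ρ_pos; have := B.R_pos
  unfold centerLip; positivity

theorem Problem.HasBounds.jacobianLip_pos {μ : ℝ} (hμ : 0 < μ) : 0 < jacobianLip l ρ R μ := by
  have := B.l_pos; have := B.ρ_pos; have := B.R_pos; have := B.centerLip_pos hμ
  unfold jacobianLip; positivity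

theorem Problem.HasBounds.abs_psi_cross_le (μ : ℝ) (x : Vec dx) {c : Vec dy}
    (hc : c ∈ P.interiorY) (u : Vec dx) (v : Vec dy) :
    |jointHess (P.psi μ) x c (u, 0) (0, v)| ≤ l * ‖u‖ * ‖v‖ := by
  rw [jointHess_psi_apply B.g_smooth μ hc, map_zero, inner_zero_left, mul_zero, add_zero]
  refine ((jointHess P.g x c).le_opNorm₂ (u, 0) (0, v)).trans ?_
  rw [Prod.norm_mk, Prod.norm_mk, norm_zero, norm_zero, max_eq_right (norm_nonneg v),
    max_eq_left (norm_nonneg u)]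
  have := B.g_hess_le x c hc
  gcongr

/-- The implicit equation is tested against its own solution: `μ ‖w‖_c² ≤ l ‖u‖ · R ‖w‖_c`. The
resulting constant `l R / μ` is enlarged to `centerLip`. -/
theorem Problem.HasBounds.dikinNorm_jacobian_le {μ : ℝ} (hμ : 0 < μ) (x : Vec dx) {c : Vec dy}
    (hc : c ∈ P.interiorY) {u : Vec dx} {w : Vec dy}
    (hw : jointHess (P.psi μ) x c (u, w) (0, w) = 0) :
    P.dikinNorm c w ≤ centerLip l ρ R μ * ‖u‖ := by
  have h1 := (B.psi_hess_bounds μ x hc w).1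
  have h2 := abs_le.1 (B.abs_psi_cross_le μ x hc u w)
  have h3 : (u, w) = (u, (0 : Vec dy)) + ((0 : Vec dx), w) := by simp
  rw [h3, map_add, add_apply] at hw
  have h4 := B.norm_le_dikinNorm hc w
  have hl := B.l_pos
  have hρ := B.ρ_pos
  have hR := B.R_pos
  set D := P.dikinNorm c w with hD
  have hD0 : 0 ≤ D := dikinNorm_nonneg _ _
  have h5 : μ * D ^ 2 ≤ l * ‖u‖ * (R * D) := by
    have : l * ‖u‖ * ‖w‖ ≤ l * ‖u‖ * (R * D) := by gcongr
    linarith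
  have h6 : D ≤ l * R / μ * ‖u‖ := by
    rcases hD0.eq_or_lt with h | h
    · rw [← h]; positivity
    · rw [div_mul_eq_mul_div, le_div_iff₀ hμ]
      refine le_of_mul_le_mul_right ?_ h
      linarith
  refine h6.trans ?_
  unfold centerLip
  have h7 : l * R ≤ 6 * R * (l + ρ) := by nlinarith [mul_pos hR hl, mul_pos hR hρ]
  exact mul_le_mul_of_nonneg_right (div_le_div_of_nonneg_right h7 hμ.le) (norm_nonneg _)

/-- Slack ratios of two exact centers deviate from one by at most a multiple of the distance. -/
theorem Problem.HasBounds.abs_slack_ratio_sub_le {μ : ℝ} (hμ : 0 < μ) (hlf0 : 0 ≤ lf0)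
    (x₁ x₂ : Vec dx) (i : Fin m) :
    |P.slack (P.exactCenter μ x₂) i / P.slack (P.exactCenter μ x₁) i -
      P.slack (P.exactCenter μ x₁) i / P.slack (P.exactCenter μ x₂) i| ≤
        2 * centerLip l ρ R μ * ‖x₂ - x₁‖ := by
  have h1 := (abs_slack_div_sub_one_le (B.exactCenter_mem hμ x₁) (P.exactCenter μ x₂) i).trans
    (B.exactCenter_stability hμ hlf0 x₁ x₂)
  have h2 := (abs_slack_div_sub_one_le (B.exactCenter_mem hμ x₂) (P.exactCenter μ x₁) i).trans
    (B.exactCenter_stability hμ hlf0 x₂ x₁)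
  rw [norm_sub_rev] at h2
  rw [abs_le] at h1 h2 ⊢
  unfold centerLip
  constructor <;> linarith

theorem Problem.HasBounds.norm_exactCenter_sub_le {μ : ℝ} (hμ : 0 < μ) (hlf0 : 0 ≤ lf0)
    (x₁ x₂ : Vec dx) :
    ‖P.exactCenter μ x₂ - P.exactCenter μ x₁‖ ≤ R * centerLip l ρ R μ * ‖x₂ - x₁‖ := by
  have h1 := B.norm_le_dikinNorm (B.exactCenter_mem hμ x₁) (P.exactCenter μ x₂ - P.exactCenter μ x₁)
  have h2 := mul_le_mul_of_nonneg_left (B.exactCenter_stability hμ hlf0 x₁ x₂) B.R_pos.le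
  exact h1.trans (h2.trans_eq (by unfold centerLip; ring))

theorem Problem.HasBounds.dikinNorm_fderiv_exactCenter_le {μ : ℝ} (hμ : 0 < μ) (hlf0 : 0 ≤ lf0)
    (x u : Vec dx) : P.dikinNorm (P.exactCenter μ x) (fderiv ℝ (P.exactCenter μ) x u) ≤
      centerLip l ρ R μ * ‖u‖ :=
  B.dikinNorm_jacobian_le hμ x (B.exactCenter_mem hμ x)
    ((B.fderiv_exactCenter_spec hμ hlf0 x).2 u _)

theorem Problem.HasBounds.norm_graph_le {μ : ℝ} (hμ : 0 < μ) (hlf0 : 0 ≤ lf0) (x u : Vec dx) :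
    ‖(u, fderiv ℝ (P.exactCenter μ) x u)‖ ≤ (1 + R * centerLip l ρ R μ) * ‖u‖ := by
  have h1 := B.norm_le_dikinNorm (B.exactCenter_mem hμ x) (fderiv ℝ (P.exactCenter μ) x u)
  have h2 := mul_le_mul_of_nonneg_left (B.dikinNorm_fderiv_exactCenter_le hμ hlf0 x u) B.R_pos.le
  have h3 : 0 ≤ R * (centerLip l ρ R μ * ‖u‖) :=
    mul_nonneg B.R_pos.le (mul_nonneg (B.centerLip_pos hμ).le (norm_nonneg _))
  rw [Prod.norm_mk]
  refine max_le ?_ ?_ <;> linarith [norm_nonneg u]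

/-- The implicit equations at the two anchors are subtracted and tested against the difference of
the Jacobians. The change of `∇²g` is controlled by its Lipschitz constant, the change of metric by
slack ratios of the two centers; coercivity at the first anchor closes the estimate. -/
theorem Problem.HasBounds.jacobian_lipschitz {μ : ℝ} (hμ : 0 < μ) (hlf0 : 0 ≤ lf0)
    (x₁ x₂ u : Vec dx) :
    P.dikinNorm (P.exactCenter μ x₁)
      (fderiv ℝ (P.exactCenter μ) x₂ u - fderiv ℝ (P.exactCenter μ) x₁ u) ≤
        jacobianLip l ρ R μ * ‖x₂ - x₁‖ * ‖u‖ := by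
  have hc₁ := B.exactCenter_mem hμ x₁
  have hc₂ := B.exactCenter_mem hμ x₂
  have hJ₁ := (B.fderiv_exactCenter_spec hμ hlf0 x₁).2
  have hJ₂ := (B.fderiv_exactCenter_spec hμ hlf0 x₂).2
  have hgr := B.norm_graph_le hμ hlf0 x₂ u
  have hloc := B.dikinNorm_fderiv_exactCenter_le hμ hlf0 x₂ u
  have hE := B.norm_exactCenter_sub_le hμ hlf0 x₁ x₂
  have hM := B.centerLip_pos hμ
  have hθ := B.abs_slack_ratio_sub_le hμ hlf0 x₁ x₂
  have hR := B.R_pos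
  have hl := B.l_pos
  set c₁ := P.exactCenter μ x₁
  set c₂ := P.exactCenter μ x₂
  set a₁ := fderiv ℝ (P.exactCenter μ) x₁ u
  set a₂ := fderiv ℝ (P.exactCenter μ) x₂ u
  set M := centerLip l ρ R μ with hMdef
  set w := a₂ - a₁ with hw
  set D := P.dikinNorm c₁ w with hD
  have hD0 : 0 ≤ D := dikinNorm_nonneg _ _
  have h1 := (B.psi_hess_bounds μ x₁ hc₁ w).1
  have h2 : jointHess (P.psi μ) x₁ c₁ (0, w) (0, w) =
      (jointHess P.g x₁ c₁ - jointHess P.g x₂ c₂) (u, a₂) (0, w) +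
        μ * (inner ℝ (P.scaled c₁ a₂) (P.scaled c₁ w) -
          inner ℝ (P.scaled c₂ a₂) (P.scaled c₂ w)) := by
    have e1 : ((0 : Vec dx), w) = (u, a₂) - (u, a₁) := by simp [hw]
    have e2 : jointHess (P.psi μ) x₁ c₁ (0, w) (0, w) =
        jointHess (P.psi μ) x₁ c₁ (u, a₂) (0, w) - jointHess (P.psi μ) x₂ c₂ (u, a₂) (0, w) := by
      rw [hJ₂ u w, sub_zero]
      have e3 : jointHess (P.psi μ) x₁ c₁ (0, w) =
          jointHess (P.psi μ) x₁ c₁ (u, a₂) - jointHess (P.psi μ) x₁ c₁ (u, a₁) := by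
        rw [e1, map_sub]
      rw [e3, sub_apply, hJ₁ u w, sub_zero]
    rw [e2, jointHess_psi_apply B.g_smooth μ hc₁, jointHess_psi_apply B.g_smooth μ hc₂,
      sub_apply, sub_apply]
    ring
  have h3 : (jointHess P.g x₁ c₁ - jointHess P.g x₂ c₂) (u, a₂) (0, w) ≤
      l * (‖x₂ - x₁‖ + R * M * ‖x₂ - x₁‖) * ((1 + R * M) * ‖u‖) * (R * D) := by
    refine (le_abs_self _).trans (((jointHess P.g x₁ c₁ - jointHess P.g x₂ c₂).le_opNorm₂
      (u, a₂) (0, w)).trans ?_)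
    have k1 := B.g_hess_lip x₁ x₂ c₁ hc₁ c₂ hc₂
    rw [norm_sub_rev x₁, norm_sub_rev c₁] at k1
    have k2 : ‖jointHess P.g x₁ c₁ - jointHess P.g x₂ c₂‖ ≤
        l * (‖x₂ - x₁‖ + R * M * ‖x₂ - x₁‖) := k1.trans (by gcongr)
    have k3 : ‖((0 : Vec dx), w)‖ ≤ R * D := by
      rw [Prod.norm_mk, norm_zero, max_eq_right (norm_nonneg w)]
      exact B.norm_le_dikinNorm hc₁ w
    gcongr
  -- The mixed form of the metric comparison: `a₂` is bounded in the metric at `c₂`, where its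
  -- implicit equation lives, and `w` in the metric at `c₁`.
  have h4 : inner ℝ (P.scaled c₁ a₂) (P.scaled c₁ w) - inner ℝ (P.scaled c₂ a₂) (P.scaled c₂ w) ≤
      2 * M * ‖x₂ - x₁‖ * (M * ‖u‖) * D := by
    have k := abs_inner_scaled_sub_le' hc₁ hc₂ (θ := 2 * M * ‖x₂ - x₁‖) (by positivity)
      (fun i => by rw [abs_sub_comm]; exact hθ i) a₂ w
    have k' := neg_le_of_abs_le k
    have : 2 * M * ‖x₂ - x₁‖ * P.dikinNorm c₂ a₂ * P.dikinNorm c₁ w ≤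
        2 * M * ‖x₂ - x₁‖ * (M * ‖u‖) * D := by gcongr
    linarith
  have h5 : μ * D ^ 2 ≤ μ * (jacobianLip l ρ R μ * ‖x₂ - x₁‖ * ‖u‖) * D := by
    have h6 := mul_le_mul_of_nonneg_left h4 hμ.le
    have h7 : μ * (jacobianLip l ρ R μ * ‖x₂ - x₁‖ * ‖u‖) * D =
        l * (‖x₂ - x₁‖ + R * M * ‖x₂ - x₁‖) * ((1 + R * M) * ‖u‖) * (R * D) +
          μ * (2 * M * ‖x₂ - x₁‖ * (M * ‖u‖) * D) := by
      rw [jacobianLip, ← hMdef]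
      field_simp
    rw [h7]
    linarith
  rcases hD0.eq_or_lt with h | h
  · rw [← h]
    have := B.jacobianLip_pos hμ
    positivity
  · refine le_of_mul_le_mul_right (a := μ * D) ?_ (by positivity)
    linarith

/-- A product rule: either the derivative of `f` changes along a fixed graph direction, or the graph
direction changes by the difference of the Jacobians. -/
theorem Problem.HasBounds.gradient_F_lipschitz {μ : ℝ} (hμ : 0 < μ) (hlf0 : 0 ≤ lf0)
    (x₁ x₂ : Vec dx) :
    ‖gradient (P.F μ) x₂ - gradient (P.F μ) x₁‖ ≤ gradLip l ρ R lf0 μ * ‖x₂ - x₁‖ := by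
  have hc₁ := B.exactCenter_mem hμ x₁
  have hc₂ := B.exactCenter_mem hμ x₂
  have hM := B.centerLip_pos hμ
  have hR := B.R_pos
  have hl := B.l_pos
  set M := centerLip l ρ R μ with hMdef
  have key : ∀ u, inner ℝ (gradient (P.F μ) x₂ - gradient (P.F μ) x₁) u ≤
      gradLip l ρ R lf0 μ * ‖x₂ - x₁‖ * ‖u‖ := by
    intro u
    have hgr := B.norm_graph_le hμ hlf0 x₂ u
    have hE := B.norm_exactCenter_sub_le hμ hlf0 x₁ x₂
    have hJ := B.jacobian_lipschitz hμ hlf0 x₁ x₂ u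
    have hf := B.f_deriv_lip x₂ x₁ _ hc₂ _ hc₁
    rw [inner_sub_left, B.inner_gradient_F hμ hlf0, B.inner_gradient_F hμ hlf0]
    set c₁ := P.exactCenter μ x₁
    set c₂ := P.exactCenter μ x₂
    set a₁ := fderiv ℝ (P.exactCenter μ) x₁ u
    set a₂ := fderiv ℝ (P.exactCenter μ) x₂ u
    have e1 : jointDeriv P.f x₂ c₂ (u, a₂) - jointDeriv P.f x₁ c₁ (u, a₁) =
        (jointDeriv P.f x₂ c₂ - jointDeriv P.f x₁ c₁) (u, a₂) +
          jointDeriv P.f x₁ c₁ (0, a₂ - a₁) := by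
      have : ((0 : Vec dx), a₂ - a₁) = (u, a₂) - (u, a₁) := by simp
      rw [this, map_sub, sub_apply]
      ring
    have e2 : (jointDeriv P.f x₂ c₂ - jointDeriv P.f x₁ c₁) (u, a₂) ≤
        l * (‖x₂ - x₁‖ + R * M * ‖x₂ - x₁‖) * ((1 + R * M) * ‖u‖) := by
      refine (le_abs_self _).trans (((jointDeriv P.f x₂ c₂ - jointDeriv P.f x₁ c₁).le_opNorm
        (u, a₂)).trans ?_)
      have k2 : ‖jointDeriv P.f x₂ c₂ - jointDeriv P.f x₁ c₁‖ ≤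
        l * (‖x₂ - x₁‖ + R * M * ‖x₂ - x₁‖) := hf.trans (by gcongr)
      gcongr
    have e3 : jointDeriv P.f x₁ c₁ (0, a₂ - a₁) ≤
        lf0 * (R * (jacobianLip l ρ R μ * ‖x₂ - x₁‖ * ‖u‖)) := by
      refine (le_abs_self _).trans ((B.f_derivY_le x₁ c₁ hc₁ _).trans ?_)
      have := (B.norm_le_dikinNorm hc₁ (a₂ - a₁)).trans (mul_le_mul_of_nonneg_left hJ hR.le)
      gcongr
    rw [e1]
    refine (add_le_add e2 e3).trans_eq ?_
    rw [gradLip, ← hMdef]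
    ring
  set q := gradient (P.F μ) x₂ - gradient (P.F μ) x₁ with hq
  have h1 := key q
  rw [real_inner_self_eq_norm_sq] at h1
  rcases (norm_nonneg q).eq_or_lt with h | h
  · rw [← h]
    have := B.jacobianLip_pos hμ
    unfold gradLip
    rw [← hMdef]
    positivity
  · refine le_of_mul_le_mul_right ?_ h
    linarith

end JacobianLipschitz

/-! ### Existence of local Dikin constants -/

section ConstantsExist

variable {dx dy m : ℕ} {P : Problem dx dy m}

/-- Local Dikin constants for radii up to `1/4`; only the multiplier threshold depends on `η`. -/
noncomputable def uniformConstants (l ρ R lf0 μ η : ℝ) : DikinConstants where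
  ρψ := 4 / 9 * μ
  lψ1 := 4 * (l * R ^ 2 + μ) + l * R
  lf0 := 2 * R * lf0
  lf1 := l * R + l * R ^ 2
  ls0 := 1 + centerLip l ρ R μ
  ls1 := jacobianLip l ρ R μ
  ll0 := centerLip l ρ R μ
  LF := gradLip l ρ R lf0 μ
  lamη := l / ρ + 2 * (2 * R * lf0) / (4 / 9 * μ) / η

variable {l ρ R lf0 lg0 : ℝ} (B : P.HasBounds l ρ R lf0 lg0)
include B

/-- The tube radius is `2η ≤ 1/2`, so moving from the anchor to a point of the tube changes squared
norms by at most `(1 - 1/2)⁻² = 4` one way and `(1 + 1/2)² = 9/4` the other. This is the origin of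
the factors `4` and `4/9` in `uniformConstants`. -/
theorem Problem.HasBounds.localBounds {μ : ℝ} (hμ : 0 < μ) (hlf0 : 0 ≤ lf0) {η : ℝ}
    (hη : η ≤ 1 / 4) (x : Vec dx) {c : Vec dy} (hc : c ∈ P.interiorY) :
    P.LocalBounds μ η (uniformConstants l ρ R lf0 μ η) x c := by
  have hR := B.R_pos
  have hl := B.l_pos
  have hψ := contDiffOn_psi B.g_smooth μ
  refine ⟨?_, ?_, ?_, ?_, ?_⟩ <;> intro y hy <;> obtain ⟨hyi, hyd⟩ := hy
  · intro u
    rw [hessYY_eq isOpen_region hψ (mem_region hyi)]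
    obtain ⟨h1, h2⟩ := B.psi_hess_bounds μ x hyi u
    have hr : P.dikinNorm c (y - c) ≤ 1 / 2 := hyd.trans (by linarith)
    have h3 := dikinNorm_le_div hc (by norm_num) hr u
    have h4 := dikinNorm_le_mul hc (by norm_num) hr u
    have h5 := pow_le_pow_left₀ (dikinNorm_nonneg _ _) h3 2
    have h6 := pow_le_pow_left₀ (dikinNorm_nonneg _ _) h4 2
    have h7 : P.dikinNorm y u ^ 2 ≤ 4 * P.dikinNorm c u ^ 2 := h5.trans_eq (by ring)
    have h8 : P.dikinNorm c u ^ 2 ≤ 9 / 4 * P.dikinNorm y u ^ 2 := h6.trans_eq (by ring)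
    simp only [uniformConstants]
    constructor
    · refine le_trans ?_ h1
      have := mul_le_mul_of_nonneg_left h8 hμ.le
      linarith
    · refine h2.trans ?_
      have h9 := mul_le_mul_of_nonneg_left h7 (by positivity : 0 ≤ l * R ^ 2 + μ)
      have : 0 ≤ l * R * P.dikinNorm c u ^ 2 := by positivity
      linarith
  · intro u v
    rw [hessXY_eq isOpen_region hψ (mem_region hyi)]
    have h1 := B.abs_psi_cross_le μ x hyi u v
    have h2 := mul_le_mul_of_nonneg_left (B.norm_le_dikinNorm hc v)
      (by positivity : 0 ≤ l * ‖u‖)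
    have h3 : 0 ≤ 4 * (l * R ^ 2 + μ) * (‖u‖ * P.dikinNorm c v) := by
      have := dikinNorm_nonneg (P := P) c v
      positivity
    simp only [uniformConstants]
    linarith
  · intro v
    rw [inner_gradY isOpen_region B.f_smooth (mem_region hyi)]
    have h1 := B.f_derivY_le x y hyi v
    have h2 := mul_le_mul_of_nonneg_left (B.norm_le_dikinNorm hc v) hlf0
    have h3 : 0 ≤ lf0 * R * P.dikinNorm c v := by
      have := dikinNorm_nonneg (P := P) c v
      positivity
    simp only [uniformConstants]
    linarith
  · intro u v
    rw [hessXY_eq isOpen_region B.f_smooth (mem_region hyi)]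
    have h1 := (jointHess P.f x y).le_opNorm₂ (u, 0) (0, v)
    rw [Prod.norm_mk, Prod.norm_mk, norm_zero, norm_zero, max_eq_right (norm_nonneg v),
      max_eq_left (norm_nonneg u)] at h1
    have h0 := dikinNorm_nonneg (P := P) c v
    refine h1.trans ?_
    have h2 := B.f_hess_le x y hyi
    have h3 := B.norm_le_dikinNorm hc v
    calc ‖jointHess P.f x y‖ * ‖u‖ * ‖v‖ ≤ l * ‖u‖ * (R * P.dikinNorm c v) := by gcongr
      _ = l * R * ‖u‖ * P.dikinNorm c v := by ring
      _ ≤ (l * R + l * R ^ 2) * ‖u‖ * P.dikinNorm c v := by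
        gcongr
        exact le_add_of_nonneg_right (by positivity)
  · intro u v
    rw [hessYY_eq isOpen_region B.f_smooth (mem_region hyi)]
    have h1 := (jointHess P.f x y).le_opNorm₂ (0, u) (0, v)
    rw [Prod.norm_mk, Prod.norm_mk, norm_zero, max_eq_right (norm_nonneg v),
      max_eq_right (norm_nonneg u)] at h1
    have h0 := dikinNorm_nonneg (P := P) c v
    have h0' := dikinNorm_nonneg (P := P) c u
    refine h1.trans ?_
    have h2 := B.f_hess_le x y hyi
    have h3 := B.norm_le_dikinNorm hc v
    have h4 := B.norm_le_dikinNorm hc u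
    calc ‖jointHess P.f x y‖ * ‖u‖ * ‖v‖ ≤ l * (R * P.dikinNorm c u) * (R * P.dikinNorm c v) := by
          gcongr
      _ = l * R ^ 2 * P.dikinNorm c u * P.dikinNorm c v := by ring
      _ ≤ (l * R + l * R ^ 2) * P.dikinNorm c u * P.dikinNorm c v := by
        gcongr
        exact le_add_of_nonneg_left (by positivity)

theorem Problem.HasBounds.isDikinConstants {μ : ℝ} (hμ : 0 < μ) (hlf0 : 0 ≤ lf0) {η : ℝ}
    (hη0 : 0 < η) (hη : η ≤ 1 / 4) :
    P.IsDikinConstants μ η (uniformConstants l ρ R lf0 μ η) := by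
  have hR := B.R_pos
  have hl := B.l_pos
  have hρ := B.ρ_pos
  have hM := B.centerLip_pos hμ
  have hJ := B.jacobianLip_pos hμ
  have hlam : 0 < l / ρ + 2 * (2 * R * lf0) / (4 / 9 * μ) / η := by positivity
  -- The two summands of the threshold `λ_η`: the first lets strong convexity of `g` absorb `f / λ`,
  -- the second keeps the proxy center within `η` of the exact one.
  have hp : ∀ lam, l / ρ + 2 * (2 * R * lf0) / (4 / 9 * μ) / η ≤ lam →
      0 < lam ∧ 1 / lam * l ≤ ρ ∧ 2 * (2 * R * lf0) / (4 / 9 * μ) / lam ≤ η := by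
    intro lam h
    have h0 : 0 < lam := hlam.trans_le h
    have h1 : 0 ≤ 2 * (2 * R * lf0) / (4 / 9 * μ) / η := by positivity
    have h2 : 0 ≤ l / ρ := by positivity
    refine ⟨h0, ?_, ?_⟩
    · rw [one_div_mul_eq_div, div_le_iff₀ h0, mul_comm, ← div_le_iff₀ hρ]
      linarith
    · rw [div_le_iff₀ h0, mul_comm η, ← div_le_iff₀ hη0]
      linarith
  -- The gradient bound in `uniformConstants` is doubled for this comparison: the prescribed
  -- coefficient becomes `9 R lf0 / μ`, above the `6 R lf0 / μ` of the stability estimate.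
  have hconst : 6 * R / μ * lf0 ≤ 2 * (2 * R * lf0) / (4 / 9 * μ) := by
    have : 2 * (2 * R * lf0) / (4 / 9 * μ) = 9 * R / μ * lf0 := by field_simp; ring
    rw [this]
    gcongr
    norm_num
  have hstab : ∀ {p₁ p₂ : ℝ} {x₁ x₂ : Vec dx} {c₁ c₂ : Vec dy}, 0 ≤ p₁ → p₁ * l ≤ ρ →
      P.IsStationary μ p₁ x₁ c₁ → P.IsStationary μ p₂ x₂ c₂ →
      P.dikinNorm c₁ (c₂ - c₁) ≤ 2 * (2 * R * lf0) / (4 / 9 * μ) * |p₂ - p₁| +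
        centerLip l ρ R μ * ‖x₂ - x₁‖ := by
    intro p₁ p₂ x₁ x₂ c₁ c₂ h1 h2 h3 h4
    refine (B.stability hμ hlf0 h1 h2 h3 h4).trans ?_
    have := mul_le_mul_of_nonneg_right hconst (abs_nonneg (p₂ - p₁))
    have e : 6 * R / μ * ((l + ρ) * ‖x₂ - x₁‖ + lf0 * |p₂ - p₁|) =
        6 * R / μ * lf0 * |p₂ - p₁| + centerLip l ρ R μ * ‖x₂ - x₁‖ := by
      unfold centerLip; ring
    rw [e]
    linarith
  refine
    { ρψ_pos := ?_
      lψ1_pos := ?_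
      lf0_nonneg := ?_
      lf1_nonneg := ?_
      one_le_ls0 := ?_
      ls1_nonneg := ?_
      ll0_nonneg := ?_
      ll0_le_ls0 := ?_
      LF_nonneg := ?_
      lamη_pos := ?_
      exact_bounds := fun x => B.localBounds hμ hlf0 hη x (B.exactCenter_mem hμ x)
      proxy_bounds := fun lam hlam x =>
        B.localBounds hμ hlf0 hη x (B.proxyCenter_mem hμ (hp lam hlam).1 x)
      proxy_transfer := ?_
      proxy_stability := ?_
      exact_stability := ?_
      exact_jacobian := ?_
      F_smooth := ?_ }
  any_goals simp only [uniformConstants]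
  any_goals positivity
  · linarith
  · linarith
  · unfold gradLip; positivity
  · intro lam hlam x
    obtain ⟨h0, h1, h2⟩ := hp lam hlam
    refine ⟨?_, h2⟩
    have := hstab le_rfl (by rw [zero_mul]; exact hρ.le) (B.exactCenter_isStationary hμ x)
      (B.proxyCenter_isStationary hμ h0 x)
    rw [sub_zero, sub_self, norm_zero, mul_zero, add_zero, abs_of_pos (by positivity),
      mul_one_div] at this
    exact this
  · intro lam₁ lam₂ h₁ h₂ x₁ x₂
    obtain ⟨h01, h11, -⟩ := hp lam₁ h₁
    obtain ⟨h02, -, -⟩ := hp lam₂ h₂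
    exact hstab (by positivity) h11 (B.proxyCenter_isStationary hμ h01 x₁)
      (B.proxyCenter_isStationary hμ h02 x₂)
  · intro x₁ x₂
    have := B.exactCenter_stability hμ hlf0 x₁ x₂
    refine this.trans ?_
    rw [← centerLip]
    gcongr
    linarith
  · exact fun x₁ x₂ u => B.jacobian_lipschitz hμ hlf0 x₁ x₂ u
  · exact fun x₁ x₂ => B.gradient_F_lipschitz hμ hlf0 x₁ x₂

end ConstantsExist

end BarrierBilevel

namespace BarrierBilevel

/-! ### Existence of valid polynomial schedules -/

section Schedules

variable {T : ℕ} {ξ α₀ γ₀ lam₀ k₀ : ℝ}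

theorem polySchedule_lam_zero (hk₀ : 0 < k₀) : (polySchedule T ξ α₀ γ₀ lam₀ k₀).lam 0 = lam₀ := by
  simp [polySchedule, div_self hk₀.ne']

/-- The effective proxy step size of the polynomial profile is constant. -/
theorem polySchedule_β (hk₀ : 0 < k₀) (k : ℕ) :
    (polySchedule T ξ α₀ γ₀ lam₀ k₀).β k = α₀ * lam₀ / k₀ ^ (1 / 3 : ℝ) := by
  have h1 : 0 < (k : ℝ) + k₀ := by positivity
  have h2 : 0 < ((k : ℝ) + k₀) ^ (1 / 3 : ℝ) := Real.rpow_pos_of_pos h1 _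
  have h3 : 0 < k₀ ^ (1 / 3 : ℝ) := Real.rpow_pos_of_pos hk₀ _
  simp only [Schedule.β, polySchedule]
  rw [Real.div_rpow h1.le hk₀.le]
  field_simp

theorem polySchedule_lam_pos (hk₀ : 0 < k₀) (hlam₀ : 0 < lam₀) (k : ℕ) :
    0 < (polySchedule T ξ α₀ γ₀ lam₀ k₀).lam k := by
  simp only [polySchedule]
  positivity

theorem polySchedule_α_le (hk₀ : 0 < k₀) (hα₀ : 0 < α₀) (k : ℕ) :
    (polySchedule T ξ α₀ γ₀ lam₀ k₀).α k ≤ α₀ / k₀ ^ (1 / 3 : ℝ) := by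
  simp only [polySchedule]
  gcongr
  linarith [(Nat.cast_nonneg k : (0 : ℝ) ≤ k)]

theorem polySchedule_lam_mono (hk₀ : 0 < k₀) (hlam₀ : 0 < lam₀) :
    Monotone (polySchedule T ξ α₀ γ₀ lam₀ k₀).lam := by
  intro j k hjk
  simp only [polySchedule]
  gcongr

theorem polySchedule_δ_le (hk₀ : 0 < k₀) (hlam₀ : 0 < lam₀) (k : ℕ) :
    (polySchedule T ξ α₀ γ₀ lam₀ k₀).δ k / (polySchedule T ξ α₀ γ₀ lam₀ k₀).lam k ≤ 1 / k₀ := by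
  rw [div_le_iff₀ (polySchedule_lam_pos hk₀ hlam₀ k)]
  simp only [polySchedule, Schedule.δ]
  have h1 : 0 < (k : ℝ) + k₀ := by positivity
  have h2 : ((k + 1 : ℕ) + k₀) / k₀ = (1 + 1 / ((k : ℝ) + k₀)) * (((k : ℝ) + k₀) / k₀) := by
    push_cast; field_simp; ring
  have h3 : (1 + 1 / ((k : ℝ) + k₀)) ^ (1 / 3 : ℝ) ≤ 1 + 1 / k₀ := by
    have h4 : (1 : ℝ) ≤ 1 + 1 / ((k : ℝ) + k₀) := by
      have : 0 < 1 / ((k : ℝ) + k₀) := by positivity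
      linarith
    calc _ ≤ (1 + 1 / ((k : ℝ) + k₀)) ^ (1 : ℝ) := Real.rpow_le_rpow_of_exponent_le h4 (by norm_num)
      _ = 1 + 1 / ((k : ℝ) + k₀) := Real.rpow_one _
      _ ≤ 1 + 1 / k₀ := by gcongr; linarith [(Nat.cast_nonneg k : (0 : ℝ) ≤ k)]
  rw [h2, Real.mul_rpow (by positivity) (by positivity)]
  have h5 : 0 ≤ lam₀ * (((k : ℝ) + k₀) / k₀) ^ (1 / 3 : ℝ) := by positivity
  have h6 := mul_le_mul_of_nonneg_right h3 h5
  linarith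

/-- Every restriction on `ξ` is linear in `ξ`. Stating it for all smaller positive `ξ`, with `X` of
any sign, allows the minimum of finitely many thresholds. -/
theorem exists_pos_mul_le (X : ℝ) {Y : ℝ} (hY : 0 < Y) :
    ∃ ξ₀ : ℝ, 0 < ξ₀ ∧ ∀ ξ, 0 < ξ → ξ ≤ ξ₀ → ξ * X ≤ Y := by
  refine ⟨Y / (|X| + 1), by positivity, fun ξ h0 h1 => ?_⟩
  rw [le_div_iff₀ (by positivity)] at h1
  have := mul_le_mul_of_nonneg_left (le_abs_self X) h0.le
  linarith

theorem frozen_defect_le {η : ℝ} (h0 : 0 < η) (h : η ≤ 1 / 4) : ((1 - η) ^ 2)⁻¹ - 1 ≤ 4 * η := by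
  rw [sub_le_iff_le_add, inv_le_iff_one_le_mul₀ (by nlinarith)]
  nlinarith [mul_pos h0 h0, mul_pos (mul_pos h0 h0) h0]

/-- For a small radius every family of constants admits valid polynomial schedules. -/
theorem exists_validPolySchedule {cξ lf0 lg0 η : ℝ} (hc : 0 < cξ) {C : DikinConstants}
    (hρ : 0 < C.ρψ) (hl : 0 < C.lψ1) (hf0 : 0 ≤ C.lf0) (hf1 : 0 ≤ C.lf1) (hlamη : 0 < C.lamη)
    (hη0 : 0 < η) (hη : η ≤ 1 / 4) (hηs : η * (64 * C.lψ1) ≤ C.ρψ) (hT : 1 ≤ T) :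
    ∃ ξ α₀ γ₀ lam₀ k₀ : ℝ, ValidPolySchedule cξ lf0 lg0 η C T ξ α₀ γ₀ lam₀ k₀ := by
  have hT0 : (0 : ℝ) < T := by exact_mod_cast hT
  set γ₀ := min (1 / (4 * C.lψ1)) (1 / (4 * T * C.ρψ)) with hγ
  have hγ0 : 0 < γ₀ := lt_min (by positivity) (by positivity)
  -- The sum of all lower bounds on `λ₀`. Its last term gives `ℓ_{f,1} ≤ λ₀ ℓ_{ψ,1}`, which reduces
  -- the frozen-metric condition of the proxy tracker to smallness of `η`.
  set lam₀ := C.lamη + 2 * C.lf1 / C.ρψ + 8 * C.lf0 / (η * C.ρψ) + C.lf1 / C.lψ1 with hlam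
  have t1 : 0 ≤ 2 * C.lf1 / C.ρψ := by positivity
  have t2 : 0 ≤ 8 * C.lf0 / (η * C.ρψ) := by positivity
  have t3 : 0 ≤ C.lf1 / C.lψ1 := by positivity
  have hlam0 : 0 < lam₀ := by linarith
  -- Relative multiplier increments are at most `1 / k₀`, which now equals the permitted `T ρ_ψ β /
  -- 16`, because `α₀` is chosen next to make `β = γ₀`.
  set k₀ := 16 / (T * C.ρψ * γ₀) with hk
  have hk0 : 0 < k₀ := by positivity
  have hk3 : 0 < k₀ ^ (1 / 3 : ℝ) := Real.rpow_pos_of_pos hk0 _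
  set α₀ := γ₀ * k₀ ^ (1 / 3 : ℝ) / lam₀ with hα
  have hα0 : 0 < α₀ := by positivity
  obtain ⟨ξ₁, p₁, h₁⟩ := exists_pos_mul_le (α₀ / k₀ ^ (1 / 3 : ℝ) * (2 * C.LF)) one_pos
  obtain ⟨ξ₂, p₂, h₂⟩ := exists_pos_mul_le (16 * C.ls0 * (lf0 / lam₀ + 2 * lg0) / T)
    (by positivity : 0 < η * C.ρψ)
  obtain ⟨ξ₃, p₃, h₃⟩ := exists_pos_mul_le (64 * C.ll0 * (lf0 / lam₀ + 2 * lg0) / T)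
    (by positivity : 0 < η * C.ρψ)
  obtain ⟨ξ₄, p₄, h₄⟩ := exists_pos_mul_le
    (max (C.lψ1 * C.ls0 ^ 2) (C.ls1 * Real.sqrt (max (lg0 ^ 2) (lf0 ^ 2))) / T)
    (by positivity : 0 < cξ * C.ρψ)
  set ξ := min (min ξ₁ ξ₂) (min ξ₃ ξ₄) with hξ
  have hξ0 : 0 < ξ := lt_min (lt_min p₁ p₂) (lt_min p₃ p₄)
  have e₁ := h₁ ξ hξ0 ((min_le_left _ _).trans (min_le_left _ _))
  have e₂ := h₂ ξ hξ0 ((min_le_left _ _).trans (min_le_right _ _))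
  have e₃ := h₃ ξ hξ0 ((min_le_right _ _).trans (min_le_left _ _))
  have e₄ := h₄ ξ hξ0 ((min_le_right _ _).trans (min_le_right _ _))
  have hβ : α₀ * lam₀ / k₀ ^ (1 / 3 : ℝ) = γ₀ := by rw [hα]; field_simp
  have hα₀ξ : 0 ≤ 2 * ξ := by linarith
  refine ⟨ξ, α₀, γ₀, lam₀, k₀, hξ0, hα0, hγ0, hlam0, hk0, by linarith, ⟨?_, ?_⟩, ?_⟩
  · have h5 := mul_le_mul_of_nonneg_right (frozen_defect_le hη0 hη) hl.le
    linarith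
  · have h6 : C.lf1 ≤ lam₀ * C.lψ1 := by
      rw [← div_le_iff₀ hl]; linarith
    have h7 : 0 ≤ lam₀ * C.lψ1 + C.lf1 := by positivity
    have h5 := mul_le_mul_of_nonneg_right (frozen_defect_le hη0 hη) h7
    have h8 := mul_le_mul_of_nonneg_left hηs hlam0.le
    have h9 := mul_le_mul_of_nonneg_left h6 hη0.le
    linarith
  · refine
      { lam_zero_curvature := ?_
        lam_zero_transfer := ?_
        β_le_γ := ?_
        γ_le := fun k => le_rfl
        α_le := ?_
        δ_nonneg := ?_
        δ_le := ?_
        exact_drift := ?_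
        proxy_drift := ?_
        anchor_switch := ?_ }
    · rw [polySchedule_lam_zero hk0]; linarith
    · rw [polySchedule_lam_zero hk0]; linarith
    · intro k; rw [polySchedule_β hk0, hβ]; exact le_rfl
    · intro k
      have h5 := polySchedule_α_le (T := T) (ξ := ξ) (γ₀ := γ₀) (lam₀ := lam₀) hk0 hα0 k
      rcases le_total 0 C.LF with h | h
      · have := mul_le_mul_of_nonneg_right h5 (by positivity : 0 ≤ 2 * ξ * C.LF)
        exact this.trans (by linarith)
      · have h6 : 0 ≤ (polySchedule T ξ α₀ γ₀ lam₀ k₀).α k := by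
          simp only [polySchedule]; positivity
        have h7 : 2 * ξ * C.LF ≤ 0 := mul_nonpos_of_nonneg_of_nonpos hα₀ξ h
        exact (mul_nonpos_of_nonneg_of_nonpos h6 h7).trans zero_le_one
    · intro k
      exact sub_nonneg.2 (polySchedule_lam_mono hk0 hlam0 (Nat.le_succ k))
    · intro k
      rw [polySchedule_β hk0, hβ]
      refine (polySchedule_δ_le hk0 hlam0 k).trans (le_of_eq ?_)
      rw [hk]
      simp only [polySchedule]
      field_simp
    · rw [polySchedule_lam_zero hk0]
      refine le_trans (le_of_eq ?_) e₂
      simp only [polySchedule]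
      ring
    · rw [polySchedule_lam_zero hk0]
      refine le_trans (le_of_eq ?_) e₃
      simp only [polySchedule]
      ring
    · refine le_trans (le_of_eq ?_) e₄
      simp only [polySchedule]
      ring

variable {dx dy m : ℕ} {P : Problem dx dy m} {l ρ R lf0 lg0 : ℝ}

/-- In `uniformConstants` the curvature pair `(ρ_ψ, ℓ_{ψ,1})` does not depend on `η`, so the
frozen-metric requirement is a fixed threshold on `η` rather than a circular condition. -/
theorem Problem.HasBounds.exists_constants_and_schedules (B : P.HasBounds l ρ R lf0 lg0) {cξ μ : ℝ}
    (hc : 0 < cξ) (hμ : 0 < μ) (hlf0 : 0 ≤ lf0) :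
    ∃ η₀ : ℝ, 0 < η₀ ∧ ∀ η : ℝ, 0 < η → η < η₀ →
      ∃ C : DikinConstants, P.IsDikinConstants μ η C ∧
        ∀ T : ℕ, 1 ≤ T → ∃ ξ α₀ γ₀ lam₀ k₀ : ℝ,
          ValidPolySchedule cξ lf0 lg0 η C T ξ α₀ γ₀ lam₀ k₀ := by
  have hR := B.R_pos
  have hl := B.l_pos
  have hl1 : 0 < 4 * (l * R ^ 2 + μ) + l * R := by positivity
  refine ⟨min (1 / 4) (4 / 9 * μ / (64 * (4 * (l * R ^ 2 + μ) + l * R))),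
    lt_min (by norm_num) (by positivity), fun η h0 h1 => ?_⟩
  have h2 : η ≤ 1 / 4 := h1.le.trans (min_le_left _ _)
  have h3 := h1.le.trans (min_le_right _ _)
  have hC := B.isDikinConstants hμ hlf0 h0 h2
  refine ⟨_, hC, fun T hT => exists_validPolySchedule hc hC.ρψ_pos hC.lψ1_pos hC.lf0_nonneg
    hC.lf1_nonneg hC.lamη_pos h0 h2 ?_ hT⟩
  exact (le_div_iff₀ (by positivity)).1 h3

end Schedules

end BarrierBilevel

namespace BarrierBilevel

/-! ### Contraction of the inner loops with a frozen metric -/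

section Contraction

variable {dx dy m : ℕ} {P : Problem dx dy m}

/-- The squared ratio lies between `a = (1 - η)²` and `a⁻¹`; as `a + a⁻¹ ≥ 2`, the upper deviation
dominates the lower one. -/
theorem abs_sq_slack_ratio_sub_one_le {c z : Vec dy} (hc : c ∈ P.interiorY) {η : ℝ} (hη : η < 1)
    (hz : P.dikinNorm c (z - c) ≤ η) (i : Fin m) :
    |(P.slack c i / P.slack z i) ^ 2 - 1| ≤ ((1 - η) ^ 2)⁻¹ - 1 := by
  obtain ⟨h1, h2⟩ := slack_le_of_dikinNorm hc hz i
  have h0 := (dikinNorm_nonneg (P := P) c (z - c)).trans hz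
  have hci := hc i
  have hzi := mem_interiorY_of_dikinNorm hc (hz.trans_lt hη) i
  have hη1 : 0 < 1 - η := by linarith
  set a := (1 - η) ^ 2 with ha
  have ha0 : 0 < a := by positivity
  have h3 : P.slack c i / P.slack z i ≤ (1 - η)⁻¹ := by
    rw [div_le_iff₀ hzi, ← div_eq_inv_mul, le_div_iff₀ hη1]; linarith
  have h4 : 1 - η ≤ P.slack c i / P.slack z i := by
    rw [le_div_iff₀ hzi]
    calc (1 - η) * P.slack z i ≤ (1 - η) * ((1 + η) * P.slack c i) := by gcongr
      _ = (1 - η ^ 2) * P.slack c i := by ring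
      _ ≤ 1 * P.slack c i := by gcongr; nlinarith
      _ = _ := one_mul _
  have h5 : (P.slack c i / P.slack z i) ^ 2 ≤ a⁻¹ := by
    rw [ha, ← inv_pow]; exact pow_le_pow_left₀ (by positivity) h3 2
  have h6 : a ≤ (P.slack c i / P.slack z i) ^ 2 := pow_le_pow_left₀ hη1.le h4 2
  have h7 : 2 ≤ a + a⁻¹ := by
    have : a + a⁻¹ - 2 = (a - 1) ^ 2 / a := by field_simp; ring
    have : 0 ≤ (a - 1) ^ 2 / a := by positivity
    linarith
  rw [abs_le]
  constructor <;> linarith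

/-- One preconditioned step with a frozen metric contracts the local distance to the anchor. -/
theorem frozen_step_le {c z₀ z p : Vec dy} {η γ ρ ℓ : ℝ} {w : Vec dy → Vec dy →L[ℝ] ℝ}
    {M : Vec dy → Vec dy →L[ℝ] Vec dy →L[ℝ] ℝ} (hc : c ∈ P.interiorY) (hη : η < 1 / 2)
    (hz₀ : P.dikinNorm c (z₀ - c) ≤ η) (hz : P.dikinNorm c (z - c) ≤ η)
    (hM : ∀ y, P.dikinNorm c (y - c) ≤ η → HasFDerivAt w (M y) y)
    (hsymm : ∀ y, P.dikinNorm c (y - c) ≤ η → ∀ u v, M y u v = M y v u)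
    (hbd : ∀ y, P.dikinNorm c (y - c) ≤ η → ∀ u,
      ρ * P.dikinNorm c u ^ 2 ≤ M y u u ∧ M y u u ≤ ℓ * P.dikinNorm c u ^ 2)
    (hw : w c = 0) (hρ : 0 ≤ ρ) (hℓ : 0 ≤ ℓ) (hγ : 0 ≤ γ) (hγℓ : γ * ℓ ≤ 1) (hγρ : γ * ρ ≤ 1)
    (hθ : (((1 - η) ^ 2)⁻¹ - 1) * ℓ ≤ ρ / 4)
    (hp : ∀ v, inner ℝ (P.scaled z₀ p) (P.scaled z₀ v) = w z v) :
    P.dikinNorm c (z - γ • p - c) ≤ (1 - 7 / 16 * (γ * ρ)) * P.dikinNorm c (z - c) := by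
  set e := z - c with he
  set D := P.dikinNorm c with hD
  have hD0 : ∀ u, 0 ≤ D u := fun u => dikinNorm_nonneg c u
  have hη0 : 0 ≤ η := (hD0 _).trans hz
  have hseg : ∀ t ∈ Set.Icc (0 : ℝ) 1, D (c + t • e - c) ≤ η := fun t ht => by
    rw [add_sub_cancel_left, hD, dikinNorm_smul, abs_of_nonneg ht.1]
    exact (mul_le_of_le_one_left (hD0 _) ht.2).trans hz
  have hline : ∀ t ∈ Set.Icc (0 : ℝ) 1, ∀ v,
      HasDerivAt (fun t : ℝ => w (c + t • e) v) (M (c + t • e) e v) t := by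
    intro t ht v
    have h1 : HasDerivAt (fun t : ℝ => c + t • e) e t := by
      simpa using ((hasDerivAt_id t).smul_const e).const_add c
    have h2 := HasFDerivAt.comp_hasDerivAt (f := fun t : ℝ => c + t • e) t (hM _ (hseg t ht)) h1
    simpa using h2.clm_apply (hasDerivAt_const t v)
  have hend : c + e = z := by simp [he]
  have hwp : |w z p| ≤ ℓ * D e * D p := by
    have := abs_sub_le_of_hasDerivAt (fun t ht => hline t ht p) (C := ℓ * D e * D p) ?_
    · simpa [hend, hw] using this
    · intro t ht
      have := abs_bilin_le_of_quadratic (P.scaled c) (M (c + t • e)) hℓ (hsymm _ (hseg t ht))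
        (fun u => ?_) e p
      · simpa only [hD, dikinNorm_eq] using this
      · obtain ⟨b1, b2⟩ := hbd _ (hseg t ht) u
        rw [← dikinNorm_eq, abs_of_nonneg ((mul_nonneg hρ (sq_nonneg _)).trans b1)]
        exact b2
  -- The ideal step with the metric at the anchor: integrating from `c`, where `w` vanishes, leaves
  -- the forms `⟨·,·⟩_c - γ M`, which lie between `0` and `(1 - γρ) ‖·‖_c²`.
  have hstep : ∀ v, |inner ℝ (P.scaled c e) (P.scaled c v) - γ * w z v| ≤
      (1 - γ * ρ) * D e * D v := by
    intro v
    have := abs_sub_le_of_hasDerivAt (φ := fun t : ℝ =>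
        t * inner ℝ (P.scaled c e) (P.scaled c v) - γ * w (c + t • e) v)
      (φ' := fun t : ℝ => inner ℝ (P.scaled c e) (P.scaled c v) - γ * M (c + t • e) e v)
      (C := (1 - γ * ρ) * D e * D v) ?_ ?_
    · simpa [hend, hw] using this
    · intro t ht
      have h1 := ((hasDerivAt_id t).mul_const (inner ℝ (P.scaled c e) (P.scaled c v))).sub
        ((hline t ht v).const_mul γ)
      exact h1.congr_deriv (by simp)
    · intro t ht
      have := abs_bilin_le_of_quadratic (P.scaled c) (P.barrierDeriv₂ c - γ • M (c + t • e))
        (k := 1 - γ * ρ) (by linarith) (fun u v => ?_) (fun u => ?_) e v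
      · simpa only [hD, dikinNorm_eq, sub_apply, smul_apply, smul_eq_mul, barrierDeriv₂_apply]
          using this
      · simp only [sub_apply, smul_apply, smul_eq_mul, barrierDeriv₂_apply,
          hsymm _ (hseg t ht) u v, real_inner_comm]
      · obtain ⟨b1, b2⟩ := hbd _ (hseg t ht) u
        simp only [sub_apply, smul_apply, smul_eq_mul, barrierDeriv₂_apply,
          real_inner_self_eq_norm_sq, ← dikinNorm_eq]
        have b3 := mul_le_mul_of_nonneg_left b1 hγ
        have b4 := mul_le_mul_of_nonneg_left b2 hγ
        have b5 := mul_le_mul_of_nonneg_right hγℓ (sq_nonneg (P.dikinNorm c u))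
        rw [abs_of_nonneg (by linarith)]
        linarith
  -- Testing the equation for `p` with `p` gives `‖p‖²_{z₀} = w z p ≤ ℓ D(e) D(p)`, and `(1 + η)² ≤
  -- 9/4` changes the metric back to the anchor.
  have hpD : D p ≤ 9 / 4 * (ℓ * D e) := by
    have h1 := dikinNorm_le_mul hc (by linarith) hz₀ p
    have h2 : D p ≤ 3 / 2 * P.dikinNorm z₀ p := h1.trans
      (mul_le_mul_of_nonneg_right (by linarith) (dikinNorm_nonneg _ _))
    have h3 : P.dikinNorm z₀ p ^ 2 = w z p := by
      rw [← hp p, real_inner_self_eq_norm_sq, dikinNorm_eq]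
    have h4 := pow_le_pow_left₀ (hD0 p) h2 2
    have h5 : D p ^ 2 ≤ 9 / 4 * (ℓ * D e) * D p := by
      rw [mul_pow, h3] at h4
      linarith [le_abs_self (w z p)]
    rcases (hD0 p).eq_or_lt with h | h
    · rw [← h]; exact mul_nonneg (by norm_num) (mul_nonneg hℓ (hD0 e))
    · refine le_of_mul_le_mul_right ?_ h
      linarith
  have hθ0 : 0 ≤ ((1 - η) ^ 2)⁻¹ - 1 := by
    rw [sub_nonneg]
    refine (one_le_inv₀ (by nlinarith)).2 (by nlinarith)
  have hdiff : ∀ v, |inner ℝ (P.scaled z₀ p) (P.scaled z₀ v) -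
      inner ℝ (P.scaled c p) (P.scaled c v)| ≤ 9 / 16 * ρ * D e * D v := by
    intro v
    refine (abs_inner_scaled_sub_le hc (mem_interiorY_of_dikinNorm hc (by linarith)) hθ0
      (abs_sq_slack_ratio_sub_one_le hc (by linarith) hz₀) p v).trans ?_
    have h1 := mul_le_mul_of_nonneg_left hpD hθ0
    have h2 := mul_le_mul_of_nonneg_right hθ (hD0 e)
    exact mul_le_mul_of_nonneg_right (by linarith) (hD0 v)
  have hfin : z - γ • p - c = e - γ • p := by rw [he]; abel
  rw [hfin]
  set v := e - γ • p with hv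
  have h1 : D v ^ 2 = inner ℝ (P.scaled c e) (P.scaled c v) -
      γ * inner ℝ (P.scaled c p) (P.scaled c v) := by
    rw [hD, dikinNorm_eq, ← real_inner_self_eq_norm_sq]
    conv_lhs => rw [hv, map_sub, map_smul, inner_sub_left, real_inner_smul_left, ← map_smul,
      ← map_sub, ← hv]
  have h2 := (abs_le.1 (hstep v)).2
  have h3 := mul_le_mul_of_nonneg_left (abs_le.1 (hdiff v)).2 hγ
  rw [hp v] at h3
  -- Freezing costs `θ · 9/4 · ℓ ≤ 9/16 · ρ`, and `1 - 9/16 = 7/16` of the ideal gain survives.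
  have h4 : D v ^ 2 ≤ (1 - 7 / 16 * (γ * ρ)) * D e * D v := by linarith
  rcases (hD0 v).eq_or_lt with h | h
  · rw [← h]; exact mul_nonneg (by linarith) (hD0 e)
  · refine le_of_mul_le_mul_right ?_ h
    linarith

/-- Each step shrinks the distance to the anchor, so the iterates stay in the region where the
curvature bounds hold, while the preconditioner remains that of the starting point. -/
theorem frozen_iterate_le (hP : P.IsPolytope) {c z₀ : Vec dy} {η γ ρ ℓ : ℝ}
    {w : Vec dy → Vec dy →L[ℝ] ℝ} {G : Vec dy → Vec dy}
    {M : Vec dy → Vec dy →L[ℝ] Vec dy →L[ℝ] ℝ} (hc : c ∈ P.interiorY) (hη : η < 1 / 2)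
    (hz₀ : P.dikinNorm c (z₀ - c) ≤ η)
    (hM : ∀ y, P.dikinNorm c (y - c) ≤ η → HasFDerivAt w (M y) y)
    (hsymm : ∀ y, P.dikinNorm c (y - c) ≤ η → ∀ u v, M y u v = M y v u)
    (hbd : ∀ y, P.dikinNorm c (y - c) ≤ η → ∀ u,
      ρ * P.dikinNorm c u ^ 2 ≤ M y u u ∧ M y u u ≤ ℓ * P.dikinNorm c u ^ 2)
    (hw : w c = 0) (hρ : 0 ≤ ρ) (hℓ : 0 ≤ ℓ) (hγ : 0 ≤ γ) (hγℓ : γ * ℓ ≤ 1) (hγρ : γ * ρ ≤ 1)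
    (hθ : (((1 - η) ^ 2)⁻¹ - 1) * ℓ ≤ ρ / 4)
    (hG : ∀ y, P.dikinNorm c (y - c) ≤ η → ∀ v, inner ℝ (G y) v = w y v) (t : ℕ) :
    P.dikinNorm c ((fun z => z - γ • (P.barrierHess z₀).inverse (G z))^[t] z₀ - c) ≤
      (1 - 7 / 16 * (γ * ρ)) ^ t * P.dikinNorm c (z₀ - c) := by
  have h0 : 0 ≤ γ * ρ := mul_nonneg hγ hρ
  have hq0 : 0 ≤ 1 - 7 / 16 * (γ * ρ) := by linarith
  have hq1 : 1 - 7 / 16 * (γ * ρ) ≤ 1 := by linarith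
  induction t with
  | zero => simp
  | succ t ih =>
    rw [Function.iterate_succ_apply', pow_succ']
    set z := (fun z => z - γ • (P.barrierHess z₀).inverse (G z))^[t] z₀
    have hz : P.dikinNorm c (z - c) ≤ η := ih.trans
      ((mul_le_of_le_one_left (dikinNorm_nonneg _ _) (pow_le_one₀ hq0 hq1)).trans hz₀)
    have hz₀i : z₀ ∈ P.interiorY := mem_interiorY_of_dikinNorm hc (by linarith)
    have := frozen_step_le (p := (P.barrierHess z₀).inverse (G z)) hc hη hz₀ hz hM hsymm hbd hw
      hρ hℓ hγ hγℓ hγρ hθ (fun v => by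
        rw [← inner_barrierHess, barrierHess_inverse_apply hP hz₀i, hG z hz])
    refine this.trans ?_
    rw [mul_assoc]
    exact mul_le_mul_of_nonneg_left ih hq0

/-- The second derivative of `h` in the lower variable as a bilinear map. -/
noncomputable def sliceHess (h : Vec dx → Vec dy → ℝ) (x : Vec dx) (y : Vec dy) :
    Vec dy →L[ℝ] Vec dy →L[ℝ] ℝ :=
  ((ContinuousLinearMap.compL ℝ (Vec dy) (Vec dx × Vec dy) ℝ).flip
      (ContinuousLinearMap.inr ℝ (Vec dx) (Vec dy))) ∘L
    jointHess h x y ∘L ContinuousLinearMap.inr ℝ (Vec dx) (Vec dy)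

theorem sliceHess_apply (h : Vec dx → Vec dy → ℝ) (x : Vec dx) (y u v : Vec dy) :
    sliceHess h x y u v = jointHess h x y (0, u) (0, v) := rfl

theorem hasFDerivAt_sliceDeriv {h : Vec dx → Vec dy → ℝ}
    (hh : ContDiffOn ℝ 2 (Function.uncurry h) P.region) (x : Vec dx) {y : Vec dy}
    (hy : y ∈ P.interiorY) :
    HasFDerivAt (fun y => jointDeriv h x y ∘L ContinuousLinearMap.inr ℝ (Vec dx) (Vec dy))
      (sliceHess h x y) y :=
  ((ContinuousLinearMap.compL ℝ (Vec dy) (Vec dx × Vec dy) ℝ).flip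
      (ContinuousLinearMap.inr ℝ (Vec dx) (Vec dy))).hasFDerivAt.comp y
    (hasFDerivAt_jointDeriv_right isOpen_region hh (mem_region hy))

variable {l ρ R lf0 lg0 μ η : ℝ} {C : DikinConstants}

theorem Problem.HasBounds.exactTracker_le (B : P.HasBounds l ρ R lf0 lg0) (hμ : 0 < μ)
    (hη : η < 1 / 2) (hη0 : 0 < η) (hC : P.IsDikinConstants μ η C) {γ : ℝ} (hγ : 0 ≤ γ)
    (hγℓ : γ * C.lψ1 ≤ 1) (hγρ : γ * C.ρψ ≤ 1) (hθ : (((1 - η) ^ 2)⁻¹ - 1) * C.lψ1 ≤ C.ρψ / 4)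
    (x : Vec dx) {z₀ : Vec dy}
    (hz₀ : P.dikinNorm (P.exactCenter μ x) (z₀ - P.exactCenter μ x) ≤ η) (t : ℕ) :
    P.dikinNorm (P.exactCenter μ x) (P.zInner μ γ x z₀ t - P.exactCenter μ x) ≤
      (1 - 7 / 16 * (γ * C.ρψ)) ^ t *
        P.dikinNorm (P.exactCenter μ x) (z₀ - P.exactCenter μ x) := by
  have hc := B.exactCenter_mem hμ x
  have hψ := contDiffOn_psi B.g_smooth μ
  have hmem : ∀ y, P.dikinNorm (P.exactCenter μ x) (y - P.exactCenter μ x) ≤ η →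
      y ∈ P.interiorY := fun y hy => mem_interiorY_of_dikinNorm hc (by linarith)
  refine frozen_iterate_le B.polytope (M := fun y => sliceHess (P.psi μ) x y)
    (w := fun y => jointDeriv (P.psi μ) x y ∘L ContinuousLinearMap.inr ℝ (Vec dx) (Vec dy))
    (G := gradY (P.psi μ) x) hc hη hz₀
    (fun y hy => hasFDerivAt_sliceDeriv hψ x (hmem y hy))
    (fun y hy u v => jointHess_symm isOpen_region hψ (mem_region (hmem y hy)) _ _)
    (fun y hy u => ?_) ?_ hC.ρψ_pos.le hC.lψ1_pos.le hγ hγℓ hγρ hθ (fun y hy v => ?_) t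
  · have := (hC.exact_bounds x).curvature y ⟨hmem y hy, hy.trans (by linarith)⟩ u
    rwa [hessYY_eq isOpen_region hψ (mem_region (hmem y hy))] at this
  · ext v
    exact B.exactCenter_stationary hμ x v
  · rw [inner_gradY isOpen_region hψ (mem_region (hmem y hy))]
    rfl

/-- The threshold on `λ` gives `ℓ_{f,1} ≤ λ ρ_ψ / 2`. Thus `f` takes away at most half of the
curvature of `λ ψ_μ`, which leaves the pair `(λ ρ_ψ / 2, λ ℓ_{ψ,1} + ℓ_{f,1})`. -/
theorem Problem.HasBounds.proxyTracker_le (B : P.HasBounds l ρ R lf0 lg0) (hμ : 0 < μ)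
    (hη : η < 1 / 2) (hη0 : 0 < η) (hC : P.IsDikinConstants μ η C) {lam α : ℝ}
    (hlam : C.lamη ≤ lam) (hcurv : 2 * C.lf1 / C.ρψ ≤ lam) (hα : 0 ≤ α)
    (hαℓ : α * (lam * C.lψ1 + C.lf1) ≤ 1) (hαρ : α * (lam * C.ρψ / 2) ≤ 1)
    (hθ : (((1 - η) ^ 2)⁻¹ - 1) * (lam * C.lψ1 + C.lf1) ≤ lam * C.ρψ / 2 / 4)
    (x : Vec dx) {y₀ : Vec dy}
    (hy₀ : P.dikinNorm (P.proxyCenter lam μ x) (y₀ - P.proxyCenter lam μ x) ≤ η) (t : ℕ) :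
    P.dikinNorm (P.proxyCenter lam μ x) (P.yInner μ α lam x y₀ t - P.proxyCenter lam μ x) ≤
      (1 - 7 / 16 * (α * (lam * C.ρψ / 2))) ^ t *
        P.dikinNorm (P.proxyCenter lam μ x) (y₀ - P.proxyCenter lam μ x) := by
  have hlam0 : 0 < lam := hC.lamη_pos.trans_le hlam
  have hc := B.proxyCenter_mem hμ hlam0 x
  have hψ := contDiffOn_psi B.g_smooth μ
  have hρ := hC.ρψ_pos
  have hℓ := hC.lψ1_pos
  have hf1 := hC.lf1_nonneg
  have hmem : ∀ y, P.dikinNorm (P.proxyCenter lam μ x) (y - P.proxyCenter lam μ x) ≤ η →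
      y ∈ P.interiorY := fun y hy => mem_interiorY_of_dikinNorm hc (by linarith)
  have hcurv' : C.lf1 ≤ lam * C.ρψ / 2 := by
    rw [div_le_iff₀ hρ] at hcurv; linarith
  refine frozen_iterate_le B.polytope
    (M := fun y => sliceHess P.f x y + lam • sliceHess (P.psi μ) x y)
    (w := fun y => jointDeriv P.f x y ∘L ContinuousLinearMap.inr ℝ (Vec dx) (Vec dy) +
      lam • (jointDeriv (P.psi μ) x y ∘L ContinuousLinearMap.inr ℝ (Vec dx) (Vec dy)))
    (G := gradY (P.L lam μ) x) hc hη hy₀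
    (fun y hy => (hasFDerivAt_sliceDeriv B.f_smooth x (hmem y hy)).add
      ((hasFDerivAt_sliceDeriv hψ x (hmem y hy)).const_smul lam))
    (fun y hy u v => ?_) (fun y hy u => ?_) ?_ (by positivity) (by positivity) hα hαℓ hαρ hθ
    (fun y hy v => ?_) t
  · simp only [add_apply, smul_apply, sliceHess_apply]
    rw [jointHess_symm isOpen_region hψ (mem_region (hmem y hy)),
      jointHess_symm isOpen_region B.f_smooth (mem_region (hmem y hy))]
  · have hy2 : y ∈ P.tube (2 * η) (P.proxyCenter lam μ x) := ⟨hmem y hy, hy.trans (by linarith)⟩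
    have h1 := (hC.proxy_bounds lam hlam x).curvature y hy2 u
    have h2 := abs_le.1 ((hC.proxy_bounds lam hlam x).f_hess y hy2 u u)
    rw [hessYY_eq isOpen_region hψ (mem_region (hmem y hy))] at h1
    rw [hessYY_eq isOpen_region B.f_smooth (mem_region (hmem y hy)), mul_assoc, ← sq] at h2
    simp only [add_apply, smul_apply, sliceHess_apply, smul_eq_mul]
    have h3 := mul_le_mul_of_nonneg_left h1.1 hlam0.le
    have h4 := mul_le_mul_of_nonneg_left h1.2 hlam0.le
    have h5 := mul_le_mul_of_nonneg_right hcurv'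
      (sq_nonneg (P.dikinNorm (P.proxyCenter lam μ x) u))
    constructor <;> linarith
  · ext v
    exact B.proxyCenter_stationary hμ hlam0 x v
  · rw [inner_gradY_L B.f_smooth B.g_smooth lam μ (hmem y hy)]
    rfl

end Contraction

end BarrierBilevel

namespace BarrierBilevel

/-! ### Forward invariance of the tubes and recursion for the tracking errors -/

section Tracking

/-- The consequences of a valid polynomial schedule that the tracking analysis uses; `τ = T ρ_ψ β`
is the contraction budget of one inner loop. -/
structure Schedule.IsTracking (S : Schedule) (cξ lf0 lg0 η : ℝ) (C : DikinConstants)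
    (lam₀ β τ : ℝ) : Prop where
  T_pos : 1 ≤ S.T
  ξ_pos : 0 < S.ξ
  α_pos : ∀ k, 0 < S.α k
  lamη_le : C.lamη ≤ lam₀
  lam_ge : ∀ k, lam₀ ≤ S.lam k
  β_pos : 0 < β
  β_eq : ∀ k, S.α k * S.lam k = β
  β_le : ∀ k, β ≤ S.γ k
  τ_eq : τ = S.T * C.ρψ * β
  τ_le : τ ≤ 1 / 4
  γ_curv : ∀ k, S.γ k * C.lψ1 ≤ 1 / 4
  γ_contr : ∀ k, S.γ k * C.ρψ ≤ 1 / 4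
  frozen_exact : (((1 - η) ^ 2)⁻¹ - 1) * C.lψ1 ≤ C.ρψ / 4
  frozen_proxy : ∀ k, (((1 - η) ^ 2)⁻¹ - 1) * (S.lam k * C.lψ1 + C.lf1) ≤ S.lam k * C.ρψ / 2 / 4
  curvature : 2 * C.lf1 / C.ρψ ≤ lam₀
  transfer : 2 * C.lf0 / C.ρψ ≤ η / 4 * lam₀
  α_le : ∀ k, S.α k * (2 * S.ξ * C.LF) ≤ 1
  lam_mono : ∀ k, S.lam k ≤ S.lam (k + 1)
  lam_succ_le : ∀ k, S.lam (k + 1) ≤ (1 + τ / 16) * S.lam k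
  exact_drift : C.ls0 * (S.ξ * β * (lf0 / lam₀ + 2 * lg0)) ≤ τ * η / 16
  proxy_drift : C.ll0 * (S.ξ * β * (lf0 / lam₀ + 2 * lg0)) ≤ τ * η / 64
  anchor : S.ξ * C.lψ1 * C.ls0 ≤ cξ * (S.T * C.ρψ)

theorem ValidPolySchedule.isTracking {cξ lf0 lg0 η ξ α₀ γ₀ lam₀ k₀ : ℝ} {T : ℕ}
    {C : DikinConstants} (hV : ValidPolySchedule cξ lf0 lg0 η C T ξ α₀ γ₀ lam₀ k₀) (hT : 1 ≤ T)
    (hη0 : 0 < η) (hη : η < 1 / 2) (hρ : 0 < C.ρψ) (hℓ : 0 < C.lψ1) (hf1 : 0 ≤ C.lf1)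
    (hls0 : 1 ≤ C.ls0) :
    (polySchedule T ξ α₀ γ₀ lam₀ k₀).IsTracking cξ lf0 lg0 η C lam₀
      (α₀ * lam₀ / k₀ ^ (1 / 3 : ℝ)) (T * C.ρψ * (α₀ * lam₀ / k₀ ^ (1 / 3 : ℝ))) := by
  have hk := hV.k₀_pos
  have hα := hV.α₀_pos
  have hlam := hV.lam₀_pos
  have hξ := hV.ξ_pos
  have hT0 : (0 : ℝ) < T := by exact_mod_cast hT
  have hT1 : (1 : ℝ) ≤ T := by exact_mod_cast hT
  have hk3 : 0 < k₀ ^ (1 / 3 : ℝ) := Real.rpow_pos_of_pos hk _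
  have hA := hV.barrierAware
  set S := polySchedule T ξ α₀ γ₀ lam₀ k₀ with hS
  set β := α₀ * lam₀ / k₀ ^ (1 / 3 : ℝ) with hβ
  have hβ0 : 0 < β := by positivity
  have hβk : ∀ k, S.β k = β := fun k => polySchedule_β hk k
  have hST : (S.T : ℝ) = T := rfl
  have hSξ : S.ξ = ξ := rfl
  have hlam0 : S.lam 0 = lam₀ := polySchedule_lam_zero hk
  have hmono : Monotone S.lam := polySchedule_lam_mono hk hlam
  have hlampos : ∀ k, 0 < S.lam k := fun k => polySchedule_lam_pos hk hlam k
  have hge : ∀ k, lam₀ ≤ S.lam k := fun k => hlam0 ▸ hmono (Nat.zero_le k)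
  have hγ1 : ∀ k, S.γ k * (4 * C.lψ1) ≤ 1 := fun k =>
    (le_div_iff₀ (by positivity)).1 ((hA.γ_le k).trans (min_le_left _ _))
  have hγ2 : ∀ k, S.γ k * (4 * T * C.ρψ) ≤ 1 := fun k =>
    (le_div_iff₀ (by positivity)).1 ((hA.γ_le k).trans (min_le_right _ _))
  have hβγ : ∀ k, β ≤ S.γ k := fun k => hβk k ▸ hA.β_le_γ k
  have hθ0 : 0 ≤ ((1 - η) ^ 2)⁻¹ - 1 := by
    rw [sub_nonneg]
    refine (one_le_inv₀ (by nlinarith)).2 (by nlinarith)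
  have hd1 := hA.exact_drift
  have hd2 := hA.proxy_drift
  have hd3 := hA.anchor_switch
  rw [hlam0, hSξ, hST, div_mul_eq_mul_div, div_le_iff₀ hT0] at hd1 hd2
  rw [hSξ, hST, div_mul_eq_mul_div, div_le_iff₀ hT0] at hd3
  exact
    { T_pos := hT
      ξ_pos := hξ
      α_pos := fun k => by rw [hS]; simp only [polySchedule]; positivity
      lamη_le := hV.admissible
      lam_ge := hge
      β_pos := hβ0
      β_eq := hβk
      β_le := hβγ
      τ_eq := rfl
      τ_le := by
        have := mul_le_mul_of_nonneg_right (hβγ 0) (by positivity : 0 ≤ 4 * T * C.ρψ)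
        linarith [hγ2 0]
      γ_curv := fun k => by linarith [hγ1 k]
      γ_contr := fun k => by
        have h0 : 0 ≤ S.γ k := hβ0.le.trans (hβγ k)
        have := mul_le_mul_of_nonneg_left hT1 (by positivity : 0 ≤ 4 * (S.γ k * C.ρψ))
        linarith [hγ2 k]
      frozen_exact := hV.frozen.1
      -- The condition at `λ₀` propagates to all larger multipliers because `ℓ_{f,1} / λ` decreases
      -- in `λ`.
      frozen_proxy := fun k => by
        have h1 := hV.frozen.2
        have h2 := mul_le_mul_of_nonneg_left h1 (hlampos k).le
        have h3 : lam₀ * (S.lam k * C.lψ1 + C.lf1) ≤ S.lam k * (lam₀ * C.lψ1 + C.lf1) := by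
          have := mul_le_mul_of_nonneg_right (hge k) hf1
          linarith
        have h4 := mul_le_mul_of_nonneg_left h3 hθ0
        refine le_of_mul_le_mul_left ?_ hlam
        linarith
      curvature := hlam0 ▸ hA.lam_zero_curvature
      transfer := by
        have h1 := hA.lam_zero_transfer
        rw [hlam0, div_le_iff₀ (by positivity)] at h1
        rw [div_le_iff₀ hρ]
        linarith
      α_le := hA.α_le
      lam_mono := fun k => hmono (Nat.le_succ k)
      lam_succ_le := fun k => by
        have h1 := hA.δ_le k
        rw [div_le_iff₀ (hlampos k), hβk, Schedule.δ, hST] at h1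
        linarith
      exact_drift := by
        have := mul_le_mul_of_nonneg_left hd1 hβ0.le
        rw [hSξ]
        linarith
      proxy_drift := by
        have := mul_le_mul_of_nonneg_left hd2 hβ0.le
        rw [hSξ]
        linarith
      anchor := by
        rw [hSξ, hST]
        have h1 : ξ * (C.lψ1 * C.ls0 ^ 2) ≤
            ξ * max (C.lψ1 * C.ls0 ^ 2) (C.ls1 * Real.sqrt (max (lg0 ^ 2) (lf0 ^ 2))) :=
          mul_le_mul_of_nonneg_left (le_max_left _ _) hξ.le
        have h2 : C.ls0 ≤ C.ls0 ^ 2 := by nlinarith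
        have h3 := mul_le_mul_of_nonneg_left h2 (by positivity : 0 ≤ ξ * C.lψ1)
        linarith }

/-- `T` contractions by `1 - a` contract at least by `1 - τ/5`. -/
theorem one_sub_pow_le {a τ : ℝ} {T : ℕ} (ha0 : 0 ≤ a) (ha1 : a ≤ 1) (hτ : τ ≤ 1 / 4)
    (h : 7 / 32 * τ = T * a) : (1 - a) ^ T ≤ 1 - τ / 5 := by
  -- Bernoulli is applied to `1 + a` and transferred by `(1 - a)(1 + a) ≤ 1`; for `τ ≤ 1/4`, `1 / (1
  -- + 7τ/32) ≤ 1 - τ/5`.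
  have h1 : 1 + T * a ≤ (1 + a) ^ T := one_add_mul_le_pow (by linarith) T
  have h2 : 0 ≤ (1 - a) ^ T := pow_nonneg (by linarith) T
  have h3 : (1 - a) ^ T * (1 + a) ^ T ≤ 1 := by
    rw [← mul_pow]
    exact pow_le_one₀ (by nlinarith) (by nlinarith)
  have h4 : (1 - a) ^ T * (1 + 7 / 32 * τ) ≤ 1 := by
    rw [h]; exact (mul_le_mul_of_nonneg_left h1 h2).trans h3
  have hτ0 : 0 ≤ τ := by
    have : 0 ≤ (T : ℝ) * a := by positivity
    linarith
  nlinarith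

/-- The effect of moving the anchor by `d` after an inner loop. -/
theorem anchor_move {τ η V W V' d : ℝ} (hτ0 : 0 < τ) (hτ : τ ≤ 1 / 4) (hη0 : 0 < η)
    (hη : η < 1 / 2) (hV0 : 0 ≤ V) (hV : V ≤ η) (hW : W ≤ (1 - τ / 5) * V) (hd0 : 0 ≤ d)
    (hd : d ≤ τ * η / 16) (hV'0 : 0 ≤ V') (hV' : V' ≤ (W + d) / (1 - d)) :
    V' ≤ η ∧ V' ^ 2 ≤ (1 - τ / 6) * V ^ 2 + 7 / τ * d ^ 2 := by
  have hτη : τ * η ≤ τ / 2 := by nlinarith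
  have hd1 : d ≤ τ / 32 := by linarith
  have hd2 : d ≤ 1 / 128 := by linarith
  rw [le_div_iff₀ (by linarith)] at hV'
  constructor
  · have h1 : (1 - τ / 5) * V ≤ (1 - τ / 5) * η := mul_le_mul_of_nonneg_left hV (by linarith)
    have h2 : d * η ≤ τ * η / 16 * (1 / 2) := by
      have := mul_le_mul hd hη.le hη0.le (by positivity)
      linarith
    refine le_of_mul_le_mul_right (a := 1 - d) ?_ (by linarith)
    have : 0 ≤ τ * η := by positivity
    linarith
  · have h1 : V' ≤ (1 - τ / 6) * V + 128 / 127 * d := by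
      refine le_of_mul_le_mul_right (a := 1 - d) ?_ (by linarith)
      refine hV'.trans ?_
      -- The gap between `τ/5` and `τ/6` pays for the division by `1 - d`, since `d ≤ τ/32`.
      have h2 : (1 - τ / 5) * V ≤ (1 - τ / 6) * (1 - d) * V := by
        refine mul_le_mul_of_nonneg_right ?_ hV0
        nlinarith
      nlinarith
    set e := 128 / 127 * d with he
    -- Convexity of the square with weights `1 - τ/6` and `τ/6`, applied to `V` and `6e/τ`.
    have h3 : ((1 - τ / 6) * V + e) ^ 2 ≤ (1 - τ / 6) * V ^ 2 + 6 / τ * e ^ 2 := by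
      have h4 : (1 - τ / 6) * V ^ 2 + 6 / τ * e ^ 2 - ((1 - τ / 6) * V + e) ^ 2 =
          (1 - τ / 6) * (τ / 6) * (V - 6 / τ * e) ^ 2 := by
        field_simp; ring
      have h5 : 0 ≤ (1 - τ / 6) * (τ / 6) * (V - 6 / τ * e) ^ 2 :=
        mul_nonneg (mul_nonneg (by linarith) (by linarith)) (sq_nonneg _)
      linarith
    have h6 := pow_le_pow_left₀ hV'0 h1 2
    have h7 : 6 / τ * e ^ 2 ≤ 7 / τ * d ^ 2 := by
      rw [he, div_mul_eq_mul_div 6, div_mul_eq_mul_div 7]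
      refine div_le_div_of_nonneg_right ?_ hτ0.le
      nlinarith [sq_nonneg d]
    linarith

theorem norm_le_of_forall_inner_le {n : ℕ} {q : Vec n} {K : ℝ} (hK : 0 ≤ K)
    (h : ∀ u, inner ℝ q u ≤ K * ‖u‖) : ‖q‖ ≤ K := by
  have h1 := h q
  rw [real_inner_self_eq_norm_sq] at h1
  rcases (norm_nonneg q).eq_or_lt with h0 | h0
  · rw [← h0]; exact hK
  · refine le_of_mul_le_mul_right ?_ h0
    linarith

variable {dx dy m : ℕ} {P : Problem dx dy m} {l ρ R lf0 lg0 μ η cξ lam₀ β τ : ℝ}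
  {C : DikinConstants} {S : Schedule}

theorem Problem.HasBounds.inner_direction (B : P.HasBounds l ρ R lf0 lg0) (μ lam : ℝ)
    (x : Vec dx) {y z : Vec dy} (hy : y ∈ P.interiorY) (hz : z ∈ P.interiorY) (u : Vec dx) :
    inner ℝ (P.direction μ lam x y z) u = jointDeriv P.f x y (u, 0) +
      lam * (jointDeriv (P.psi μ) x y (u, 0) - jointDeriv (P.psi μ) x z (u, 0)) := by
  have hψ := contDiffOn_psi B.g_smooth μ
  rw [Problem.direction, inner_add_left, real_inner_smul_left, inner_sub_left,
    inner_gradX isOpen_region B.f_smooth (mem_region hy),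
    inner_gradX isOpen_region hψ (mem_region hy), inner_gradX isOpen_region hψ (mem_region hz)]

/-- The barrier is independent of `x`, so only `f` and `g` contribute. The growth in `λ` is
harmless: the step carries the factor `α`, and `αλ = β` is constant. -/
theorem Problem.HasBounds.norm_direction_le (B : P.HasBounds l ρ R lf0 lg0) (hlf0 : 0 ≤ lf0)
    (hlg0 : 0 ≤ lg0) {lam : ℝ} (hlam : 0 ≤ lam) (x : Vec dx) {y z : Vec dy}
    (hy : y ∈ P.interiorY) (hz : z ∈ P.interiorY) :
    ‖P.direction μ lam x y z‖ ≤ lf0 + 2 * lam * lg0 := by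
  refine norm_le_of_forall_inner_le (by positivity) fun u => ?_
  rw [B.inner_direction μ lam x hy hz, jointDeriv_psi_apply B.g_smooth μ hy,
    jointDeriv_psi_apply B.g_smooth μ hz, map_zero, map_zero, mul_zero, add_zero, add_zero]
  have h1 := (abs_le.1 (B.f_derivX_le x y hy u)).2
  have h2 := (abs_le.1 (B.g_derivX_le x y hy u)).2
  have h3 := (abs_le.1 (B.g_derivX_le x z hz u)).1
  have h4 := mul_le_mul_of_nonneg_left (sub_le_sub h2 h3) hlam
  linarith

/-- Distance of the exact tracker to its center at the start of an outer iteration. -/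
noncomputable def Problem.exactError (P : Problem dx dy m) (μ : ℝ) (s : State dx dy) : ℝ :=
  P.dikinNorm (P.exactCenter μ s.x) (s.z - P.exactCenter μ s.x)

/-- Distance of the proxy tracker to its center at the start of an outer iteration. -/
noncomputable def Problem.proxyError (P : Problem dx dy m) (μ lam : ℝ) (s : State dx dy) : ℝ :=
  P.dikinNorm (P.proxyCenter lam μ s.x) (s.y - P.proxyCenter lam μ s.x)

theorem Schedule.IsTracking.lam₀_pos (hS : S.IsTracking cξ lf0 lg0 η C lam₀ β τ)
    (hC : P.IsDikinConstants μ η C) : 0 < lam₀ := hC.lamη_pos.trans_le hS.lamη_le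

theorem Schedule.IsTracking.lam_pos (hS : S.IsTracking cξ lf0 lg0 η C lam₀ β τ)
    (hC : P.IsDikinConstants μ η C) (k : ℕ) : 0 < S.lam k :=
  (hC.lamη_pos.trans_le hS.lamη_le).trans_le (hS.lam_ge k)

theorem Schedule.IsTracking.τ_pos (hS : S.IsTracking cξ lf0 lg0 η C lam₀ β τ)
    (hC : P.IsDikinConstants μ η C) : 0 < τ := by
  have h1 : (0 : ℝ) < S.T := by exact_mod_cast hS.T_pos
  have := hC.ρψ_pos
  have := hS.β_pos
  rw [hS.τ_eq]
  positivity

theorem Schedule.IsTracking.rate_mem (hS : S.IsTracking cξ lf0 lg0 η C lam₀ β τ)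
    (hC : P.IsDikinConstants μ η C) : 0 ≤ 1 - 7 / 32 * (β * C.ρψ) ∧ 1 - 7 / 32 * (β * C.ρψ) ≤ 1 := by
  have e2 := mul_le_mul_of_nonneg_right (hS.β_le 0) hC.ρψ_pos.le
  have e4 := hS.γ_contr 0
  have := mul_nonneg hS.β_pos.le hC.ρψ_pos.le
  constructor <;> linarith

theorem Schedule.IsTracking.rate_pow_le (hS : S.IsTracking cξ lf0 lg0 η C lam₀ β τ)
    (hC : P.IsDikinConstants μ η C) : (1 - 7 / 32 * (β * C.ρψ)) ^ S.T ≤ 1 - τ / 5 := by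
  have h := hS.rate_mem hC
  refine one_sub_pow_le (by linarith [h.2]) (by linarith [h.1]) hS.τ_le ?_
  rw [hS.τ_eq]
  ring

section Step

variable (B : P.HasBounds l ρ R lf0 lg0) (hμ : 0 < μ) (hlf0 : 0 ≤ lf0) (hlg0 : 0 ≤ lg0)
  (hη0 : 0 < η) (hη : η < 1 / 2) (hC : P.IsDikinConstants μ η C)
  (hS : S.IsTracking cξ lf0 lg0 η C lam₀ β τ)
include B hμ hη0 hη hC hS

/-- The rate is weakened to `7/32 · β ρ_ψ` so that both trackers share it: for the proxy tracker
half of the curvature is lost to `f` and `αλ = β`, while the exact tracker has `γ ≥ β`. -/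
theorem exact_inner_le (k : ℕ) (x : Vec dx) {z₀ : Vec dy}
    (hz₀ : P.dikinNorm (P.exactCenter μ x) (z₀ - P.exactCenter μ x) ≤ η) (t : ℕ) :
    P.dikinNorm (P.exactCenter μ x) (P.zInner μ (S.γ k) x z₀ t - P.exactCenter μ x) ≤
      (1 - 7 / 32 * (β * C.ρψ)) ^ t *
        P.dikinNorm (P.exactCenter μ x) (z₀ - P.exactCenter μ x) := by
  have hγ0 := hS.β_pos.le.trans (hS.β_le k)
  have h1 := B.exactTracker_le hμ hη hη0 hC hγ0 ((hS.γ_curv k).trans (by norm_num))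
    ((hS.γ_contr k).trans (by norm_num)) hS.frozen_exact x hz₀ t
  refine h1.trans (mul_le_mul_of_nonneg_right (pow_le_pow_left₀ ?_ ?_ t) (dikinNorm_nonneg _ _))
  · linarith [hS.γ_contr k]
  · have := mul_le_mul_of_nonneg_right (hS.β_le k) hC.ρψ_pos.le
    have := mul_nonneg hγ0 hC.ρψ_pos.le
    linarith

theorem proxy_inner_le (k : ℕ) (x : Vec dx) {y₀ : Vec dy}
    (hy₀ : P.dikinNorm (P.proxyCenter (S.lam k) μ x) (y₀ - P.proxyCenter (S.lam k) μ x) ≤ η)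
    (t : ℕ) :
    P.dikinNorm (P.proxyCenter (S.lam k) μ x)
        (P.yInner μ (S.α k) (S.lam k) x y₀ t - P.proxyCenter (S.lam k) μ x) ≤
      (1 - 7 / 32 * (β * C.ρψ)) ^ t *
        P.dikinNorm (P.proxyCenter (S.lam k) μ x) (y₀ - P.proxyCenter (S.lam k) μ x) := by
  have hρ := hC.ρψ_pos
  have hβeq := hS.β_eq k
  have hα := hS.α_pos k
  have hβγ := hS.β_le k
  have e1 := mul_le_mul_of_nonneg_right hβγ hC.lψ1_pos.le
  have e2 := mul_le_mul_of_nonneg_right hβγ hρ.le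
  have e3 := hS.γ_curv k
  have e4 := hS.γ_contr k
  have hcurv : 2 * C.lf1 / C.ρψ ≤ S.lam k := hS.curvature.trans (hS.lam_ge k)
  have hf : S.α k * C.lf1 ≤ β * C.ρψ / 2 := by
    rw [div_le_iff₀ hρ] at hcurv
    have := mul_le_mul_of_nonneg_left hcurv hα.le
    rw [← hβeq]
    linarith
  have h1 := B.proxyTracker_le hμ hη hη0 hC (hS.lamη_le.trans (hS.lam_ge k)) hcurv hα.le
    (by
      have : S.α k * (S.lam k * C.lψ1 + C.lf1) = S.α k * S.lam k * C.lψ1 + S.α k * C.lf1 := by ring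
      rw [this, hβeq]; linarith)
    (by
      have : S.α k * (S.lam k * C.ρψ / 2) = S.α k * S.lam k * C.ρψ / 2 := by ring
      rw [this, hβeq]; linarith) (hS.frozen_proxy k) x hy₀ t
  have e : 7 / 16 * (S.α k * (S.lam k * C.ρψ / 2)) = 7 / 32 * (β * C.ρψ) := by
    rw [← hβeq]; ring
  rwa [e] at h1

include hlf0 hlg0

/-- One outer iteration: both trackers stay in their tubes during the inner loop and at the next
anchors, and the squared errors contract up to the squared displacement of the anchors. -/
theorem outerStep_tracking (k : ℕ) (s : State dx dy) (hz : P.exactError μ s ≤ η)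
    (hy : P.proxyError μ (S.lam k) s ≤ η) :
    P.exactError μ (P.outerStep μ S k s) ≤ η ∧
    P.proxyError μ (S.lam (k + 1)) (P.outerStep μ S k s) ≤ η ∧
    P.exactError μ (P.outerStep μ S k s) ^ 2 ≤ (1 - τ / 6) * P.exactError μ s ^ 2 +
      7 / τ * (C.ls0 * ‖(P.outerStep μ S k s).x - s.x‖) ^ 2 ∧
    P.proxyError μ (S.lam (k + 1)) (P.outerStep μ S k s) ^ 2 ≤
      (1 - τ / 6) * P.proxyError μ (S.lam k) s ^ 2 +
      7 / τ * (2 * C.lf0 / C.ρψ * (1 / S.lam k - 1 / S.lam (k + 1)) +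
        C.ls0 * ‖(P.outerStep μ S k s).x - s.x‖) ^ 2 ∧
    P.dikinNorm (P.exactCenter μ s.x) ((P.outerStep μ S k s).z - P.exactCenter μ s.x) ≤
      P.exactError μ s ∧
    P.dikinNorm (P.proxyCenter (S.lam k) μ s.x)
      ((P.outerStep μ S k s).y - P.proxyCenter (S.lam k) μ s.x) ≤ P.proxyError μ (S.lam k) s := by
  have hlam0 := hS.lam₀_pos hC
  have hlamk := hS.lam_pos hC
  have hτ0 := hS.τ_pos hC
  have hτ := hS.τ_le
  have hrate := hS.rate_pow_le hC
  set s' := P.outerStep μ S k s with hs'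
  have hWz : P.dikinNorm (P.exactCenter μ s.x) (s'.z - P.exactCenter μ s.x) ≤
      (1 - τ / 5) * P.exactError μ s :=
    (exact_inner_le B hμ hη0 hη hC hS k s.x hz S.T).trans
      (mul_le_mul_of_nonneg_right hrate (dikinNorm_nonneg _ _))
  have hWy : P.dikinNorm (P.proxyCenter (S.lam k) μ s.x)
      (s'.y - P.proxyCenter (S.lam k) μ s.x) ≤ (1 - τ / 5) * P.proxyError μ (S.lam k) s :=
    (proxy_inner_le B hμ hη0 hη hC hS k s.x hy S.T).trans
      (mul_le_mul_of_nonneg_right hrate (dikinNorm_nonneg _ _))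
  have hVz0 : 0 ≤ P.exactError μ s := dikinNorm_nonneg _ _
  have hVy0 : 0 ≤ P.proxyError μ (S.lam k) s := dikinNorm_nonneg _ _
  have hWz' := hWz.trans (mul_le_of_le_one_left hVz0 (by linarith : 1 - τ / 5 ≤ 1))
  have hWy' := hWy.trans (mul_le_of_le_one_left hVy0 (by linarith : 1 - τ / 5 ≤ 1))
  have hcz := B.exactCenter_mem hμ s.x
  have hcy := B.proxyCenter_mem hμ (hlamk k) s.x
  have hzi : s'.z ∈ P.interiorY := mem_interiorY_of_dikinNorm hcz (by linarith)
  have hyi : s'.y ∈ P.interiorY := mem_interiorY_of_dikinNorm hcy (by linarith)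
  have hxdiff : s'.x - s.x = -((S.ξ * S.α k) • P.direction μ (S.lam k) s.x s'.y s'.z) := by
    have : s'.x = s.x - (S.ξ * S.α k) • P.direction μ (S.lam k) s.x s'.y s'.z := rfl
    rw [this]; abel
  have hα := hS.α_pos k
  have hξ := hS.ξ_pos
  have hΔ : ‖s'.x - s.x‖ ≤ S.ξ * β * (lf0 / lam₀ + 2 * lg0) := by
    rw [hxdiff, norm_neg, norm_smul, Real.norm_of_nonneg (by positivity)]
    have h1 := B.norm_direction_le (μ := μ) hlf0 hlg0 (hlamk k).le s.x hyi hzi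
    have h2 : lf0 + 2 * S.lam k * lg0 ≤ S.lam k * (lf0 / lam₀ + 2 * lg0) := by
      have h3 : lf0 ≤ S.lam k * (lf0 / lam₀) := by
        rw [mul_div_assoc', le_div_iff₀ hlam0, mul_comm]
        exact mul_le_mul_of_nonneg_right (hS.lam_ge k) hlf0
      linarith
    calc S.ξ * S.α k * ‖P.direction μ (S.lam k) s.x s'.y s'.z‖
        ≤ S.ξ * S.α k * (S.lam k * (lf0 / lam₀ + 2 * lg0)) := by
          gcongr; exact h1.trans h2
      _ = S.ξ * (S.α k * S.lam k) * (lf0 / lam₀ + 2 * lg0) := by ring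
      _ = _ := by rw [hS.β_eq]
  have hls0 : 0 ≤ C.ls0 := by linarith [hC.one_le_ls0]
  have hΔ0 := norm_nonneg (s'.x - s.x)
  have hdz : C.ls0 * ‖s'.x - s.x‖ ≤ τ * η / 16 :=
    (mul_le_mul_of_nonneg_left hΔ hls0).trans hS.exact_drift
  have hdy' : C.ll0 * ‖s'.x - s.x‖ ≤ τ * η / 64 :=
    (mul_le_mul_of_nonneg_left hΔ hC.ll0_nonneg).trans hS.proxy_drift
  have hlamle := hS.lam_mono k
  have hinv0 : 0 ≤ 1 / S.lam k - 1 / S.lam (k + 1) :=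
    sub_nonneg.2 (one_div_le_one_div_of_le (hlamk k) hlamle)
  have hκ0 : 0 ≤ 2 * C.lf0 / C.ρψ := by
    have := hC.lf0_nonneg; have := hC.ρψ_pos; positivity
  -- The proxy drift caused by the multiplier: the relative increment is at most `τ/16`, and the
  -- transfer condition bounds the coefficient by `η λ₀ / 4`.
  have hD : 2 * C.lf0 / C.ρψ * (1 / S.lam k - 1 / S.lam (k + 1)) ≤ τ * η / 64 := by
    have h1 : 1 / S.lam k - 1 / S.lam (k + 1) ≤ τ / 16 / lam₀ := by
      have h2 : 1 / S.lam k - 1 / S.lam (k + 1) =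
          (S.lam (k + 1) - S.lam k) / S.lam (k + 1) / S.lam k := by
        have := (hlamk k).ne'; have := (hlamk (k + 1)).ne'
        field_simp
      rw [h2]
      have h3 : (S.lam (k + 1) - S.lam k) / S.lam (k + 1) ≤ τ / 16 := by
        rw [div_le_iff₀ (hlamk (k + 1))]
        have := hS.lam_succ_le k
        have := mul_le_mul_of_nonneg_left hlamle hτ0.le
        linarith
      exact div_le_div₀ (by positivity) h3 hlam0 (hS.lam_ge k)
    calc _ ≤ η / 4 * lam₀ * (τ / 16 / lam₀) := mul_le_mul hS.transfer h1 hinv0 (by positivity)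
      _ = τ * η / 64 := by field_simp; norm_num
  have hex := hC.exact_stability s.x s'.x
  have hpr := hC.proxy_stability (S.lam k) (S.lam (k + 1)) (hS.lamη_le.trans (hS.lam_ge k))
    (hS.lamη_le.trans (hS.lam_ge (k + 1))) s.x s'.x
  rw [abs_sub_comm, abs_of_nonneg hinv0] at hpr
  -- The triangle inequality is used in the old metric; passing to the metric of the new anchor then
  -- costs `1 / (1 - d)`.
  have hmove : ∀ {c c' y : Vec dy} {d W : ℝ}, c ∈ P.interiorY → P.dikinNorm c (c' - c) ≤ d →
      d < 1 → P.dikinNorm c (y - c) ≤ W → P.dikinNorm c' (y - c') ≤ (W + d) / (1 - d) := by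
    intro c c' y d W hc h1 h2 h3
    refine (dikinNorm_le_div hc h2 h1 _).trans ?_
    refine div_le_div_of_nonneg_right ?_ (by linarith)
    have : y - c' = (y - c) - (c' - c) := by abel
    rw [this]
    exact (dikinNorm_sub_le _ _ _).trans (add_le_add h3 h1)
  have hτη : τ * η ≤ 1 / 8 := by nlinarith
  have mz := anchor_move hτ0 hτ hη0 hη hVz0 hz hWz (mul_nonneg hls0 hΔ0) hdz
    (dikinNorm_nonneg (P.exactCenter μ s'.x) (s'.z - P.exactCenter μ s'.x))
    (hmove hcz hex (by linarith) le_rfl)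
  set d := 2 * C.lf0 / C.ρψ * (1 / S.lam k - 1 / S.lam (k + 1)) + C.ll0 * ‖s'.x - s.x‖ with hd
  have hd0 : 0 ≤ d := add_nonneg (mul_nonneg hκ0 hinv0) (mul_nonneg hC.ll0_nonneg hΔ0)
  have hdle : d ≤ τ * η / 16 := by
    have : 0 ≤ τ * η := by positivity
    linarith
  have my := anchor_move hτ0 hτ hη0 hη hVy0 hy hWy hd0 hdle
    (dikinNorm_nonneg (P.proxyCenter (S.lam (k + 1)) μ s'.x)
      (s'.y - P.proxyCenter (S.lam (k + 1)) μ s'.x))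
    (hmove hcy hpr (by linarith) le_rfl)
  refine ⟨mz.1, my.1, mz.2, my.2.trans ?_, hWz', hWy'⟩
  have h1 : d ≤ 2 * C.lf0 / C.ρψ * (1 / S.lam k - 1 / S.lam (k + 1)) + C.ls0 * ‖s'.x - s.x‖ :=
    add_le_add_right (mul_le_mul_of_nonneg_right hC.ll0_le_ls0 hΔ0) _
  have h2 := pow_le_pow_left₀ hd0 h1 2
  have h3 := mul_le_mul_of_nonneg_left h2 (by positivity : 0 ≤ 7 / τ)
  linarith

/-- Both trackers stay in their tubes at the start of every outer iteration. -/
theorem run_error_le {s₀ : State dx dy} (hlam0 : S.lam 0 = lam₀) (hz : P.exactError μ s₀ ≤ η)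
    (hy : P.proxyError μ lam₀ s₀ ≤ η) (k : ℕ) :
    P.exactError μ (P.run μ S s₀ k) ≤ η ∧ P.proxyError μ (S.lam k) (P.run μ S s₀ k) ≤ η := by
  induction k with
  | zero => exact ⟨hz, by rw [hlam0]; exact hy⟩
  | succ k ih =>
    have := outerStep_tracking B hμ hlf0 hlg0 hη0 hη hC hS k _ ih.1 ih.2
    exact ⟨this.1, this.2.1⟩

/-- Forward invariance of the tubes for all inner iterates. -/
theorem run_inner_mem_tube {s₀ : State dx dy} (hlam0 : S.lam 0 = lam₀)
    (hz : P.exactError μ s₀ ≤ η) (hy : P.proxyError μ lam₀ s₀ ≤ η) (k t : ℕ) :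
    P.zInner μ (S.γ k) (P.run μ S s₀ k).x (P.run μ S s₀ k).z t ∈
      P.tube η (P.exactCenter μ (P.run μ S s₀ k).x) ∧
    P.yInner μ (S.α k) (S.lam k) (P.run μ S s₀ k).x (P.run μ S s₀ k).y t ∈
      P.tube η (P.proxyCenter (S.lam k) μ (P.run μ S s₀ k).x) := by
  obtain ⟨h1, h2⟩ := run_error_le B hμ hlf0 hlg0 hη0 hη hC hS hlam0 hz hy k
  obtain ⟨q0, q1⟩ := hS.rate_mem hC
  have hq := pow_le_one₀ (n := t) q0 q1
  rw [mem_tube_iff (B.exactCenter_mem hμ _) (by linarith),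
    mem_tube_iff (B.proxyCenter_mem hμ (hS.lam_pos hC k) _)
      (by linarith)]
  constructor
  · exact (exact_inner_le B hμ hη0 hη hC hS k _ h1 t).trans
      ((mul_le_of_le_one_left (dikinNorm_nonneg _ _) hq).trans h1)
  · exact (proxy_inner_le B hμ hη0 hη hC hS k _ h2 t).trans
      ((mul_le_of_le_one_left (dikinNorm_nonneg _ _) hq).trans h2)

end Step

end Tracking

end BarrierBilevel

namespace BarrierBilevel

/-! ### Error of the outer direction and the descent lemma -/

section Direction

variable {dx dy m : ℕ} {P : Problem dx dy m} {l ρ R lf0 lg0 μ η : ℝ} {C : DikinConstants}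

theorem hasDerivAt_jointDeriv_line {h : Vec dx → Vec dy → ℝ}
    (hh : ContDiffOn ℝ 2 (Function.uncurry h) P.region) (x : Vec dx) (c e : Vec dy) {t : ℝ}
    (ht : c + t • e ∈ P.interiorY) (p : Vec dx × Vec dy) :
    HasDerivAt (fun t : ℝ => jointDeriv h x (c + t • e) p)
      (jointHess h x (c + t • e) (0, e) p) t := by
  have h1 : HasDerivAt (fun t : ℝ => c + t • e) e t := by
    simpa using ((hasDerivAt_id t).smul_const e).const_add c
  have h2 := HasFDerivAt.comp_hasDerivAt (f := fun t : ℝ => c + t • e) t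
    (hasFDerivAt_jointDeriv_right isOpen_region hh (mem_region (x := x) ht)) h1
  simpa using h2.clm_apply (hasDerivAt_const t p)

theorem dikinNorm_segment_le {c e : Vec dy} {r : ℝ} (he : P.dikinNorm c e ≤ r) {t : ℝ}
    (ht : t ∈ Set.Icc (0 : ℝ) 1) : P.dikinNorm c (c + t • e - c) ≤ r := by
  rw [add_sub_cancel_left, dikinNorm_smul, abs_of_nonneg ht.1]
  exact (mul_le_of_le_one_left (dikinNorm_nonneg _ _) ht.2).trans he

/-- A bound on the mixed second derivative bounds the increments of the upper partial gradient. -/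
theorem abs_derivX_increment_le {h : Vec dx → Vec dy → ℝ}
    (hh : ContDiffOn ℝ 2 (Function.uncurry h) P.region) {K r : ℝ} {x : Vec dx} {c y : Vec dy}
    (hc : c ∈ P.interiorY) (hr : r < 1) (hy : P.dikinNorm c (y - c) ≤ r)
    (hK : ∀ y ∈ P.tube r c, ∀ u v, |hessXY h x y u v| ≤ K * ‖u‖ * P.dikinNorm c v) (u : Vec dx) :
    |jointDeriv h x y (u, 0) - jointDeriv h x c (u, 0)| ≤ K * ‖u‖ * P.dikinNorm c (y - c) := by
  set e := y - c with he
  have hmem : ∀ t ∈ Set.Icc (0 : ℝ) 1, c + t • e ∈ P.tube r c := fun t ht =>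
    (mem_tube_iff hc hr).2 (dikinNorm_segment_le hy ht)
  have := abs_sub_le_of_hasDerivAt (C := K * ‖u‖ * P.dikinNorm c e)
    (fun t ht => hasDerivAt_jointDeriv_line hh x c e (hmem t ht).1 (u, 0)) (fun t ht => ?_)
  · have hend : c + e = y := by simp [he]
    simpa [hend] using this
  · rw [jointHess_symm isOpen_region hh (mem_region (hmem t ht).1),
      ← hessXY_eq isOpen_region hh (mem_region (hmem t ht).1)]
    exact hK _ (hmem t ht) u e

/-- The two curvature bounds are compared at the center of the tube. The factor `‖u‖_c` is kept
because `ρ_ψ ≤ ℓ_{ψ,1}` need not hold when there is no nonzero direction. -/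
theorem ρψ_mul_le (hη0 : 0 < η)
    {x : Vec dx} {c : Vec dy} (hc : c ∈ P.interiorY) (hL : P.LocalBounds μ η C x c) (u : Vec dy) :
    C.ρψ * P.dikinNorm c u ≤ C.lψ1 * P.dikinNorm c u := by
  have hmem : c ∈ P.tube (2 * η) c :=
    ⟨hc, by rw [sub_self, dikinNorm_eq, map_zero, norm_zero]; linarith⟩
  obtain ⟨h1, h2⟩ := hL.curvature c hmem u
  have h3 := h1.trans h2
  rcases (dikinNorm_nonneg (P := P) c u).eq_or_lt with h | h
  · rw [← h]; simp
  · refine le_of_mul_le_mul_right ?_ h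
    linarith

/-- The outer direction inherits the tracking errors. -/
theorem Problem.HasBounds.norm_direction_sub_le (B : P.HasBounds l ρ R lf0 lg0) (hμ : 0 < μ)
    (hη0 : 0 < η) (hη : η < 1 / 2) (hC : P.IsDikinConstants μ η C) {lam : ℝ}
    (hlam : C.lamη ≤ lam) (hcurv : 2 * C.lf1 / C.ρψ ≤ lam) (x : Vec dx) {y z : Vec dy}
    (hy : P.dikinNorm (P.proxyCenter lam μ x) (y - P.proxyCenter lam μ x) ≤ η)
    (hz : P.dikinNorm (P.exactCenter μ x) (z - P.exactCenter μ x) ≤ η) :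
    ‖P.direction μ lam x y z - P.direction μ lam x (P.proxyCenter lam μ x) (P.exactCenter μ x)‖ ≤
      lam * C.lψ1 * (3 / 2 * P.dikinNorm (P.proxyCenter lam μ x) (y - P.proxyCenter lam μ x) +
        P.dikinNorm (P.exactCenter μ x) (z - P.exactCenter μ x)) := by
  have hlam0 : 0 < lam := hC.lamη_pos.trans_le hlam
  have hψ := contDiffOn_psi B.g_smooth μ
  have hρ := hC.ρψ_pos
  have hℓ := hC.lψ1_pos
  have hcy := B.proxyCenter_mem hμ hlam0 x
  have hcz := B.exactCenter_mem hμ x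
  have hLy := hC.proxy_bounds lam hlam x
  have hLz := hC.exact_bounds x
  set cy := P.proxyCenter lam μ x
  set cz := P.exactCenter μ x
  have hyi : y ∈ P.interiorY := mem_interiorY_of_dikinNorm hcy (by linarith)
  have hzi : z ∈ P.interiorY := mem_interiorY_of_dikinNorm hcz (by linarith)
  set Wy := P.dikinNorm cy (y - cy) with hWy
  set Wz := P.dikinNorm cz (z - cz) with hWz
  have hWy0 : 0 ≤ Wy := dikinNorm_nonneg _ _
  have hWz0 : 0 ≤ Wz := dikinNorm_nonneg _ _
  -- The `f` part of the direction is absorbed as half of the `ψ_μ` part, which accounts for the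
  -- factor `3/2`.
  have hf : C.lf1 * Wy ≤ lam * C.lψ1 * (1 / 2 * Wy) := by
    have h1 : C.lf1 ≤ lam * C.ρψ / 2 := by
      rw [div_le_iff₀ hρ] at hcurv; linarith
    have h2 := mul_le_mul_of_nonneg_left (ρψ_mul_le hη0 hcy hLy (y - cy)) hlam0.le
    have h3 := mul_le_mul_of_nonneg_right h1 hWy0
    linarith
  refine norm_le_of_forall_inner_le (by positivity) fun u => ?_
  have a1 := (abs_le.1 (abs_derivX_increment_le B.f_smooth hcy (r := 2 * η) (by linarith)
    (hy.trans (by linarith)) hLy.f_cross u)).2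
  have a2 := (abs_le.1 (abs_derivX_increment_le hψ hcy (r := 2 * η) (by linarith)
    (hy.trans (by linarith)) hLy.psi_cross u)).2
  have a3 := (abs_le.1 (abs_derivX_increment_le hψ hcz (r := 2 * η) (by linarith)
    (hz.trans (by linarith)) hLz.psi_cross u)).1
  rw [inner_sub_left, B.inner_direction μ lam x hyi hzi, B.inner_direction μ lam x hcy hcz]
  have a4 := mul_le_mul_of_nonneg_left a2 hlam0.le
  have a5 := mul_le_mul_of_nonneg_left a3 hlam0.le
  have a6 := mul_le_mul_of_nonneg_right hf (norm_nonneg u)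
  linarith

/-- The gradient of the penalized surrogate approximates the gradient of `F_μ` at rate `1/λ`. -/
theorem Problem.HasBounds.exists_bias_bound (B : P.HasBounds l ρ R lf0 lg0) (hμ : 0 < μ)
    (hlf0 : 0 ≤ lf0) (hη : η < 1 / 2) (hC : P.IsDikinConstants μ η C) :
    ∃ b : ℝ, 0 ≤ b ∧ ∀ lam, C.lamη ≤ lam → ∀ x,
      ‖P.direction μ lam x (P.proxyCenter lam μ x) (P.exactCenter μ x) - gradient (P.F μ) x‖ ≤
        b / lam := by
  have hR := B.R_pos
  have hl := B.l_pos
  have hM := B.centerLip_pos hμ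
  have hψ := contDiffOn_psi B.g_smooth μ
  set M := centerLip l ρ R μ with hMdef
  set κ := 2 * C.lf0 / C.ρψ with hκ
  have hκ0 : 0 ≤ κ := by have := hC.lf0_nonneg; have := hC.ρψ_pos; positivity
  refine ⟨l * (R * κ) * (1 + R * M) + κ ^ 2 * (l * R ^ 2 * (1 + R * M) + μ * (8 * M)),
    by positivity, fun lam hlam x => ?_⟩
  have hlam0 : 0 < lam := hC.lamη_pos.trans_le hlam
  have hcy := B.proxyCenter_mem hμ hlam0 x
  have hcz := B.exactCenter_mem hμ x
  obtain ⟨t1, t2⟩ := hC.proxy_transfer lam hlam x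
  have hsy := B.proxyCenter_stationary hμ hlam0 x
  have hsz := B.exactCenter_stationary hμ x
  refine norm_le_of_forall_inner_le (by positivity) fun u => ?_
  have hgr := B.norm_graph_le hμ hlf0 x u
  have hw := B.dikinNorm_fderiv_exactCenter_le hμ hlf0 x u
  have hJ := (B.fderiv_exactCenter_spec hμ hlf0 x).2 u
  rw [inner_sub_left, B.inner_direction μ lam x hcy hcz, B.inner_gradient_F hμ hlf0]
  set cy := P.proxyCenter lam μ x
  set cz := P.exactCenter μ x
  set w := fderiv ℝ (P.exactCenter μ) x u
  set e := cy - cz with he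
  set D := P.dikinNorm cz e with hD
  have hD0 : 0 ≤ D := dikinNorm_nonneg _ _
  have hDη : D ≤ η := t1.trans t2
  have heD : ‖e‖ ≤ R * D := B.norm_le_dikinNorm hcz e
  have split : ∀ (h : Vec dx → Vec dy → ℝ) (y : Vec dy),
      jointDeriv h x y (u, w) = jointDeriv h x y (u, 0) + jointDeriv h x y (0, w) := by
    intro h y
    rw [← map_add]
    simp
  have k1 : jointDeriv P.f x cy (u, w) - jointDeriv P.f x cz (u, w) ≤
      l * (R * D) * ((1 + R * M) * ‖u‖) := by
    rw [← sub_apply]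
    refine (le_abs_self _).trans (((jointDeriv P.f x cy - jointDeriv P.f x cz).le_opNorm _).trans ?_)
    have h1 := B.f_deriv_lip x x cy hcy cz hcz
    rw [sub_self, norm_zero, zero_add] at h1
    have h2 : ‖jointDeriv P.f x cy - jointDeriv P.f x cz‖ ≤ l * (R * D) :=
      h1.trans (mul_le_mul_of_nonneg_left heD hl.le)
    gcongr
  -- The graph direction `(u, w)` is orthogonal to `(0, e)` for the Hessian at the exact center, by
  -- the implicit equation. Only the variation of the Hessian along the segment remains, so the
  -- increment is of order `D²`.
  have k2 : jointDeriv (P.psi μ) x cy (u, w) - jointDeriv (P.psi μ) x cz (u, w) ≤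
      D ^ 2 * (l * R ^ 2 * (1 + R * M) + μ * (8 * M)) * ‖u‖ := by
    have hseg : ∀ t ∈ Set.Icc (0 : ℝ) 1, P.dikinNorm cz (cz + t • e - cz) ≤ D := fun t ht =>
      dikinNorm_segment_le le_rfl ht
    have hmem : ∀ t ∈ Set.Icc (0 : ℝ) 1, cz + t • e ∈ P.interiorY := fun t ht =>
      mem_interiorY_of_dikinNorm hcz ((hseg t ht).trans_lt (by linarith))
    have := abs_sub_le_of_hasDerivAt
      (C := D ^ 2 * (l * R ^ 2 * (1 + R * M) + μ * (8 * M)) * ‖u‖)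
      (fun t ht => hasDerivAt_jointDeriv_line hψ x cz e (hmem t ht) (u, w)) (fun t ht => ?_)
    · have hend : cz + e = cy := by simp [he]
      rw [one_smul, zero_smul, add_zero, hend] at this
      exact (le_abs_self _).trans this
    · set y := cz + t • e with hy
      have h0 : jointHess (P.psi μ) x cz (0, e) (u, w) = 0 := by
        rw [jointHess_symm isOpen_region hψ (mem_region hcz)]
        exact hJ e
      have h1 : jointHess (P.psi μ) x y (0, e) (u, w) =
          (jointHess P.g x y - jointHess P.g x cz) (0, e) (u, w) +
          μ * (inner ℝ (P.scaled y e) (P.scaled y w) -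
            inner ℝ (P.scaled cz e) (P.scaled cz w)) := by
        rw [← sub_zero (jointHess (P.psi μ) x y (0, e) (u, w)), ← h0,
          jointHess_psi_apply B.g_smooth μ (hmem t ht), jointHess_psi_apply B.g_smooth μ hcz,
          sub_apply, sub_apply]
        ring
      have h2 : |(jointHess P.g x y - jointHess P.g x cz) (0, e) (u, w)| ≤
          l * (R * D) * (R * D) * ((1 + R * M) * ‖u‖) := by
        refine ((jointHess P.g x y - jointHess P.g x cz).le_opNorm₂ (0, e) (u, w)).trans ?_
        have h3 := B.g_hess_lip x x y (hmem t ht) cz hcz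
        rw [sub_self, norm_zero, zero_add] at h3
        have h4 : ‖jointHess P.g x y - jointHess P.g x cz‖ ≤ l * (R * D) :=
          h3.trans (mul_le_mul_of_nonneg_left ((B.norm_le_dikinNorm hcz (y - cz)).trans
            (mul_le_mul_of_nonneg_left (hseg t ht) hR.le)) hl.le)
        have h5 : ‖((0 : Vec dx), e)‖ ≤ R * D := by
          rw [Prod.norm_mk, norm_zero, max_eq_right (norm_nonneg e)]
          exact heD
        gcongr
      have h3 : |inner ℝ (P.scaled y e) (P.scaled y w) -
          inner ℝ (P.scaled cz e) (P.scaled cz w)| ≤ 8 * D * D * (M * ‖u‖) := by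
        have hθ : ((1 - D) ^ 2)⁻¹ - 1 ≤ 8 * D := by
          rw [sub_le_iff_le_add, inv_le_iff_one_le_mul₀ (by nlinarith)]
          have h6 : 0 ≤ 1 / 2 - D := by linarith
          have h7 : 0 ≤ D * (1 / 2 - D) := mul_nonneg hD0 h6
          nlinarith [mul_nonneg h7 h6, mul_nonneg h7 hD0, h7]
        have := abs_inner_scaled_sub_le hcz (hmem t ht) (θ := 8 * D) (by positivity)
          (fun i => (abs_sq_slack_ratio_sub_one_le hcz (by linarith) (hseg t ht) i).trans hθ) e w
        refine this.trans ?_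
        gcongr
      rw [h1]
      refine (abs_add_le _ _).trans ?_
      rw [abs_mul, abs_of_pos hμ]
      have := mul_le_mul_of_nonneg_left h3 hμ.le
      linarith
  -- Replacing `(u, 0)` by `(u, w)` costs nothing: `∇_y ψ_μ` vanishes at the exact center and `∇_y f
  -- + λ ∇_y ψ_μ` at the proxy center.
  have hsplit : jointDeriv P.f x cy (u, 0) +
      lam * (jointDeriv (P.psi μ) x cy (u, 0) - jointDeriv (P.psi μ) x cz (u, 0)) -
        jointDeriv P.f x cz (u, w) =
      (jointDeriv P.f x cy (u, w) - jointDeriv P.f x cz (u, w)) +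
        lam * (jointDeriv (P.psi μ) x cy (u, w) - jointDeriv (P.psi μ) x cz (u, w)) := by
    rw [split P.f cy, split (P.psi μ) cy, split (P.psi μ) cz, hsz w]
    linarith [hsy w]
  rw [hsplit]
  have hDκ : D ≤ κ / lam := t1
  have k3 : l * (R * D) * ((1 + R * M) * ‖u‖) ≤ l * (R * (κ / lam)) * ((1 + R * M) * ‖u‖) := by
    gcongr
  have k4 : D ^ 2 * (l * R ^ 2 * (1 + R * M) + μ * (8 * M)) * ‖u‖ ≤
      (κ / lam) ^ 2 * (l * R ^ 2 * (1 + R * M) + μ * (8 * M)) * ‖u‖ := by gcongr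
  have k5 := mul_le_mul_of_nonneg_left (k2.trans k4) hlam0.le
  have k6 : (l * (R * κ) * (1 + R * M) + κ ^ 2 * (l * R ^ 2 * (1 + R * M) + μ * (8 * M))) / lam *
      ‖u‖ = l * (R * (κ / lam)) * ((1 + R * M) * ‖u‖) +
        lam * ((κ / lam) ^ 2 * (l * R ^ 2 * (1 + R * M) + μ * (8 * M)) * ‖u‖) := by
    field_simp
  rw [k6]
  linarith

/-- The descent lemma for a function with a Lipschitz gradient. -/
theorem descent_of_gradient_lipschitz {n : ℕ} {F : Vec n → ℝ} (hF : Differentiable ℝ F) {L : ℝ}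
    (hL : ∀ x₁ x₂, ‖gradient F x₂ - gradient F x₁‖ ≤ L * ‖x₂ - x₁‖) (x h : Vec n) :
    F (x + h) ≤ F x + inner ℝ (gradient F x) h + L / 2 * ‖h‖ ^ 2 := by
  have hd : ∀ t : ℝ, HasDerivAt (fun t : ℝ => F (x + t • h) - t * inner ℝ (gradient F x) h -
      L / 2 * ‖h‖ ^ 2 * t ^ 2)
      (inner ℝ (gradient F (x + t • h)) h - inner ℝ (gradient F x) h -
        L / 2 * ‖h‖ ^ 2 * (2 * t)) t := by
    intro t
    have h1 : HasDerivAt (fun t : ℝ => x + t • h) h t := by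
      simpa using ((hasDerivAt_id t).smul_const h).const_add x
    have h2 := HasFDerivAt.comp_hasDerivAt (f := fun t : ℝ => x + t • h) t
      (hF (x + t • h)).hasFDerivAt h1
    rw [← inner_gradient_eq] at h2
    have h3 := (h2.sub ((hasDerivAt_id t).mul_const (inner ℝ (gradient F x) h))).sub
      (((hasDerivAt_id t).pow 2).const_mul (L / 2 * ‖h‖ ^ 2))
    exact h3.congr_deriv (by simp)
  -- The auxiliary function subtracts the linear term and the quadratic majorant, so its derivative
  -- at the mean value point is nonpositive.
  obtain ⟨t, ht, hte⟩ := exists_hasDerivAt_eq_slope _ _ (zero_lt_one (α := ℝ))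
    (fun t _ => (hd t).continuousAt.continuousWithinAt) (fun t _ => hd t)
  have h1 : inner ℝ (gradient F (x + t • h)) h - inner ℝ (gradient F x) h ≤
      L * t * ‖h‖ ^ 2 := by
    rw [← inner_sub_left]
    refine (real_inner_le_norm _ _).trans ?_
    have h2 := hL x (x + t • h)
    rw [add_sub_cancel_left, norm_smul, Real.norm_of_nonneg ht.1.le] at h2
    have := mul_le_mul_of_nonneg_right h2 (norm_nonneg h)
    linarith
  simp only [one_smul, zero_smul, add_zero, one_mul, one_pow, mul_one, zero_mul, sub_zero,
    div_one, ne_eq, OfNat.ofNat_ne_zero, not_false_eq_true, zero_pow, mul_zero] at hte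
  linarith

end Direction

end BarrierBilevel

namespace BarrierBilevel

/-! ### Decrease of the potential and weighted summability -/

section Potential

variable {dx dy m : ℕ} {P : Problem dx dy m} {l ρ R lf0 lg0 μ η lam₀ β τ : ℝ}
  {C : DikinConstants} {S : Schedule}

theorem sq_add_mul_le (a c y z : ℝ) :
    (a + c * (3 / 2 * y + z)) ^ 2 ≤ 2 * a ^ 2 + 9 * c ^ 2 * (z ^ 2 + y ^ 2) := by
  have h1 : (3 / 2 * y + z) ^ 2 ≤ 9 / 2 * (z ^ 2 + y ^ 2) := by
    nlinarith [sq_nonneg (3 / 2 * y - z), sq_nonneg z]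
  have h2 := mul_le_mul_of_nonneg_left h1 (sq_nonneg c)
  have h3 := sq_nonneg (a - c * (3 / 2 * y + z))
  have h4 : (a + c * (3 / 2 * y + z)) ^ 2 =
      2 * a ^ 2 + 2 * (c ^ 2 * (3 / 2 * y + z) ^ 2) - (a - c * (3 / 2 * y + z)) ^ 2 := by ring
  linarith

set_option maxHeartbeats 800000 in
/-- The decrease of the potential along one outer iteration, as an inequality between numbers. -/
theorem potential_step {ξ α lam lam' b ℓ ls0 κ T ρ' β τ F F' G Q Er Vy Vz Vy' Vz' Δ : ℝ}
    (hξ : 0 < ξ) (hα : 0 < α) (hlam : 0 < lam) (hlam' : lam ≤ lam') (hT : 0 < T)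
    (hρ : 0 < ρ') (hℓ : 0 < ℓ) (hls0 : 0 ≤ ls0) (hτ0 : 0 < τ) (hτ : τ ≤ 1 / 4)
    (hβ : α * lam = β) (hτeq : τ = T * ρ' * β) (hlam1 : lam' ≤ (1 + τ / 16) * lam)
    (hanchor : ξ * ℓ * ls0 ≤ 1 / 100 * (T * ρ'))
    (hEr0 : 0 ≤ Er) (hEr : Er ≤ b / lam + lam * ℓ * (3 / 2 * Vy + Vz)) (hΔ : Δ = ξ * α * Q)
    (hF : F' ≤ F - ξ * α / 2 * G ^ 2 - ξ * α / 4 * Q ^ 2 + ξ * α / 2 * Er ^ 2)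
    (hz : Vz' ^ 2 ≤ (1 - τ / 6) * Vz ^ 2 + 7 / τ * (ls0 * Δ) ^ 2)
    (hy : Vy' ^ 2 ≤ (1 - τ / 6) * Vy ^ 2 + 7 / τ * (κ * (1 / lam - 1 / lam') + ls0 * Δ) ^ 2) :
    F' + 60 * ξ * ℓ ^ 2 / (T * ρ') * (lam' * (Vz' ^ 2 + Vy' ^ 2)) +
        60 * ξ * ℓ ^ 2 / (T * ρ') * (16 / τ) * κ ^ 2 * (1 / lam') ≤
      F + 60 * ξ * ℓ ^ 2 / (T * ρ') * (lam * (Vz ^ 2 + Vy ^ 2)) +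
        60 * ξ * ℓ ^ 2 / (T * ρ') * (16 / τ) * κ ^ 2 * (1 / lam) -
        ξ * α / 2 * G ^ 2 + ξ * b ^ 2 * (α / lam ^ 2) := by
  have hlam'0 : 0 < lam' := hlam.trans_le hlam'
  have hβ0 : 0 < β := by rw [← hβ]; positivity
  set A := 60 * ξ * ℓ ^ 2 / (T * ρ') with hA
  have hA0 : 0 < A := by positivity
  set g := 1 / lam - 1 / lam' with hg
  have hg0 : 0 ≤ g := sub_nonneg.2 (one_div_le_one_div_of_le hlam hlam')
  have hg1 : lam * g ≤ 1 := by
    have h1 : lam * g = 1 - lam / lam' := by rw [hg]; field_simp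
    have : 0 ≤ lam / lam' := by positivity
    linarith
  set V := Vz ^ 2 + Vy ^ 2 with hV
  have hV0 : 0 ≤ V := by positivity
  have hV' : Vz' ^ 2 + Vy' ^ 2 ≤ (1 - τ / 6) * V +
      7 / τ * (3 * (ls0 * Δ) ^ 2 + 2 * (κ * g) ^ 2) := by
    have h1 : (κ * g + ls0 * Δ) ^ 2 ≤ 2 * (κ * g) ^ 2 + 2 * (ls0 * Δ) ^ 2 := by
      nlinarith [sq_nonneg (κ * g - ls0 * Δ)]
    have h2 := mul_le_mul_of_nonneg_left h1 (by positivity : 0 ≤ 7 / τ)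
    linarith
  -- The contraction `1 - τ/6` outweighs the growth `1 + τ/16` of the multiplier and leaves `1 -
  -- τ/10`.
  have hU : lam' * (Vz' ^ 2 + Vy' ^ 2) ≤ (1 - τ / 10) * (lam * V) +
      8 / τ * lam * (3 * (ls0 * Δ) ^ 2 + 2 * (κ * g) ^ 2) := by
    set Y := 3 * (ls0 * Δ) ^ 2 + 2 * (κ * g) ^ 2 with hY
    have hY0 : 0 ≤ Y := by positivity
    have h1 : lam' * (Vz' ^ 2 + Vy' ^ 2) ≤
        (1 + τ / 16) * lam * ((1 - τ / 6) * V + 7 / τ * Y) :=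
      mul_le_mul hlam1 hV' (by positivity) (by positivity)
    have h2 : (1 + τ / 16) * (1 - τ / 6) ≤ 1 - τ / 10 := by nlinarith
    have h3 := mul_le_mul_of_nonneg_right h2 (by positivity : 0 ≤ lam * V)
    have h4 : (1 + τ / 16) * 7 ≤ 8 := by linarith
    have h5 := mul_le_mul_of_nonneg_right h4 (by positivity : 0 ≤ lam * Y / τ)
    have h6 : 7 / τ * Y = 7 * (Y / τ) := by ring
    have h7 : 8 / τ * lam * Y = 8 * (lam * Y / τ) := by ring
    rw [h6] at h1
    rw [h7]
    have h8 : lam * Y / τ = lam * (Y / τ) := by ring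
    rw [h8] at h5 ⊢
    linarith
  have hErr : ξ * α / 2 * Er ^ 2 ≤ ξ * b ^ 2 * (α / lam ^ 2) + 9 / 2 * ξ * β * ℓ ^ 2 * (lam * V) := by
    have h1 := pow_le_pow_left₀ hEr0 hEr 2
    have h2 := sq_add_mul_le (b / lam) (lam * ℓ) Vy Vz
    have h3 := mul_le_mul_of_nonneg_left (h1.trans h2) (by positivity : 0 ≤ ξ * α / 2)
    refine h3.trans_eq ?_
    rw [← hβ, hV]
    field_simp
  -- The weight `60` makes the gain `6 ξβℓ² λV`, above the `9/2 ξβℓ² λV` that the direction error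
  -- costs.
  have hAτ : A * (τ / 10) = 6 * ξ * β * ℓ ^ 2 := by rw [hA, hτeq]; field_simp; norm_num
  -- The absolute constant enters here: `1440 · (1/100)² ≤ 1/4`, so the negative term in `Q²` pays
  -- for the drift of the anchors.
  have hdrift : A * (8 / τ * lam * (3 * (ls0 * Δ) ^ 2)) ≤ ξ * α / 4 * Q ^ 2 := by
    have h1 : A * (8 / τ * lam * (3 * (ls0 * Δ) ^ 2)) =
        1440 * (ξ * ℓ * ls0 / (T * ρ')) ^ 2 * (ξ * α * Q ^ 2) := by
      rw [hA, hτeq, hΔ, ← hβ]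
      field_simp
      ring
    have h2 : ξ * ℓ * ls0 / (T * ρ') ≤ 1 / 100 := by
      rw [div_le_iff₀ (by positivity)]; exact hanchor
    have h3 := pow_le_pow_left₀ (by positivity) h2 2
    rw [h1]
    have h4 : 1440 * (ξ * ℓ * ls0 / (T * ρ')) ^ 2 ≤ 1 / 4 := by linarith
    have := mul_le_mul_of_nonneg_right h4 (by positivity : 0 ≤ ξ * α * Q ^ 2)
    linarith
  -- One factor `g` is traded against `λ` by `λ g ≤ 1`; the remaining `g` is a difference of
  -- reciprocals and telescopes through the `1/λ` term of the potential.
  have hlamdrift : A * (8 / τ * lam * (2 * (κ * g) ^ 2)) ≤ A * (16 / τ) * κ ^ 2 * g := by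
    have h1 : A * (8 / τ * lam * (2 * (κ * g) ^ 2)) = A * (16 / τ) * κ ^ 2 * g * (lam * g) := by
      ring
    rw [h1]
    exact mul_le_of_le_one_right (by positivity) hg1
  have hAU := mul_le_mul_of_nonneg_left hU hA0.le
  have e1 : A * ((1 - τ / 10) * (lam * V) + 8 / τ * lam * (3 * (ls0 * Δ) ^ 2 + 2 * (κ * g) ^ 2)) =
      A * (lam * V) - A * (τ / 10) * (lam * V) + A * (8 / τ * lam * (3 * (ls0 * Δ) ^ 2)) +
        A * (8 / τ * lam * (2 * (κ * g) ^ 2)) := by ring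
  rw [e1, hAτ] at hAU
  have e2 : A * (16 / τ) * κ ^ 2 * g =
      A * (16 / τ) * κ ^ 2 * (1 / lam) - A * (16 / τ) * κ ^ 2 * (1 / lam') := by rw [hg]; ring
  have e3 : 0 ≤ ξ * β * ℓ ^ 2 * (lam * V) := by positivity
  linarith

/-- The weighted squared gradients along the run are summable up to the bias of the penalty. -/
theorem exists_sum_gradient_le (B : P.HasBounds l ρ R lf0 lg0) (hμ : 0 < μ) (hlf0 : 0 ≤ lf0)
    (hlg0 : 0 ≤ lg0) (hη0 : 0 < η) (hη : η < 1 / 2) (hC : P.IsDikinConstants μ η C)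
    (hS : S.IsTracking (1 / 100) lf0 lg0 η C lam₀ β τ) (hbdd : BddBelow (Set.range (P.F μ)))
    {s₀ : State dx dy} (hlam0 : S.lam 0 = lam₀) (hz : P.exactError μ s₀ ≤ η)
    (hy : P.proxyError μ lam₀ s₀ ≤ η) :
    ∃ Φ b : ℝ, 0 ≤ b ∧ ∀ K : ℕ,
      ∑ k ∈ Finset.range K, S.α k * ‖gradient (P.F μ) (P.run μ S s₀ k).x‖ ^ 2 ≤
        Φ + b * ∑ k ∈ Finset.range K, S.α k / S.lam k ^ 2 := by
  obtain ⟨b, hb0, hb⟩ := B.exists_bias_bound hμ hlf0 hη hC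
  obtain ⟨F₀, hF₀⟩ := hbdd
  have hlamk := hS.lam_pos hC
  have hτ0 := hS.τ_pos hC
  have hT : (0 : ℝ) < S.T := by exact_mod_cast hS.T_pos
  have hls0 : 0 ≤ C.ls0 := by linarith [hC.one_le_ls0]
  have hξ := hS.ξ_pos
  set s := P.run μ S s₀ with hs
  set A := 60 * S.ξ * C.lψ1 ^ 2 / (S.T * C.ρψ) with hA
  have hA0 : 0 < A := by have := hC.lψ1_pos; have := hC.ρψ_pos; positivity
  set κ := 2 * C.lf0 / C.ρψ with hκ
  set Φ : ℕ → ℝ := fun k => P.F μ (s k).x +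
    A * (S.lam k * (P.exactError μ (s k) ^ 2 + P.proxyError μ (S.lam k) (s k) ^ 2)) +
    A * (16 / τ) * κ ^ 2 * (1 / S.lam k) with hΦ
  have hstep : ∀ k, Φ (k + 1) ≤ Φ k - S.ξ * S.α k / 2 * ‖gradient (P.F μ) (s k).x‖ ^ 2 +
      S.ξ * b ^ 2 * (S.α k / S.lam k ^ 2) := by
    intro k
    obtain ⟨hzk, hyk⟩ := run_error_le B hμ hlf0 hlg0 hη0 hη hC hS hlam0 hz hy k
    obtain ⟨-, -, t1, t2, t3, t4⟩ := outerStep_tracking B hμ hlf0 hlg0 hη0 hη hC hS k _ hzk hyk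
    have hsk : P.outerStep μ S k (P.run μ S s₀ k) = s (k + 1) := rfl
    rw [hsk, ← hs] at t1 t2 t3 t4
    rw [← hs] at hzk hyk
    have hα := hS.α_pos k
    have hlamη := hS.lamη_le.trans (hS.lam_ge k)
    set q := P.direction μ (S.lam k) (s k).x (s (k + 1)).y (s (k + 1)).z with hq
    have hx : (s (k + 1)).x = (s k).x + (-(S.ξ * S.α k)) • q := by
      have : (s (k + 1)).x = (s k).x - (S.ξ * S.α k) • q := rfl
      rw [this, neg_smul, sub_eq_add_neg]
    have hEr : ‖q - gradient (P.F μ) (s k).x‖ ≤ b / S.lam k + S.lam k * C.lψ1 *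
        (3 / 2 * P.proxyError μ (S.lam k) (s k) + P.exactError μ (s k)) := by
      have h1 := B.norm_direction_sub_le hμ hη0 hη hC hlamη (hS.curvature.trans (hS.lam_ge k))
        (s k).x (t4.trans hyk) (t3.trans hzk)
      have h2 := hb (S.lam k) hlamη (s k).x
      have h3 := norm_sub_le_norm_sub_add_norm_sub q (P.direction μ (S.lam k) (s k).x
        (P.proxyCenter (S.lam k) μ (s k).x) (P.exactCenter μ (s k).x)) (gradient (P.F μ) (s k).x)
      have h4 := mul_le_mul_of_nonneg_left (add_le_add
        (mul_le_mul_of_nonneg_left t4 (by norm_num : (0 : ℝ) ≤ 3 / 2)) t3)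
        (mul_nonneg (hlamk k).le hC.lψ1_pos.le)
      linarith
    have hΔ : ‖(s (k + 1)).x - (s k).x‖ = S.ξ * S.α k * ‖q‖ := by
      rw [hx, add_sub_cancel_left, norm_smul, norm_neg, Real.norm_of_nonneg (by positivity)]
    -- The cross term is expanded as `-⟨G, q⟩ = (‖q - G‖² - ‖q‖² - ‖G‖²) / 2`, and the bound on `α`
    -- limits the quadratic term to half of the resulting `‖q‖²` gain.
    have hF : P.F μ (s (k + 1)).x ≤ P.F μ (s k).x -
        S.ξ * S.α k / 2 * ‖gradient (P.F μ) (s k).x‖ ^ 2 - S.ξ * S.α k / 4 * ‖q‖ ^ 2 +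
          S.ξ * S.α k / 2 * ‖q - gradient (P.F μ) (s k).x‖ ^ 2 := by
      have h1 := descent_of_gradient_lipschitz
        (fun x => (B.hasFDerivAt_F hμ hlf0 x).differentiableAt) hC.F_smooth (s k).x
        ((-(S.ξ * S.α k)) • q)
      rw [← hx, real_inner_smul_right, norm_smul, norm_neg, Real.norm_of_nonneg (by positivity),
        real_inner_comm] at h1
      rw [norm_sub_sq_real]
      have h2 := mul_le_mul_of_nonneg_right (hS.α_le k)
        (by positivity : 0 ≤ S.ξ * S.α k * ‖q‖ ^ 2 / 4)
      linarith
    exact potential_step hξ hα (hlamk k) (hS.lam_mono k) hT hC.ρψ_pos hC.lψ1_pos hls0 hτ0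
      hS.τ_le (hS.β_eq k) hS.τ_eq (hS.lam_succ_le k) hS.anchor (norm_nonneg _) hEr hΔ hF t1 t2
  have hΦlow : ∀ k, F₀ ≤ Φ k := fun k => by
    have h1 : F₀ ≤ P.F μ (s k).x := hF₀ ⟨_, rfl⟩
    have h2 := hlamk k
    have h3 : 0 ≤ A * (S.lam k * (P.exactError μ (s k) ^ 2 + P.proxyError μ (S.lam k) (s k) ^ 2)) +
        A * (16 / τ) * κ ^ 2 * (1 / S.lam k) := by positivity
    simp only [hΦ]
    linarith
  have hsum : ∀ K, S.ξ / 2 * ∑ k ∈ Finset.range K, S.α k * ‖gradient (P.F μ) (s k).x‖ ^ 2 ≤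
      Φ 0 - Φ K + S.ξ * b ^ 2 * ∑ k ∈ Finset.range K, S.α k / S.lam k ^ 2 := by
    intro K
    induction K with
    | zero => simp
    | succ K ih =>
      rw [Finset.sum_range_succ, Finset.sum_range_succ, mul_add, mul_add]
      have := hstep K
      linarith
  refine ⟨(Φ 0 - F₀) * (2 / S.ξ), 2 * b ^ 2, by positivity, fun K => ?_⟩
  have h1 := hsum K
  have h2 := hΦlow K
  have h3 : S.ξ / 2 * ∑ k ∈ Finset.range K, S.α k * ‖gradient (P.F μ) (s k).x‖ ^ 2 ≤
      Φ 0 - F₀ + S.ξ * b ^ 2 * ∑ k ∈ Finset.range K, S.α k / S.lam k ^ 2 := by linarith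
  have h4 := mul_le_mul_of_nonneg_left h3 (by positivity : 0 ≤ 2 / S.ξ)
  have e1 : ∀ X : ℝ, 2 / S.ξ * (S.ξ / 2 * X) = X := fun X => by field_simp
  have e2 : ∀ X Y : ℝ, 2 / S.ξ * (X + S.ξ * b ^ 2 * Y) = X * (2 / S.ξ) + 2 * b ^ 2 * Y :=
    fun X Y => by field_simp
  rwa [e1, e2] at h4

end Potential

/-! ### Rate and iteration complexity -/

section Rate

theorem sum_inv_succ_le (K : ℕ) :
    ∑ k ∈ Finset.range K, 1 / ((k : ℝ) + 1) ≤ 1 + Real.log K := by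
  have h := harmonic_le_one_add_log K
  simp only [harmonic, Rat.cast_sum] at h
  refine le_trans (le_of_eq (Finset.sum_congr rfl fun k _ => ?_)) h
  push_cast
  rw [one_div]

/-- Weighted summability with the polynomial profile gives the rate `K^{-2/3} log K`. -/
theorem polySchedule_rate {T : ℕ} {ξ α₀ γ₀ lam₀ k₀ Φ b : ℝ} (hα₀ : 0 < α₀) (hlam₀ : 0 < lam₀)
    (hk₀ : 0 < k₀) (hb : 0 ≤ b) {g : ℕ → ℝ} (hg : ∀ k, 0 ≤ g k)
    (h : ∀ K : ℕ, ∑ k ∈ Finset.range K, (polySchedule T ξ α₀ γ₀ lam₀ k₀).α k * g k ≤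
      Φ + b * ∑ k ∈ Finset.range K, (polySchedule T ξ α₀ γ₀ lam₀ k₀).α k /
        (polySchedule T ξ α₀ γ₀ lam₀ k₀).lam k ^ 2) :
    ∃ D : ℝ, 0 < D ∧ ∀ K : ℕ, 1 ≤ K →
      ∃ k < K, g k ≤ D * ((K : ℝ) ^ (-(2 / 3) : ℝ) * (1 + Real.log K)) := by
  set S := polySchedule T ξ α₀ γ₀ lam₀ k₀ with hS
  set β := α₀ * lam₀ / k₀ ^ (1 / 3 : ℝ) with hβ
  have hk3 : 0 < k₀ ^ (1 / 3 : ℝ) := Real.rpow_pos_of_pos hk₀ _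
  have hβ0 : 0 < β := by positivity
  -- As `αλ = β` is constant and `λ³` is linear in `k`, the bias `α/λ² = β/λ³` is comparable to the
  -- harmonic series.
  have hbias : ∀ k : ℕ, S.α k / S.lam k ^ 2 ≤
      β * k₀ / lam₀ ^ 3 * (1 + 1 / k₀) * (1 / ((k : ℝ) + 1)) := by
    intro k
    have hl : 0 < S.lam k := polySchedule_lam_pos hk₀ hlam₀ k
    have h1 : S.α k / S.lam k ^ 2 = β / S.lam k ^ 3 := by
      have : S.α k * S.lam k = β := polySchedule_β hk₀ k
      rw [← this]
      field_simp
    have h2 : S.lam k ^ 3 = lam₀ ^ 3 * (((k : ℝ) + k₀) / k₀) := by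
      have hpos : 0 ≤ ((k : ℝ) + k₀) / k₀ := by positivity
      rw [hS]
      simp only [polySchedule]
      rw [mul_pow, ← Real.rpow_natCast ((((k : ℝ) + k₀) / k₀) ^ (1 / 3 : ℝ)) 3, ← Real.rpow_mul hpos]
      norm_num
    rw [h1, h2]
    have h3 : β / (lam₀ ^ 3 * (((k : ℝ) + k₀) / k₀)) = β * k₀ / lam₀ ^ 3 * (1 / ((k : ℝ) + k₀)) := by
      field_simp
    rw [h3, mul_assoc]
    refine mul_le_mul_of_nonneg_left ?_ (by positivity)
    rw [mul_one_div, div_le_div_iff₀ (by positivity) (by positivity)]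
    have h4 : (1 + 1 / k₀) * ((k : ℝ) + k₀) = 1 * ((k : ℝ) + 1) + (k₀ + k / k₀) := by
      field_simp; ring
    rw [h4]
    have : 0 ≤ k₀ + (k : ℝ) / k₀ := by positivity
    linarith
  set E := b * (β * k₀ / lam₀ ^ 3 * (1 + 1 / k₀)) with hE
  have hE0 : 0 ≤ E := by positivity
  set a := α₀ / (1 + k₀) ^ (1 / 3 : ℝ) with ha
  have h1k : 0 < (1 + k₀) ^ (1 / 3 : ℝ) := Real.rpow_pos_of_pos (by linarith) _
  have ha0 : 0 < a := by positivity
  refine ⟨(|Φ| + E + 1) / a, by positivity, fun K hK => ?_⟩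
  have hK0 : (0 : ℝ) < K := by exact_mod_cast hK
  have hK1 : (1 : ℝ) ≤ K := by exact_mod_cast hK
  have hlog : 0 ≤ Real.log K := Real.log_nonneg hK1
  have hK3 : 0 < (K : ℝ) ^ (1 / 3 : ℝ) := Real.rpow_pos_of_pos hK0 _
  have hα : ∀ k < K, a / (K : ℝ) ^ (1 / 3 : ℝ) ≤ S.α k := by
    intro k hk
    have hkK : (k : ℝ) + 1 ≤ K := by exact_mod_cast hk
    rw [hS, ha, div_div, ← Real.mul_rpow (by positivity) hK0.le]
    simp only [polySchedule]
    gcongr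
    have : k₀ * 1 ≤ k₀ * K := by gcongr
    linarith
  -- If all gradients exceeded the claimed bound, the `K` weights, each at least `a K^{-1/3}`, would
  -- make the sum at least `(|Φ| + E + 1)(1 + log K)`, more than summability permits.
  by_contra hcon
  push Not at hcon
  have h1 := h K
  have h2 : ∑ k ∈ Finset.range K, S.α k / S.lam k ^ 2 ≤
      β * k₀ / lam₀ ^ 3 * (1 + 1 / k₀) * (1 + Real.log K) := by
    calc _ ≤ ∑ k ∈ Finset.range K,
          β * k₀ / lam₀ ^ 3 * (1 + 1 / k₀) * (1 / ((k : ℝ) + 1)) :=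
          Finset.sum_le_sum fun k _ => hbias k
      _ ≤ _ := by
        rw [← Finset.mul_sum]
        exact mul_le_mul_of_nonneg_left (sum_inv_succ_le K) (by positivity)
  set w := (|Φ| + E + 1) / a * ((K : ℝ) ^ (-(2 / 3) : ℝ) * (1 + Real.log K)) with hw
  have h3 : ∑ k ∈ Finset.range K, a / (K : ℝ) ^ (1 / 3 : ℝ) * w ≤
      ∑ k ∈ Finset.range K, S.α k * g k := by
    refine Finset.sum_le_sum fun k hk => ?_
    have hk' := Finset.mem_range.1 hk
    calc _ ≤ a / (K : ℝ) ^ (1 / 3 : ℝ) * g k :=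
          mul_le_mul_of_nonneg_left (hcon k hk').le (by positivity)
      _ ≤ _ := mul_le_mul_of_nonneg_right (hα k hk') (hg k)
  have h4 : ∑ k ∈ Finset.range K, a / (K : ℝ) ^ (1 / 3 : ℝ) * w =
      (|Φ| + E + 1) * (1 + Real.log K) := by
    rw [Finset.sum_const, Finset.card_range, nsmul_eq_mul, hw]
    have h5 : (K : ℝ) ^ (-(2 / 3) : ℝ) = (K : ℝ) ^ (1 / 3 : ℝ) / K := by
      rw [← Real.rpow_sub_one hK0.ne']
      norm_num
    rw [h5]
    field_simp
  have h6 := mul_le_mul_of_nonneg_left h2 hb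
  have h7 : 0 ≤ |Φ| * Real.log K := by positivity
  have h8 := le_abs_self Φ
  have h9 : b * (β * k₀ / lam₀ ^ 3 * (1 + 1 / k₀) * (1 + Real.log K)) = E * (1 + Real.log K) := by
    rw [hE]; ring
  linarith

theorem isBigO_iInf_of_rate {g : ℕ → ℝ} (hg : ∀ k, 0 ≤ g k) {D : ℝ} (hD : 0 < D)
    (h : ∀ K : ℕ, 1 ≤ K → ∃ k < K, g k ≤ D * ((K : ℝ) ^ (-(2 / 3) : ℝ) * (1 + Real.log K))) :
    (fun K : ℕ => ⨅ k : Fin K, g k) =O[atTop]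
      fun K : ℕ => (K : ℝ) ^ (-(2 / 3) : ℝ) * Real.log K ^ 1 := by
  refine IsBigO.of_bound (2 * D) ?_
  -- From `K = 3` on the index set is nonempty and `log K ≥ 1`, so `1 + log K ≤ 2 log K`.
  filter_upwards [eventually_ge_atTop 3] with K hK
  have hK3 : (3 : ℝ) ≤ K := by exact_mod_cast hK
  have hlog : 1 ≤ Real.log K := by
    rw [Real.le_log_iff_exp_le (by linarith)]
    exact (Real.exp_one_lt_three.le).trans hK3
  obtain ⟨k, hk, hle⟩ := h K (by omega)
  have h1 : ⨅ k : Fin K, g k ≤ g k :=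
    ciInf_le ⟨0, by rintro _ ⟨j, rfl⟩; exact hg j⟩ (⟨k, hk⟩ : Fin K)
  have h2 : 0 ≤ ⨅ k : Fin K, g k := Real.iInf_nonneg fun j => hg j
  have h3 : 0 ≤ (K : ℝ) ^ (-(2 / 3) : ℝ) := by positivity
  rw [Real.norm_of_nonneg h2, pow_one, Real.norm_of_nonneg (mul_nonneg h3 (by linarith))]
  refine h1.trans (hle.trans ?_)
  have : D * ((K : ℝ) ^ (-(2 / 3) : ℝ) * (1 + Real.log K)) ≤
      D * ((K : ℝ) ^ (-(2 / 3) : ℝ) * (2 * Real.log K)) := by gcongr; linarith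
  linarith

/-- With `L = log(1/ε)`, taking `K` near `(M² L² / ε)^{3/2}` makes the power of `K` at most `ε / (M²
L²)`. As `log K` grows only linearly in `L`, the spare factor `L²` absorbs it. -/
theorem complexity_of_rate {g : ℕ → ℝ} {D : ℝ} (hD : 0 < D)
    (h : ∀ K : ℕ, 1 ≤ K → ∃ k < K, g k ≤ D * ((K : ℝ) ^ (-(2 / 3) : ℝ) * (1 + Real.log K))) :
    ∃ (p : ℕ) (E : ℝ), ∀ ε : ℝ, 0 < ε → ε ≤ 1 / 2 →
      ∃ k : ℕ, (k : ℝ) ≤ E * (ε ^ (-(3 / 2) : ℝ) * Real.log (1 / ε) ^ p) ∧ g k ≤ ε := by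
  -- The coefficient `29 = 17 + 12` gives `D (17 + 12 M) ≤ M²`; the summand `2` keeps `M ≥ 2`, so
  -- that `X ≥ 1` when `L ≥ 1/2`.
  set M := 29 * D + 2 with hM
  have hM0 : 0 < M := by linarith
  refine ⟨3, 2 * M ^ 3, fun ε hε hε2 => ?_⟩
  set L := Real.log (1 / ε) with hL
  have hε' : 2 ≤ 1 / ε := by rw [le_div_iff₀ hε]; linarith
  have hL2 : 1 / 2 ≤ L := by
    have h1 : Real.log 2 ≤ L := Real.log_le_log (by norm_num) hε'
    linarith [Real.log_two_gt_d9]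
  have hL0 : 0 < L := by linarith
  set X := M ^ 2 * L ^ 2 * (1 / ε) with hX
  have hX0 : 0 < X := by positivity
  have hX1 : 1 ≤ X := by
    have h1 : 4 ≤ M ^ 2 := by nlinarith
    have h2 : 1 / 4 ≤ L ^ 2 := by nlinarith
    calc (1 : ℝ) ≤ 4 * (1 / 4) * 2 := by norm_num
      _ ≤ X := by rw [hX]; gcongr
  set N := X ^ (3 / 2 : ℝ) with hN
  have hN1 : 1 ≤ N := Real.one_le_rpow hX1 (by norm_num)
  have hN0 : 0 < N := by linarith
  have hcube : ∀ a : ℝ, 0 ≤ a → (a ^ 2) ^ (3 / 2 : ℝ) = a ^ 3 := fun a ha => by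
    rw [← Real.rpow_natCast a 2, ← Real.rpow_mul ha, ← Real.rpow_natCast a 3]
    norm_num
  have hNeq : N = M ^ 3 * (ε ^ (-(3 / 2) : ℝ) * L ^ 3) := by
    rw [hN, hX, Real.mul_rpow (by positivity) (by positivity),
      Real.mul_rpow (by positivity) (by positivity), hcube M hM0.le, hcube L hL0.le, one_div,
      Real.inv_rpow hε.le, Real.rpow_neg hε.le]
    ring
  set K := ⌈N⌉₊ with hK
  have hNK : N ≤ K := Nat.le_ceil N
  have hKN : (K : ℝ) ≤ 2 * N := by
    have := Nat.ceil_lt_add_one hN0.le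
    linarith
  have hK1 : 1 ≤ K := Nat.one_le_ceil_iff.2 hN0
  obtain ⟨k, hk, hgk⟩ := h K hK1
  refine ⟨k, ?_, hgk.trans ?_⟩
  · have : (k : ℝ) ≤ K := by exact_mod_cast hk.le
    rw [mul_assoc, ← hNeq]
    linarith
  · have h1 : (K : ℝ) ^ (-(2 / 3) : ℝ) ≤ 1 / X := by
      have h2 : (K : ℝ) ^ (-(2 / 3) : ℝ) ≤ N ^ (-(2 / 3) : ℝ) :=
        Real.rpow_le_rpow_of_nonpos hN0 hNK (by norm_num)
      have h3 : N ^ (-(2 / 3) : ℝ) = 1 / X := by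
        rw [hN, ← Real.rpow_mul hX0.le]
        norm_num
        exact Real.rpow_neg_one X
      rwa [h3] at h2
    have h2 : Real.log K ≤ 1 + 3 * M + 9 / 2 * L := by
      have e1 : Real.log K ≤ Real.log (2 * N) :=
        Real.log_le_log (by linarith) hKN
      have e2 : Real.log (2 * N) = Real.log 2 + 3 / 2 * Real.log X := by
        rw [Real.log_mul (by norm_num) hN0.ne', hN, Real.log_rpow hX0]
      have e3 : Real.log X = 2 * Real.log M + 2 * Real.log L + L := by
        rw [hX, Real.log_mul (by positivity) (by positivity), Real.log_mul (by positivity)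
          (by positivity), Real.log_pow, Real.log_pow]
        push_cast
        rfl
      have e4 := Real.log_le_sub_one_of_pos hM0
      have e5 := Real.log_le_sub_one_of_pos hL0
      have e6 := Real.log_two_lt_d9
      rw [e2, e3] at e1
      linarith
    have hlogK : 0 ≤ Real.log K := Real.log_nonneg (by exact_mod_cast hK1)
    have h3 : D * (2 + 3 * M + 9 / 2 * L) ≤ M ^ 2 * L ^ 2 := by
      have f1 : 2 + 3 * M + 9 / 2 * L ≤ (17 + 12 * M) * L ^ 2 := by
        have g1 : 1 / 4 ≤ L ^ 2 := by nlinarith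
        have g2 : L ≤ 2 * L ^ 2 := by nlinarith
        have g3 := mul_le_mul_of_nonneg_left g1 hM0.le
        linarith
      have f2 : D * (17 + 12 * M) ≤ M ^ 2 := by nlinarith
      calc _ ≤ D * ((17 + 12 * M) * L ^ 2) := mul_le_mul_of_nonneg_left f1 hD.le
        _ = D * (17 + 12 * M) * L ^ 2 := by ring
        _ ≤ _ := mul_le_mul_of_nonneg_right f2 (sq_nonneg L)
    calc D * ((K : ℝ) ^ (-(2 / 3) : ℝ) * (1 + Real.log K))
        ≤ D * (1 / X * (2 + 3 * M + 9 / 2 * L)) := by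
          refine mul_le_mul_of_nonneg_left (mul_le_mul h1 (by linarith) (by linarith)
            (by positivity)) hD.le
      _ = D * (2 + 3 * M + 9 / 2 * L) / X := by ring
      _ ≤ M ^ 2 * L ^ 2 / X := div_le_div_of_nonneg_right h3 hX0.le
      _ = ε := by rw [hX]; field_simp

end Rate

end BarrierBilevel

/-! ### Assembly of the main theorem -/

open BarrierBilevel in
theorem theorem3 :
    -- the absolute constant of the barrier-aware conditions
    ∃ cξ : ℝ, 0 < cξ ∧
    ∀ (dx dy m : ℕ) (P : Problem dx dy m) (lf0 lg0 μ : ℝ),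
      P.IsPolytope → P.Regular lf0 lg0 → 0 < μ →
      Differentiable ℝ (P.F μ) ∧
      -- for small radii, local Dikin constants exist and valid schedules exist for them
      (∃ η₀ : ℝ, 0 < η₀ ∧ ∀ η : ℝ, 0 < η → η < η₀ →
        ∃ C : DikinConstants, P.IsDikinConstants μ η C ∧
          ∀ T : ℕ, 1 ≤ T → ∃ ξ α₀ γ₀ lam₀ k₀ : ℝ,
            ValidPolySchedule cξ lf0 lg0 η C T ξ α₀ γ₀ lam₀ k₀) ∧
      -- for all radii, local Dikin constants and valid schedules, the algorithm converges
      (BddBelow (Set.range (P.F μ)) →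
        ∀ (η : ℝ) (C : DikinConstants) (T : ℕ) (ξ α₀ γ₀ lam₀ k₀ : ℝ) (s₀ : State dx dy),
          0 < η → η < 1 / 2 → P.IsDikinConstants μ η C → 1 ≤ T →
          ValidPolySchedule cξ lf0 lg0 η C T ξ α₀ γ₀ lam₀ k₀ →
          s₀.z ∈ P.tube η (P.exactCenter μ s₀.x) →
          s₀.y ∈ P.tube η (P.proxyCenter lam₀ μ s₀.x) →
          ∀ S : Schedule, S = polySchedule T ξ α₀ γ₀ lam₀ k₀ →
          ∀ s : ℕ → State dx dy, s = P.run μ S s₀ →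
          -- forward invariance of the neighborhoods, for all inner iterates
          (∀ k t : ℕ, t ≤ T →
            P.zInner μ (S.γ k) (s k).x (s k).z t ∈ P.tube η (P.exactCenter μ (s k).x) ∧
            P.yInner μ (S.α k) (S.lam k) (s k).x (s k).y t ∈
              P.tube η (P.proxyCenter (S.lam k) μ (s k).x)) ∧
          -- the rate, up to a power of the logarithm
          (∃ p : ℕ, (fun K : ℕ => ⨅ k : Fin K, ‖gradient (P.F μ) (s k).x‖ ^ 2) =O[atTop]
            fun K : ℕ => (K : ℝ) ^ (-(2 / 3) : ℝ) * Real.log K ^ p) ∧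
          -- the iteration complexity, up to a power of the logarithm
          (∃ (p : ℕ) (D : ℝ), ∀ ε : ℝ, 0 < ε → ε ≤ 1 / 2 →
            ∃ k : ℕ, (k : ℝ) ≤ D * (ε ^ (-(3 / 2) : ℝ) * Real.log (1 / ε) ^ p) ∧
              ‖gradient (P.F μ) (s k).x‖ ^ 2 ≤ ε)) := by
  refine ⟨1 / 100, by norm_num, fun dx dy m P lf0 lg0 μ hP hR hμ => ?_⟩
  obtain ⟨l, ρ, R, B⟩ := exists_hasBounds hP hR
  obtain ⟨y₁, hy₁⟩ := hP.slater
  -- The gradient bounds are nonnegative because they dominate a norm at a Slater point.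
  have hlf0 : 0 ≤ lf0 := (norm_nonneg _).trans (hR.gradX_f_le 0 y₁ hy₁)
  have hlg0 : 0 ≤ lg0 := (norm_nonneg _).trans (hR.gradX_g_le 0 y₁ hy₁)
  refine ⟨fun x => (B.hasFDerivAt_F hμ hlf0 x).differentiableAt,
    B.exists_constants_and_schedules (by norm_num) hμ hlf0, ?_⟩
  rintro hbdd η C T ξ α₀ γ₀ lam₀ k₀ s₀ hη0 hη hC hT hV hz hy S rfl s rfl
  have hS := hV.isTracking hT hη0 hη hC.ρψ_pos hC.lψ1_pos hC.lf1_nonneg hC.one_le_ls0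
  have hlam0 : (polySchedule T ξ α₀ γ₀ lam₀ k₀).lam 0 = lam₀ := polySchedule_lam_zero hV.k₀_pos
  obtain ⟨Φ, b, hb, hsum⟩ :=
    exists_sum_gradient_le B hμ hlf0 hlg0 hη0 hη hC hS hbdd hlam0 hz.2 hy.2
  obtain ⟨D, hD, hrate⟩ :=
    polySchedule_rate hV.α₀_pos hV.lam₀_pos hV.k₀_pos hb (fun _ => sq_nonneg _) hsum
  exact ⟨fun k t _ => run_inner_mem_tube B hμ hlf0 hlg0 hη0 hη hC hS hlam0 hz.2 hy.2 k t,
    ⟨1, isBigO_iInf_of_rate (fun _ => sq_nonneg _) hD hrate⟩, complexity_of_rate hD hrate⟩
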